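/- **Setting.** Let $V:\mathbb{R}^d\to\mathbb{R}^d$ be monotone ($\langle V(z)-V(z'),z-z'\rangle\ge 0$ for all $z,z'$), $L$-smooth ($\|V(z)-V(z')\|\le L\|z-z'\|$ for all $z,z'$) and bounded ($\|V(x)\|\le G$ for all $x$), with Euclidean norms. Let $\widetilde V(\cdot,\xi)$, $\xi\sim\nu$, be an unbiased oracle with variance at most $\sigma^2$, $\sigma>0$: $\mathbb{E}_\xi[\widetilde V(z,\xi)]=V(z)$ and $\mathbb{E}_\xi\|V(z)-\widetilde V(z,\xi)\|^2\le\sigma^2$ for every $z$. Let $d,M,K,R,H\ge 1$ be integers, $T=KR$, and $D>0$. **Algorithm (SLIPPAX).** There are $M$ machines, and $z_0^m=0$ for $m=1,\dots,M$. For $t=1,\dots,T$, each machine $m$ sets $x_{t,0}^m=z_{t-1}^m$ and, for $\ell=1,\dots,H$, $$x^m_{t,\ell}=x^m_{t,\ell-1}-\gamma\Big(\widetilde V\big(x^m_{t,\ell-1}+\delta s^m_{t,\ell},\,\xi^m_{t,\ell}\big)+\tfrac1\eta\big(x^m_{t,\ell-1}-z^m_{t-1}\big)\Big),\qquad s^m_{t,\ell}\sim\mathcal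 N(0,I_d).$$ It sets $x_t^m=x_{t,H}^m$ and $w_t^m=z_{t-1}^m-\eta\widetilde V(x_t^m,\xi_{t,H+1}^m)$. Then $z_t^m=w_t^m$ if $K\nmid t$, and $z_t^m=\frac1M\sum_{m'=1}^M w_t^{m'}$ if $K\mid t$. All $\xi^m_{t,\ell}\sim\nu$ and all $s^m_{t,\ell}$ are independent. The output is $x_o=\frac1{MT}\sum_{m=1}^M\sum_{t=1}^T x_t^m$. **Theorem.** Let $$\eta=\min\left\{\frac{D^{1/2}}{K^{1/4}R^{1/4}L^{1/2}\sigma^{1/2}d^{1/8}},\ \frac{D^{2/5}}{\sigma^{2/5}L^{2/5}d^{1/10}K^{3/5}R^{1/5}},\ \frac{D^{2/3}}{K^{2/3}R^{1/3}\sigma^{2/3}L^{2/3}},\ \frac{D\sqrt M}{\sigma\sqrt{KR}},\ \frac1L\right\},$$ $\delta=\eta\sigma/\sqrt d$ and $\gamma=\frac{1}{\eta(L+1/\eta)^2}$. For every $L_0>0$ there is a constant $C>0$ that depends only on $L_0$ such that, whenever $L\ge L_0$, the random variable $\sup_{\|z\|\le D}\langle V(z),x_o-z\rangle$ is integrable and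 $$\mathbb{E}\Big[\sup_{\|z\|\le D}\langle V(z),x_o-z\rangle\Big]\le C\Bigg(\Big[\frac{D^2L}{KR}+\frac{D\sigma}{\sqrt{MKR}}+\frac{D^{4/3}\sigma^{2/3}L^{2/3}}{K^{1/3}R^{2/3}}\Big]+\Big[\frac{D^{3/2}L^{1/2}\sigma^{1/2}d^{1/8}}{K^{3/4}R^{3/4}}+\frac{D^{8/5}\sigma^{2/5}L^{2/5}d^{1/10}}{R^{4/5}K^{2/5}}\Big]+\Big(\frac34\Big)^{H}\Big[G^2+K^2L^2G^2+\frac{H^2L^2d^{1/2}G^4}{\sigma^2}\Big]\Bigg).$$ In particular, $C$ is an absolute constant for $L\ge 1$. No assumption on second derivatives of $V$ is made. -/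

import Mathlib

namespace Slippax

open MeasureTheory ProbabilityTheory

/-- `ℝ^d` with its Euclidean norm and inner product. -/
abbrev Vec (d : ℕ) : Type := EuclideanSpace ℝ (Fin d)

/-- Monotonicity of an operator `V : ℝ^d → ℝ^d`. -/
def MonotoneOperator {d : ℕ} (V : Vec d → Vec d) : Prop :=
  ∀ z z' : Vec d, 0 ≤ inner ℝ (V z - V z') (z - z')

/-- `L`-smoothness of an operator, that is, Lipschitz continuity with constant `L`. -/
def SmoothOperator {d : ℕ} (L : ℝ) (V : Vec d → Vec d) : Prop :=
  ∀ z z' : Vec d, ‖V z - V z'‖ ≤ L * ‖z - z'‖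

/-- `Vt` is an unbiased stochastic oracle for `V`, with samples of law `ν` and variance at most
`σ ^ 2`. -/
structure UnbiasedOracle {d : ℕ} {Ξ : Type*} [MeasurableSpace Ξ] (ν : Measure Ξ)
    (Vt : Vec d → Ξ → Vec d) (V : Vec d → Vec d) (σ : ℝ) : Prop where
  measurable : Measurable fun p : Vec d × Ξ => Vt p.1 p.2
  integrable : ∀ z, Integrable (Vt z) ν
  unbiased : ∀ z, ∫ ξ, Vt z ξ ∂ν = V z
  integrable_sq : ∀ z, Integrable (fun ξ => ‖V z - Vt z ξ‖ ^ 2) ν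
  variance_le : ∀ z, ∫ ξ, ‖V z - Vt z ξ‖ ^ 2 ∂ν ≤ σ ^ 2

/-- The randomness of the algorithm. In iteration `t`, machine `m` makes `H + 1` oracle queries,
numbered `ℓ = 1, …, H` (inner loop) and `ℓ = H + 1` (outer step); the query `ℓ` consumes the oracle
sample `ξ t m ℓ`, and the inner query `ℓ ≤ H` also consumes the Gaussian vector `s t m ℓ`.
The samples `ξ t m ℓ` are i.i.d. with law `ν`, the vectors `s t m ℓ` are i.i.d. standard Gaussian,
and the two families are independent of each other. -/
structure IndependentSamples {d M : ℕ} {Ξ Ω : Type*} [MeasurableSpace Ξ] [MeasurableSpace Ω]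
    (P : Measure Ω) (ν : Measure Ξ) (s : ℕ → Fin M → ℕ → Ω → Vec d)
    (ξ : ℕ → Fin M → ℕ → Ω → Ξ) : Prop where
  measurable_gauss : ∀ t m ℓ, Measurable (s t m ℓ)
  measurable_sample : ∀ t m ℓ, Measurable (ξ t m ℓ)
  law_gauss : ∀ t m ℓ, P.map (s t m ℓ) = stdGaussian (Vec d)
  law_sample : ∀ t m ℓ, P.map (ξ t m ℓ) = ν
  indep_gauss : iIndepFun (fun i : ℕ × Fin M × ℕ => s i.1 i.2.1 i.2.2) P
  indep_sample : iIndepFun (fun i : ℕ × Fin M × ℕ => ξ i.1 i.2.1 i.2.2) P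
  indep_gauss_sample :
    IndepFun (fun ω (i : ℕ × Fin M × ℕ) => s i.1 i.2.1 i.2.2 ω)
      (fun ω (i : ℕ × Fin M × ℕ) => ξ i.1 i.2.1 i.2.2 ω) P

section Algorithm

variable {d M : ℕ} {Ξ : Type*}

/-- The inner loop on one machine, started at `z`: the iterate after `ℓ` steps, for the realized
Gaussian vectors `s 1, s 2, …` and oracle samples `ξ 1, ξ 2, …`. -/
noncomputable def innerIter (Vt : Vec d → Ξ → Vec d) (η γ δ : ℝ) (z : Vec d)
    (s : ℕ → Vec d) (ξ : ℕ → Ξ) : ℕ → Vec d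
  | 0 => z
  | ℓ + 1 =>
    innerIter Vt η γ δ z s ξ ℓ -
      γ • (Vt (innerIter Vt η γ δ z s ξ ℓ + δ • s (ℓ + 1)) (ξ (ℓ + 1)) +
        (1 / η) • (innerIter Vt η γ δ z s ξ ℓ - z))

/-- The iterate `z_t^m`, with initialization at the origin and averaging over the machines whenever
`K` divides `t`. -/
noncomputable def outerIter (Vt : Vec d → Ξ → Vec d) (η γ δ : ℝ) (K H : ℕ)
    (s : ℕ → Fin M → ℕ → Vec d) (ξ : ℕ → Fin M → ℕ → Ξ) : ℕ → Fin M → Vec d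
  | 0 => fun _ => 0
  | t + 1 =>
    let w : Fin M → Vec d := fun m =>
      outerIter Vt η γ δ K H s ξ t m -
        η • Vt (innerIter Vt η γ δ (outerIter Vt η γ δ K H s ξ t m) (s (t + 1) m) (ξ (t + 1) m) H)
          (ξ (t + 1) m (H + 1))
    if (t + 1) % K = 0 then fun _ => (1 / (M : ℝ)) • ∑ m, w m else w

/-- The point `x_t^m`, for `1 ≤ t`: the result of the `H` inner steps of machine `m` in iteration
`t`, started at `z_{t-1}^m`. -/
noncomputable def proxIter (Vt : Vec d → Ξ → Vec d) (η γ δ : ℝ) (K H : ℕ)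
    (s : ℕ → Fin M → ℕ → Vec d) (ξ : ℕ → Fin M → ℕ → Ξ) (t : ℕ) (m : Fin M) : Vec d :=
  innerIter Vt η γ δ (outerIter Vt η γ δ K H s ξ (t - 1) m) (s t m) (ξ t m) H

/-- The output `x_o` of SLIPPAX after `T` iterations: the average of all `x_t^m`. -/
noncomputable def output (Vt : Vec d → Ξ → Vec d) (η γ δ : ℝ) (K H T : ℕ)
    (s : ℕ → Fin M → ℕ → Vec d) (ξ : ℕ → Fin M → ℕ → Ξ) : Vec d :=
  (1 / ((M : ℝ) * (T : ℝ))) • ∑ m : Fin M, ∑ t ∈ Finset.Icc 1 T, proxIter Vt η γ δ K H s ξ t m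

end Algorithm

/-- The restricted gap `sup_{‖z‖ ≤ D} ⟨V z, x - z⟩`. The ball is centred at the common starting
point `0` of the machines. -/
noncomputable def gap {d : ℕ} (V : Vec d → Vec d) (D : ℝ) (x : Vec d) : ℝ :=
  sSup ((fun z : Vec d => inner ℝ (V z) (x - z)) '' {z | ‖z‖ ≤ D})

/-- The outer step size `η`. -/
noncomputable def stepSize (d M K R : ℕ) (L σ D : ℝ) : ℝ :=
  min (D ^ (1 / 2 : ℝ) /
      ((K : ℝ) ^ (1 / 4 : ℝ) * (R : ℝ) ^ (1 / 4 : ℝ) * L ^ (1 / 2 : ℝ) * σ ^ (1 / 2 : ℝ) *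
        (d : ℝ) ^ (1 / 8 : ℝ)))
    (min (D ^ (2 / 5 : ℝ) /
        (σ ^ (2 / 5 : ℝ) * L ^ (2 / 5 : ℝ) * (d : ℝ) ^ (1 / 10 : ℝ) * (K : ℝ) ^ (3 / 5 : ℝ) *
          (R : ℝ) ^ (1 / 5 : ℝ)))
      (min (D ^ (2 / 3 : ℝ) /
          ((K : ℝ) ^ (2 / 3 : ℝ) * (R : ℝ) ^ (1 / 3 : ℝ) * σ ^ (2 / 3 : ℝ) * L ^ (2 / 3 : ℝ)))
        (min (D * √(M : ℝ) / (σ * √((K : ℝ) * (R : ℝ)))) (1 / L))))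

/-- The smoothing radius `δ = η σ / √d`. -/
noncomputable def smoothingRadius (d : ℕ) (η σ : ℝ) : ℝ := η * σ / √(d : ℝ)

/-- The inner step size `γ = 1 / (η (L + 1/η)^2)`. -/
noncomputable def innerStepSize (η L : ℝ) : ℝ := 1 / (η * (L + 1 / η) ^ 2)

end Slippax

/-!
Up to inexactness, a machine iterates the proximal step `z ↦ z - η V((1 + η V)⁻¹ z)`: the inner
loop contracts towards the resolvent `(1 + η V)⁻¹ z`. Its result has a mean square error of order
`(η σ)²`, but conditionally on the past its bias is only of order `η² L σ`: the noise has mean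
zero and enters the mean only through the increments of `V`, which costs a factor `η L`.

Expanding `‖z_t - z‖²` for the mean iterate and telescoping bounds the gap by `D² / (η T)`, a
variance term in which the averaging over the machines gains a factor `1 / M`, and the pairings
`⟨V x^m - V x^m', z^m - z^m'⟩` of different machines. At exact proximal points these are the
pairings of the Yosida approximation of `V`. They are bounded by `L` times the squared distance of
the iterates, and they are also what an exact proximal step subtracts from that distance. As the
distance is reset to `0` every `K` steps, either the first fact or the telescoped second one
bounds them, depending on the size of `K (η L)²`. All remaining errors are dominated by the
resulting drift term, because `η L ≤ 1` and `L ≥ L₀`.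
-/

namespace Slippax

open MeasureTheory ProbabilityTheory

section Resolvent

variable {E : Type*} [NormedAddCommGroup E] [InnerProductSpace ℝ E] {V : E → E} {L G η γ : ℝ}

/-- A monotone operator on a real inner product space that is Lipschitz with constant `L`. For
such `V` and `0 < η`, the map `x ↦ x + η • V x` is bijective if the space is complete. -/
structure MonotoneLipschitz (L : ℝ) (V : E → E) : Prop where
  nonneg : 0 ≤ L
  monotone : ∀ x y, 0 ≤ inner ℝ (V x - V y) (x - y)
  norm_sub_le : ∀ x y, ‖V x - V y‖ ≤ L * ‖x - y‖

lemma MonotoneLipschitz.lipschitzWith (hV : MonotoneLipschitz L V) :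
    LipschitzWith L.toNNReal V := by
  refine LipschitzWith.of_dist_le_mul fun x y => ?_
  simpa only [dist_eq_norm, Real.coe_toNNReal _ hV.nonneg] using hV.norm_sub_le x y

lemma MonotoneLipschitz.measurable [MeasurableSpace E] [BorelSpace E]
    (hV : MonotoneLipschitz L V) : Measurable V :=
  hV.lipschitzWith.continuous.measurable

lemma norm_sub_smul_sq_le {u f : E} {μ Λ : ℝ} (hγ : 0 ≤ γ) (hμ : μ * ‖u‖ ^ 2 ≤ inner ℝ u f)
    (hΛ : ‖f‖ ≤ Λ * ‖u‖) : ‖u - γ • f‖ ^ 2 ≤ (1 - 2 * γ * μ + γ ^ 2 * Λ ^ 2) * ‖u‖ ^ 2 := by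
  have hinner : γ * (μ * ‖u‖ ^ 2) ≤ γ * inner ℝ u f := by gcongr
  have hnorm : γ ^ 2 * ‖f‖ ^ 2 ≤ γ ^ 2 * (Λ * ‖u‖) ^ 2 := by gcongr
  rw [norm_sub_sq_real, inner_smul_right, norm_smul, mul_pow, Real.norm_eq_abs, sq_abs]
  linarith

/-- The gradient step of size `γ` on the regularized operator `x ↦ V x + (x - z) / η`, whose zero is
the resolvent of `V` at `z`. It is the inner step of the algorithm without noise. -/
noncomputable def proxStep (V : E → E) (η γ : ℝ) (z x : E) : E :=
  x - γ • (V x + (1 / η) • (x - z))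

lemma innerStepSize_pos (hη : 0 < η) (hL : 0 ≤ L) : 0 < innerStepSize η L := by
  rw [innerStepSize]; positivity

lemma innerStepSize_div (hη : 0 < η) (hL : 0 ≤ L) :
    innerStepSize η L / η = 1 / (1 + η * L) ^ 2 := by
  have hηL : L + 1 / η = (1 + η * L) / η := by field_simp; ring
  rw [innerStepSize, hηL]
  field_simp

lemma norm_proxStep_sub_sq_le (hV : MonotoneLipschitz L V) (hη : 0 < η) (z x y : E) :
    ‖proxStep V η (innerStepSize η L) z x - proxStep V η (innerStepSize η L) z y‖ ^ 2 ≤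
      (1 - innerStepSize η L / η) * ‖x - y‖ ^ 2 := by
  have hL := hV.nonneg
  set γ := innerStepSize η L with hγ
  have hdiff : proxStep V η γ z x - proxStep V η γ z y =
      (x - y) - γ • (V x - V y + (1 / η) • (x - y)) := by
    simp only [proxStep]; module
  have hfactor : 1 - 2 * γ * (1 / η) + γ ^ 2 * (L + 1 / η) ^ 2 = 1 - γ / η := by
    rw [hγ, innerStepSize]; field_simp; ring
  rw [hdiff, ← hfactor]
  refine norm_sub_smul_sq_le (innerStepSize_pos hη hL).le ?_ ?_
  · rw [inner_add_right, inner_smul_right, real_inner_self_eq_norm_sq, real_inner_comm]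
    linarith [hV.monotone x y]
  · calc ‖V x - V y + (1 / η) • (x - y)‖ ≤ ‖V x - V y‖ + ‖(1 / η) • (x - y)‖ := norm_add_le _ _
      _ ≤ L * ‖x - y‖ + 1 / η * ‖x - y‖ := by
        rw [norm_smul, Real.norm_of_nonneg (by positivity)]
        gcongr
        exact hV.norm_sub_le x y
      _ = (L + 1 / η) * ‖x - y‖ := by ring

lemma innerStepSize_div_pos (hη : 0 < η) (hL : 0 ≤ L) : 0 < innerStepSize η L / η :=
  div_pos (innerStepSize_pos hη hL) hη

lemma innerStepSize_div_le_one (hη : 0 < η) (hL : 0 ≤ L) : innerStepSize η L / η ≤ 1 := by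
  rw [innerStepSize_div hη hL, div_le_one (by positivity)]
  exact one_le_pow₀ (le_add_of_nonneg_right (by positivity))

lemma norm_proxStep_sub_le (hV : MonotoneLipschitz L V) (hη : 0 < η) (z x y : E) :
    ‖proxStep V η (innerStepSize η L) z x - proxStep V η (innerStepSize η L) z y‖ ≤
      √(1 - innerStepSize η L / η) * ‖x - y‖ := by
  have hq : 0 ≤ 1 - innerStepSize η L / η :=
    sub_nonneg.mpr (innerStepSize_div_le_one hη hV.nonneg)
  rw [← Real.sqrt_sq (norm_nonneg (x - y)), ← Real.sqrt_mul hq]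
  exact Real.le_sqrt_of_sq_le (norm_proxStep_sub_sq_le hV hη z x y)

lemma proxStep_eq_self_iff (hη : η ≠ 0) (hγ : γ ≠ 0) {z x : E} :
    proxStep V η γ z x = x ↔ x + η • V x = z := by
  have hzero : V x + (1 / η) • (x - z) = (1 / η) • (x + η • V x - z) := by
    match_scalars <;> field_simp
  rw [proxStep, sub_eq_self, smul_eq_zero_iff_right hγ, hzero,
    smul_eq_zero_iff_right (one_div_ne_zero hη), sub_eq_zero]

open Classical in
/-- The resolvent `(1 + η V)⁻¹`, with junk value `0` at the points outside the range of
`1 + η V`. -/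
noncomputable def resolvent (V : E → E) (η : ℝ) (z : E) : E :=
  if h : ∃ x, x + η • V x = z then h.choose else 0

/-- The monotonicity gap `⟨A z - A z', z - z'⟩` of the Yosida approximation `A = V ∘ resolvent V η`.
It measures how much an exact proximal step brings two points closer together. -/
noncomputable def yosidaPairing (V : E → E) (η : ℝ) (z z' : E) : ℝ :=
  inner ℝ (V (resolvent V η z) - V (resolvent V η z')) (z - z')

variable [CompleteSpace E]

lemma exists_add_smul_eq (hV : MonotoneLipschitz L V) (hη : 0 < η) (z : E) :
    ∃ x, x + η • V x = z := by
  have hL := hV.nonneg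
  have hcontr : ContractingWith (√(1 - innerStepSize η L / η)).toNNReal
      (proxStep V η (innerStepSize η L) z) := by
    refine ⟨?_, LipschitzWith.of_dist_le_mul fun x y => ?_⟩
    · rw [Real.toNNReal_lt_one, Real.sqrt_lt' one_pos]
      linarith [innerStepSize_div_pos hη hL]
    · simpa only [dist_eq_norm, Real.coe_toNNReal _ (Real.sqrt_nonneg _)] using
        norm_proxStep_sub_le hV hη z x y
  exact ⟨hcontr.fixedPoint, (proxStep_eq_self_iff hη.ne' (innerStepSize_pos hη hL).ne').mp
    hcontr.fixedPoint_isFixedPt⟩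

lemma resolvent_add (hV : MonotoneLipschitz L V) (hη : 0 < η) (z : E) :
    resolvent V η z + η • V (resolvent V η z) = z := by
  have hex := exists_add_smul_eq hV hη z
  rw [resolvent, dif_pos hex]
  exact hex.choose_spec

lemma sub_resolvent (hV : MonotoneLipschitz L V) (hη : 0 < η) (z : E) :
    z - resolvent V η z = η • V (resolvent V η z) :=
  sub_eq_iff_eq_add'.mpr (resolvent_add hV hη z).symm

lemma sub_sub_smul_eq (hV : MonotoneLipschitz L V) (hη : 0 < η) (x z : E) :
    z - x - η • V x =
      -((x - resolvent V η z) + η • (V x - V (resolvent V η z))) := by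
  nth_rw 1 [← resolvent_add hV hη z]
  module

lemma proxStep_resolvent (hV : MonotoneLipschitz L V) (hη : 0 < η) (hγ : γ ≠ 0) (z : E) :
    proxStep V η γ z (resolvent V η z) = resolvent V η z :=
  (proxStep_eq_self_iff hη.ne' hγ).mpr (resolvent_add hV hη z)

lemma norm_sub_resolvent_le (hV : MonotoneLipschitz L V) (hη : 0 < η) (hG : ∀ x, ‖V x‖ ≤ G)
    (z : E) : ‖z - resolvent V η z‖ ≤ η * G := by
  rw [sub_resolvent hV hη, norm_smul, Real.norm_of_nonneg hη.le]
  gcongr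
  exact hG _

lemma sub_eq_resolvent_sub_add (hV : MonotoneLipschitz L V) (hη : 0 < η) (z z' : E) :
    z - z' = (resolvent V η z - resolvent V η z') +
      η • (V (resolvent V η z) - V (resolvent V η z')) := by
  conv_lhs => rw [← resolvent_add hV hη z, ← resolvent_add hV hη z']
  module

lemma mul_norm_sq_le_yosidaPairing (hV : MonotoneLipschitz L V) (hη : 0 < η) (z z' : E) :
    η * ‖V (resolvent V η z) - V (resolvent V η z')‖ ^ 2 ≤ yosidaPairing V η z z' := by
  rw [yosidaPairing, sub_eq_resolvent_sub_add hV hη z z', inner_add_right, inner_smul_right,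
    real_inner_self_eq_norm_sq]
  exact le_add_of_nonneg_left (hV.monotone _ _)

lemma yosidaPairing_nonneg (hV : MonotoneLipschitz L V) (hη : 0 < η) (z z' : E) :
    0 ≤ yosidaPairing V η z z' :=
  (by positivity : 0 ≤ η * ‖V (resolvent V η z) - V (resolvent V η z')‖ ^ 2).trans
    (mul_norm_sq_le_yosidaPairing hV hη z z')

lemma norm_resolvent_sub_sq_le (hV : MonotoneLipschitz L V) (hη : 0 < η) (z z' : E) :
    ‖resolvent V η z - resolvent V η z'‖ ^ 2 ≤ ‖z - z'‖ ^ 2 - η * yosidaPairing V η z z' := by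
  have hdiff := eq_sub_of_add_eq (sub_eq_resolvent_sub_add hV hη z z').symm
  have hge := mul_le_mul_of_nonneg_left (mul_norm_sq_le_yosidaPairing hV hη z z') hη.le
  rw [hdiff, norm_sub_sq_real, inner_smul_right, norm_smul, mul_pow, Real.norm_eq_abs, sq_abs,
    real_inner_comm, ← yosidaPairing]
  linarith

lemma norm_resolvent_sub_le (hV : MonotoneLipschitz L V) (hη : 0 < η) (z z' : E) :
    ‖resolvent V η z - resolvent V η z'‖ ≤ ‖z - z'‖ := by
  refine le_of_sq_le_sq ((norm_resolvent_sub_sq_le hV hη z z').trans ?_) (norm_nonneg _)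
  exact sub_le_self _ (mul_nonneg hη.le (yosidaPairing_nonneg hV hη z z'))

lemma yosidaPairing_le (hV : MonotoneLipschitz L V) (hη : 0 < η) (z z' : E) :
    yosidaPairing V η z z' ≤ L * ‖z - z'‖ ^ 2 := by
  have hL := hV.nonneg
  calc yosidaPairing V η z z'
      ≤ ‖V (resolvent V η z) - V (resolvent V η z')‖ * ‖z - z'‖ := real_inner_le_norm _ _
    _ ≤ (L * ‖z - z'‖) * ‖z - z'‖ := by
      gcongr
      exact (hV.norm_sub_le _ _).trans (by gcongr; exact norm_resolvent_sub_le hV hη z z')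
    _ = L * ‖z - z'‖ ^ 2 := by ring

lemma measurable_resolvent [MeasurableSpace E] [BorelSpace E] (hV : MonotoneLipschitz L V)
    (hη : 0 < η) : Measurable (resolvent V η) := by
  refine (LipschitzWith.of_dist_le_mul (K := 1) fun x y => ?_).continuous.measurable
  simpa only [dist_eq_norm, NNReal.coe_one, one_mul] using norm_resolvent_sub_le hV hη x y

end Resolvent

section SecondMoments

variable {Ω E F : Type*} [MeasurableSpace Ω] {P : Measure Ω} [NormedAddCommGroup E]
  [NormedAddCommGroup F]

lemma lpNorm_two_eq_sqrt {f : Ω → E} (hf : MemLp f 2 P) :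
    lpNorm f 2 P = √(∫ ω, ‖f ω‖ ^ 2 ∂P) := by
  rw [lpNorm_eq_integral_norm_rpow_toReal two_ne_zero ENNReal.ofNat_ne_top hf.aestronglyMeasurable,
    Real.sqrt_eq_rpow]
  simp

lemma lpNorm_two_sq {f : Ω → E} (hf : MemLp f 2 P) :
    lpNorm f 2 P ^ 2 = ∫ ω, ‖f ω‖ ^ 2 ∂P := by
  rw [lpNorm_two_eq_sqrt hf, Real.sq_sqrt (integral_nonneg fun _ => sq_nonneg _)]

lemma integral_norm_le_lpNorm_two [IsProbabilityMeasure P] {f : Ω → E} (hf : MemLp f 2 P) :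
    ∫ ω, ‖f ω‖ ∂P ≤ lpNorm f 2 P := by
  rw [← lpNorm_one_eq_integral_norm hf.aestronglyMeasurable,
    ← toReal_eLpNorm hf.aestronglyMeasurable, ← toReal_eLpNorm hf.aestronglyMeasurable]
  exact ENNReal.toReal_mono hf.eLpNorm_ne_top
    (eLpNorm_le_eLpNorm_of_exponent_le one_le_two hf.aestronglyMeasurable)

lemma lpNorm_le_of_eLpNorm_le {f : Ω → E} {p : ENNReal} {c : ℝ} (hc : 0 ≤ c)
    (hf : AEStronglyMeasurable f P) (h : eLpNorm f p P ≤ ENNReal.ofReal c) : lpNorm f p P ≤ c := by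
  rw [← toReal_eLpNorm hf]
  exact ENNReal.toReal_le_of_le_ofReal hc h

lemma lpNorm_le_add_of_norm_le {f : Ω → E} {g : Ω → F} {G : Type*} [NormedAddCommGroup G]
    {h : Ω → G} {p : ENNReal} {a b : ℝ} (hf : MemLp f p P) (hg : MemLp g p P) (hp : 1 ≤ p)
    (ha : 0 ≤ a) (hb : 0 ≤ b) (h_le : ∀ ω, ‖h ω‖ ≤ a * ‖f ω‖ + b * ‖g ω‖) :
    lpNorm h p P ≤ a * lpNorm f p P + b * lpNorm g p P := by
  have hf' := hf.norm.const_smul a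
  have hg' := hg.norm.const_smul b
  calc lpNorm h p P ≤ lpNorm (a • (fun ω => ‖f ω‖) + b • fun ω => ‖g ω‖) p P :=
        lpNorm_mono_real (hf'.add hg') h_le
    _ ≤ lpNorm (a • fun ω => ‖f ω‖) p P + lpNorm (b • fun ω => ‖g ω‖) p P :=
        lpNorm_add_le hf' hp
    _ = a * lpNorm f p P + b * lpNorm g p P := by
        rw [lpNorm_const_smul, lpNorm_const_smul, lpNorm_norm hf.aestronglyMeasurable,
          lpNorm_norm hg.aestronglyMeasurable, coe_nnnorm, coe_nnnorm, Real.norm_of_nonneg ha,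
          Real.norm_of_nonneg hb]

variable [InnerProductSpace ℝ E] {f g : Ω → E}

lemma integrable_inner_of_memLp (hf : MemLp f 2 P) (hg : MemLp g 2 P) :
    Integrable (fun ω => inner ℝ (f ω) (g ω)) P :=
  (hf.norm.integrable_mul hg.norm).mono' (hf.aestronglyMeasurable.inner hg.aestronglyMeasurable)
    (.of_forall fun _ => norm_inner_le_norm _ _)

lemma integral_norm_add_sq (hf : MemLp f 2 P) (hg : MemLp g 2 P) :
    ∫ ω, ‖f ω + g ω‖ ^ 2 ∂P =
      ∫ ω, ‖f ω‖ ^ 2 ∂P + 2 * ∫ ω, inner ℝ (f ω) (g ω) ∂P + ∫ ω, ‖g ω‖ ^ 2 ∂P := by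
  have hinner := (integrable_inner_of_memLp hf hg).const_mul 2
  have hsum : Integrable (fun ω => ‖f ω‖ ^ 2 + 2 * inner ℝ (f ω) (g ω)) P :=
    hf.norm.integrable_sq.add hinner
  simp_rw [norm_add_sq_real]
  rw [integral_add hsum hg.norm.integrable_sq, integral_add hf.norm.integrable_sq hinner,
    integral_const_mul]

lemma lpNorm_two_add_sq_of_integral_inner_eq_zero (hf : MemLp f 2 P) (hg : MemLp g 2 P)
    (horth : ∫ ω, inner ℝ (f ω) (g ω) ∂P = 0) :
    lpNorm (f + g) 2 P ^ 2 = lpNorm f 2 P ^ 2 + lpNorm g 2 P ^ 2 := by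
  simp only [lpNorm_two_sq (hf.add hg), lpNorm_two_sq hf, lpNorm_two_sq hg, Pi.add_apply,
    integral_norm_add_sq hf hg, horth, mul_zero, add_zero]

end SecondMoments

section Decoupling

variable {Ω α β E : Type*} [MeasurableSpace Ω] [MeasurableSpace α] [MeasurableSpace β]
  {P : Measure Ω} [IsFiniteMeasure P] {X : Ω → α} {Y : Ω → β}

lemma lintegral_decouple (hX : Measurable X) (hY : Measurable Y) (hXY : IndepFun X Y P)
    {f : α × β → ENNReal} (hf : Measurable f) :
    ∫⁻ ω, f (X ω, Y ω) ∂P = ∫⁻ ω, ∫⁻ ω', f (X ω, Y ω') ∂P ∂P := by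
  rw [← lintegral_map hf (hX.prodMk hY),
    hXY.map_prod_eq_prod_map_map hX.aemeasurable hY.aemeasurable, lintegral_prod _ hf.aemeasurable,
    lintegral_map hf.lintegral_prod_right' hX]
  exact lintegral_congr fun ω => lintegral_map (by fun_prop) hY

lemma integral_decouple (hX : Measurable X) (hY : Measurable Y) (hXY : IndepFun X Y P)
    [NormedAddCommGroup E] [NormedSpace ℝ E] {f : α × β → E} (hf : StronglyMeasurable f)
    (hinteg : Integrable (fun ω => f (X ω, Y ω)) P) :
    ∫ ω, f (X ω, Y ω) ∂P = ∫ ω, ∫ ω', f (X ω, Y ω') ∂P ∂P := by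
  have hlaw := hXY.map_prod_eq_prod_map_map hX.aemeasurable hY.aemeasurable
  have hprod : Integrable f ((P.map X).prod (P.map Y)) := by
    rw [← hlaw]
    exact (integrable_map_measure hf.aestronglyMeasurable (hX.prodMk hY).aemeasurable).mpr hinteg
  rw [← integral_map (f := f) (hX.prodMk hY).aemeasurable hf.aestronglyMeasurable, hlaw,
    integral_prod _ hprod,
    integral_map hX.aemeasurable hprod.integral_prod_left.aestronglyMeasurable]
  exact integral_congr_ae (.of_forall fun ω => integral_map hY.aemeasurable
    (hf.comp_measurable measurable_prodMk_left).aestronglyMeasurable)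

variable [NormedAddCommGroup E] [MeasurableSpace E] [BorelSpace E]

lemma eLpNorm_le_of_indepFun {Ω : Type*} [MeasurableSpace Ω] {P : Measure Ω}
    [IsProbabilityMeasure P] {X : Ω → α} {Y : Ω → β} (hX : Measurable X) (hY : Measurable Y)
    (hXY : IndepFun X Y P) {h : α × β → E} (hh : Measurable h) {p c : ENNReal} (hp₀ : p ≠ 0)
    (hp : p ≠ ⊤) (hb : ∀ x, eLpNorm (fun ω => h (x, Y ω)) p P ≤ c) :
    eLpNorm (fun ω => h (X ω, Y ω)) p P ≤ c := by
  have hp_pos : 0 < p.toReal := ENNReal.toReal_pos hp₀ hp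
  simp only [eLpNorm_eq_lintegral_rpow_enorm_toReal hp₀ hp, one_div,
    ENNReal.rpow_inv_le_iff hp_pos] at hb ⊢
  rw [lintegral_decouple hX hY hXY (f := fun q => ‖h q‖ₑ ^ p.toReal) (by fun_prop)]
  exact (lintegral_mono fun ω => hb (X ω)).trans (by simp)

lemma abs_integral_inner_le_of_indepFun [InnerProductSpace ℝ E] [SecondCountableTopology E]
    [CompleteSpace E] (hX : Measurable X) (hY : Measurable Y) (hXY : IndepFun X Y P) {φ : α → E}
    (hφ : Measurable φ) {h : α × β → E} (hh : Measurable h) (hφX : MemLp (fun ω => φ (X ω)) 2 P)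
    (hhXY : MemLp (fun ω => h (X ω, Y ω)) 2 P) (hinteg : ∀ x, Integrable (fun ω => h (x, Y ω)) P)
    {b : ℝ} (hb : ∀ x, ‖∫ ω, h (x, Y ω) ∂P‖ ≤ b) :
    |∫ ω, inner ℝ (φ (X ω)) (h (X ω, Y ω)) ∂P| ≤ b * ∫ ω, ‖φ (X ω)‖ ∂P := by
  rw [integral_decouple hX hY hXY (f := fun q => inner ℝ (φ q.1) (h q))
    ((hφ.comp measurable_fst).inner hh).stronglyMeasurable (integrable_inner_of_memLp hφX hhXY),
    ← Real.norm_eq_abs, ← integral_const_mul]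
  refine norm_integral_le_of_norm_le ((hφX.integrable one_le_two).norm.const_mul b)
    (.of_forall fun ω => ?_)
  calc ‖∫ ω', inner ℝ (φ (X ω)) (h (X ω, Y ω')) ∂P‖
      = ‖inner ℝ (φ (X ω)) (∫ ω', h (X ω, Y ω') ∂P)‖ := by rw [integral_inner (hinteg _)]
    _ ≤ ‖φ (X ω)‖ * ‖∫ ω', h (X ω, Y ω') ∂P‖ := norm_inner_le_norm _ _
    _ ≤ ‖φ (X ω)‖ * b := by gcongr; exact hb _
    _ = b * ‖φ (X ω)‖ := mul_comm _ _

end Decoupling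

section OracleNoise

variable {Ω Ξ : Type*} [MeasurableSpace Ω] [MeasurableSpace Ξ] {P : Measure Ω}
  [IsProbabilityMeasure P] {ν : Measure Ξ} {d : ℕ} {Vt : Vec d → Ξ → Vec d} {V : Vec d → Vec d}
  {σ : ℝ} {X : Ω → Vec d} {Y : Ω → Ξ}

lemma UnbiasedOracle.measurable_sub (ho : UnbiasedOracle ν Vt V σ) (hV : Measurable V) :
    Measurable fun p : Vec d × Ξ => Vt p.1 p.2 - V p.1 :=
  ho.measurable.sub (hV.comp measurable_fst)

lemma UnbiasedOracle.eLpNorm_sub_le (ho : UnbiasedOracle ν Vt V σ) (hV : Measurable V)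
    (hσ : 0 ≤ σ) (x : Vec d) : eLpNorm (fun ξ => Vt x ξ - V x) 2 ν ≤ ENNReal.ofReal σ := by
  have hmeas : AEStronglyMeasurable (fun ξ => Vt x ξ - V x) ν :=
    ((ho.measurable_sub hV).comp measurable_prodMk_left).aestronglyMeasurable
  have hL2 : MemLp (fun ξ => Vt x ξ - V x) 2 ν := by
    rw [memLp_two_iff_integrable_sq_norm hmeas]
    simpa only [norm_sub_rev] using ho.integrable_sq x
  rw [← ofReal_lpNorm hL2, lpNorm_two_eq_sqrt hL2]
  refine ENNReal.ofReal_le_ofReal (Real.sqrt_le_iff.mpr ⟨hσ, ?_⟩)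
  simpa only [norm_sub_rev] using ho.variance_le x

lemma UnbiasedOracle.eLpNorm_noise_le (ho : UnbiasedOracle ν Vt V σ) (hV : Measurable V)
    (hσ : 0 ≤ σ) (hX : Measurable X) (hY : Measurable Y) (hlaw : P.map Y = ν)
    (hXY : IndepFun X Y P) :
    eLpNorm (fun ω => Vt (X ω) (Y ω) - V (X ω)) 2 P ≤ ENNReal.ofReal σ := by
  refine eLpNorm_le_of_indepFun hX hY hXY (ho.measurable_sub hV) two_ne_zero
    ENNReal.ofNat_ne_top fun x => ?_
  have hx : Measurable fun ξ => Vt x ξ - V x := (ho.measurable_sub hV).comp measurable_prodMk_left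
  have hbound := ho.eLpNorm_sub_le hV hσ x
  rwa [← hlaw, eLpNorm_map_measure hx.aestronglyMeasurable hY.aemeasurable] at hbound

lemma UnbiasedOracle.memLp_noise (ho : UnbiasedOracle ν Vt V σ) (hV : Measurable V)
    (hσ : 0 ≤ σ) (hX : Measurable X) (hY : Measurable Y) (hlaw : P.map Y = ν)
    (hXY : IndepFun X Y P) : MemLp (fun ω => Vt (X ω) (Y ω) - V (X ω)) 2 P :=
  ⟨((ho.measurable_sub hV).comp (hX.prodMk hY)).aestronglyMeasurable,
    (ho.eLpNorm_noise_le hV hσ hX hY hlaw hXY).trans_lt ENNReal.ofReal_lt_top⟩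

lemma UnbiasedOracle.lpNorm_noise_le (ho : UnbiasedOracle ν Vt V σ) (hV : Measurable V)
    (hσ : 0 ≤ σ) (hX : Measurable X) (hY : Measurable Y) (hlaw : P.map Y = ν)
    (hXY : IndepFun X Y P) : lpNorm (fun ω => Vt (X ω) (Y ω) - V (X ω)) 2 P ≤ σ :=
  lpNorm_le_of_eLpNorm_le hσ (ho.memLp_noise hV hσ hX hY hlaw hXY).aestronglyMeasurable
    (ho.eLpNorm_noise_le hV hσ hX hY hlaw hXY)

lemma UnbiasedOracle.integrable_sub_comp (ho : UnbiasedOracle ν Vt V σ) (hY : Measurable Y)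
    (hlaw : P.map Y = ν) (x : Vec d) : Integrable (fun ω => Vt x (Y ω) - V x) P := by
  have hinteg := ho.integrable x
  rw [← hlaw] at hinteg
  exact ((integrable_map_measure hinteg.aestronglyMeasurable hY.aemeasurable).mp hinteg).sub
    (integrable_const (V x))

lemma UnbiasedOracle.integral_sub_comp (ho : UnbiasedOracle ν Vt V σ) (hY : Measurable Y)
    (hlaw : P.map Y = ν) (x : Vec d) : ∫ ω, (Vt x (Y ω) - V x) ∂P = 0 := by
  have hinteg := ho.integrable x
  have hmean := ho.unbiased x
  rw [← hlaw] at hinteg hmean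
  rw [integral_map hY.aemeasurable hinteg.aestronglyMeasurable] at hmean
  rw [integrable_map_measure hinteg.aestronglyMeasurable hY.aemeasurable] at hinteg
  rw [integral_sub (f := fun ω => Vt x (Y ω)) hinteg (integrable_const _), hmean]
  simp

lemma UnbiasedOracle.integral_inner_noise (ho : UnbiasedOracle ν Vt V σ) (hV : Measurable V)
    (hσ : 0 ≤ σ) {φ : Ω → Vec d} (hφ : Measurable φ) (hφ_memLp : MemLp φ 2 P) (hX : Measurable X)
    (hY : Measurable Y) (hlaw : P.map Y = ν) (hXY : IndepFun (fun ω => (φ ω, X ω)) Y P) :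
    ∫ ω, inner ℝ (φ ω) (Vt (X ω) (Y ω) - V (X ω)) ∂P = 0 := by
  have hmeas : Measurable fun p : (Vec d × Vec d) × Ξ => Vt p.1.2 p.2 - V p.1.2 :=
    (ho.measurable_sub hV).comp
      (by fun_prop : Measurable fun p : (Vec d × Vec d) × Ξ => (p.1.2, p.2))
  have hle := abs_integral_inner_le_of_indepFun (hφ.prodMk hX) hY hXY (φ := Prod.fst)
    measurable_fst hmeas hφ_memLp
    (ho.memLp_noise hV hσ hX hY hlaw (hXY.comp measurable_snd measurable_id))
    (fun x => ho.integrable_sub_comp hY hlaw x.2) (b := 0)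
    (fun x => (norm_eq_zero.mpr (ho.integral_sub_comp hY hlaw x.2)).le)
  simpa using hle

lemma UnbiasedOracle.integral_noise (ho : UnbiasedOracle ν Vt V σ) (hV : Measurable V)
    (hσ : 0 ≤ σ) (hX : Measurable X) (hY : Measurable Y) (hlaw : P.map Y = ν)
    (hXY : IndepFun X Y P) : ∫ ω, (Vt (X ω) (Y ω) - V (X ω)) ∂P = 0 := by
  refine integral_eq_zero_of_forall_integral_inner_eq_zero ℝ _
    ((ho.memLp_noise hV hσ hX hY hlaw hXY).integrable one_le_two) fun c => ?_
  exact ho.integral_inner_noise hV hσ (φ := fun _ => c) measurable_const (memLp_const c) hX hY hlaw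
    (hXY.comp (φ := fun x => (c, x)) measurable_prodMk_left measurable_id)

end OracleNoise

section Gaussian

variable {E : Type*} [NormedAddCommGroup E] [InnerProductSpace ℝ E] [FiniteDimensional ℝ E]
  [MeasurableSpace E] [BorelSpace E]

lemma integral_sq_strongDual_stdGaussian (f : StrongDual ℝ E) :
    ∫ x, f x ^ 2 ∂(stdGaussian E) = ‖f‖ ^ 2 := by
  rw [← variance_dual_stdGaussian f,
    variance_of_integral_eq_zero (by fun_prop) (integral_strongDual_stdGaussian f)]

lemma integral_norm_sq_stdGaussian :
    ∫ x, ‖x‖ ^ 2 ∂(stdGaussian E) = Module.finrank ℝ E := by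
  let b := stdOrthonormalBasis ℝ E
  have hcoord : ∀ x, ‖x‖ ^ 2 = ∑ i, (InnerProductSpace.toDual ℝ E (b i) x) ^ 2 := fun x => by
    simp [← b.sum_sq_norm_inner_right x]
  have hinteg : ∀ i, Integrable (fun x => (InnerProductSpace.toDual ℝ E (b i) x) ^ 2)
      (stdGaussian E) := fun i =>
    ((InnerProductSpace.toDual ℝ E (b i)).comp_memLp' IsGaussian.memLp_two_id).integrable_sq
  simp_rw [hcoord]
  rw [integral_finsetSum _ fun i _ => hinteg i]
  simp only [integral_sq_strongDual_stdGaussian, LinearIsometryEquiv.norm_map, b.norm_eq_one,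
    one_pow, Finset.sum_const, Finset.card_univ, Fintype.card_fin, nsmul_eq_mul, mul_one]

lemma memLp_of_map_eq_stdGaussian {Ω : Type*} [MeasurableSpace Ω] {P : Measure Ω} {X : Ω → E}
    (hX : Measurable X) (hlaw : P.map X = stdGaussian E) : MemLp X 2 P := by
  have hid : MemLp (fun x : E => x) 2 (stdGaussian E) := IsGaussian.memLp_two_id
  rw [← hlaw] at hid
  exact (memLp_map_measure_iff (by fun_prop) hX.aemeasurable).mp hid

lemma lpNorm_two_of_map_eq_stdGaussian {Ω : Type*} [MeasurableSpace Ω] {P : Measure Ω}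
    {X : Ω → E} (hX : Measurable X) (hlaw : P.map X = stdGaussian E) :
    lpNorm X 2 P = √(Module.finrank ℝ E) := by
  rw [lpNorm_two_eq_sqrt (memLp_of_map_eq_stdGaussian hX hlaw), ← integral_norm_sq_stdGaussian,
    ← hlaw, integral_map hX.aemeasurable (by fun_prop)]

end Gaussian

section Independence

lemma iIndep_sumElim {ι κ Ω : Type*} [MeasurableSpace Ω] {P : Measure Ω}
    {m : ι → MeasurableSpace Ω} {n : κ → MeasurableSpace Ω} (hm : iIndep m P) (hn : iIndep n P)
    (hmn : Indep (⨆ i, m i) (⨆ j, n j) P) : iIndep (Sum.elim m n) P := by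
  rw [iIndep_iff] at *
  intro S f hf
  have hleft : ∀ i ∈ S.toLeft, MeasurableSet[m i] (f (Sum.inl i)) := fun i hi =>
    hf (Sum.inl i) (Finset.mem_toLeft.mp hi)
  have hright : ∀ j ∈ S.toRight, MeasurableSet[n j] (f (Sum.inr j)) := fun j hj =>
    hf (Sum.inr j) (Finset.mem_toRight.mp hj)
  have hinter : ⋂ i ∈ S, f i =
      (⋂ i ∈ S.toLeft, f (Sum.inl i)) ∩ ⋂ j ∈ S.toRight, f (Sum.inr j) := by
    ext ω
    simp [Sum.forall]
  rw [Finset.prod_sum_eq_prod_toLeft_mul_prod_toRight, hinter, ← hm S.toLeft hleft,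
    ← hn S.toRight hright]
  refine (Indep_iff _ _ _).mp hmn _ _ ?_ ?_
  · exact Finset.measurableSet_biInter _ fun i hi => le_iSup m i _ (hleft i hi)
  · exact Finset.measurableSet_biInter _ fun j hj => le_iSup n j _ (hright j hj)

lemma indepFun_of_indep_of_measurable {Ω α β : Type*} {m n mΩ : MeasurableSpace Ω}
    [MeasurableSpace α] [MeasurableSpace β] {P : Measure Ω} (h : Indep m n P) {X : Ω → α}
    {Y : Ω → β} (hX : Measurable[m] X) (hY : Measurable[n] Y) : IndepFun X Y P := by
  rw [IndepFun_iff_Indep]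
  exact indep_of_indep_of_le_left (indep_of_indep_of_le_right h hY.comap_le) hX.comap_le

/-- The indices of the samples of the algorithm: the left summand numbers the Gaussian vectors
`s t m ℓ`, the right summand the oracle samples `ξ t m ℓ`. -/
abbrev SampleIndex (M : ℕ) : Type := (ℕ × Fin M × ℕ) ⊕ (ℕ × Fin M × ℕ)

variable {d M : ℕ} {Ξ Ω : Type*} [MeasurableSpace Ξ] {s : ℕ → Fin M → ℕ → Ω → Vec d}
  {ξ : ℕ → Fin M → ℕ → Ω → Ξ}

/-- The σ-algebra generated by a single sample. -/
@[reducible] def sampleAlgebra (s : ℕ → Fin M → ℕ → Ω → Vec d) (ξ : ℕ → Fin M → ℕ → Ω → Ξ) :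
    SampleIndex M → MeasurableSpace Ω :=
  Sum.elim (fun i => MeasurableSpace.comap (s i.1 i.2.1 i.2.2) inferInstance)
    (fun i => MeasurableSpace.comap (ξ i.1 i.2.1 i.2.2) inferInstance)

/-- The σ-algebra generated by the samples with index in `A`. -/
@[reducible] def history (s : ℕ → Fin M → ℕ → Ω → Vec d) (ξ : ℕ → Fin M → ℕ → Ω → Ξ)
    (A : Set (SampleIndex M)) : MeasurableSpace Ω :=
  ⨆ i ∈ A, sampleAlgebra s ξ i

lemma sampleAlgebra_le_history {A : Set (SampleIndex M)} {i : SampleIndex M} (hi : i ∈ A) :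
    sampleAlgebra s ξ i ≤ history s ξ A :=
  le_iSup₂_of_le (f := fun i (_ : i ∈ A) => sampleAlgebra s ξ i) i hi le_rfl

lemma measurable_gauss_history {A : Set (SampleIndex M)} {t : ℕ} {m : Fin M} {ℓ : ℕ}
    (hi : Sum.inl (t, m, ℓ) ∈ A) : Measurable[history s ξ A] (s t m ℓ) :=
  (comap_measurable (s t m ℓ)).mono (sampleAlgebra_le_history (s := s) (ξ := ξ) hi) le_rfl

lemma measurable_sample_history {A : Set (SampleIndex M)} {t : ℕ} {m : Fin M} {ℓ : ℕ}
    (hi : Sum.inr (t, m, ℓ) ∈ A) : Measurable[history s ξ A] (ξ t m ℓ) :=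
  (comap_measurable (ξ t m ℓ)).mono (sampleAlgebra_le_history (s := s) (ξ := ξ) hi) le_rfl

variable [mΩ : MeasurableSpace Ω] {P : Measure Ω} {ν : Measure Ξ}

lemma IndependentSamples.sampleAlgebra_le (h : IndependentSamples P ν s ξ) (i : SampleIndex M) :
    sampleAlgebra s ξ i ≤ mΩ := by
  rcases i with i | i
  · exact (h.measurable_gauss _ _ _).comap_le
  · exact (h.measurable_sample _ _ _).comap_le

lemma IndependentSamples.history_le (h : IndependentSamples P ν s ξ) (A : Set (SampleIndex M)) :
    history s ξ A ≤ mΩ :=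
  iSup₂_le fun i _ => h.sampleAlgebra_le i

lemma IndependentSamples.indep_history (h : IndependentSamples P ν s ξ)
    {A B : Set (SampleIndex M)} (hAB : Disjoint A B) :
    Indep (history s ξ A) (history s ξ B) P := by
  refine indep_iSup_of_disjoint h.sampleAlgebra_le ?_ hAB
  refine iIndep_sumElim ((iIndepFun_iff_iIndep _ _ _).mp h.indep_gauss)
    ((iIndepFun_iff_iIndep _ _ _).mp h.indep_sample) ?_
  have hjoint := (IndepFun_iff_Indep _ _ _).mp h.indep_gauss_sample
  refine indep_of_indep_of_le_left (indep_of_indep_of_le_right hjoint ?_) ?_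
  · exact iSup_le fun i => Measurable.comap_le ((measurable_pi_apply i).comp
      (comap_measurable fun ω (i : ℕ × Fin M × ℕ) => ξ i.1 i.2.1 i.2.2 ω))
  · exact iSup_le fun i => Measurable.comap_le ((measurable_pi_apply i).comp
      (comap_measurable fun ω (i : ℕ × Fin M × ℕ) => s i.1 i.2.1 i.2.2 ω))

end Independence

section Measurability

variable {d M : ℕ} {Ξ Ω : Type*} [MeasurableSpace Ξ] [MeasurableSpace Ω]
  {Vt : Vec d → Ξ → Vec d} {η γ δ : ℝ}

lemma measurable_oracle_comp (hVt : Measurable fun p : Vec d × Ξ => Vt p.1 p.2) {x : Ω → Vec d}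
    {y : Ω → Ξ} (hx : Measurable x) (hy : Measurable y) : Measurable fun ω => Vt (x ω) (y ω) :=
  hVt.comp (hx.prodMk hy)

lemma measurable_innerIter (hVt : Measurable fun p : Vec d × Ξ => Vt p.1 p.2) {z : Ω → Vec d}
    (hz : Measurable z) {s : ℕ → Ω → Vec d} {ξ : ℕ → Ω → Ξ} {ℓ : ℕ}
    (hs : ∀ k ≤ ℓ, Measurable (s k)) (hξ : ∀ k ≤ ℓ, Measurable (ξ k)) :
    Measurable fun ω => innerIter Vt η γ δ (z ω) (fun k => s k ω) (fun k => ξ k ω) ℓ := by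
  induction ℓ with
  | zero => exact hz
  | succ ℓ ih =>
    have hx := ih (fun k hk => hs k (by omega)) (fun k hk => hξ k (by omega))
    have hquery := measurable_oracle_comp hVt (hx.add ((hs (ℓ + 1) le_rfl).const_smul δ))
      (hξ (ℓ + 1) le_rfl)
    exact hx.sub ((hquery.add ((hx.sub hz).const_smul (1 / η))).const_smul γ)

lemma measurable_outerIter (hVt : Measurable fun p : Vec d × Ξ => Vt p.1 p.2) (K H : ℕ)
    {s : ℕ → Fin M → ℕ → Ω → Vec d} {ξ : ℕ → Fin M → ℕ → Ω → Ξ} {t : ℕ}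
    (hs : ∀ t' ≤ t, ∀ m ℓ, Measurable (s t' m ℓ)) (hξ : ∀ t' ≤ t, ∀ m ℓ, Measurable (ξ t' m ℓ))
    (m : Fin M) :
    Measurable fun ω => outerIter Vt η γ δ K H (fun t m ℓ => s t m ℓ ω)
      (fun t m ℓ => ξ t m ℓ ω) t m := by
  induction t generalizing m with
  | zero => exact measurable_const
  | succ t ih =>
    have hz := ih (fun k hk => hs k (by omega)) (fun k hk => hξ k (by omega))
    have hx := fun m => measurable_innerIter (η := η) (γ := γ) (δ := δ) (ℓ := H) hVt (hz m)
      (fun k _ => hs (t + 1) le_rfl m k) (fun k _ => hξ (t + 1) le_rfl m k)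
    have hw := fun m => (hz m).sub
      ((measurable_oracle_comp hVt (hx m) (hξ _ le_rfl m (H + 1))).const_smul η)
    simp only [outerIter]
    split_ifs with hK
    · exact (Finset.measurable_fun_sum _ fun m _ => hw m).const_smul (1 / (M : ℝ))
    · exact hw m

end Measurability

section Parameters

/-- The standing relations between the parameters of the inner loop. -/
structure StepSizes (d : ℕ) (L σ η γ δ : ℝ) : Prop where
  dim_pos : 1 ≤ d
  L_pos : 0 < L
  sigma_pos : 0 < σ
  eta_pos : 0 < η
  eta_mul_le : η * L ≤ 1
  gamma_eq : γ = innerStepSize η L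
  delta_eq : δ = smoothingRadius d η σ

variable {d : ℕ} {L σ G η γ δ : ℝ}

lemma StepSizes.gamma_pos (h : StepSizes d L σ η γ δ) : 0 < γ :=
  h.gamma_eq ▸ innerStepSize_pos h.eta_pos h.L_pos.le

lemma StepSizes.gamma_div_le_one (h : StepSizes d L σ η γ δ) : γ / η ≤ 1 :=
  h.gamma_eq ▸ innerStepSize_div_le_one h.eta_pos h.L_pos.le

lemma StepSizes.one_fourth_le_gamma_div (h : StepSizes d L σ η γ δ) : 1 / 4 ≤ γ / η := by
  have hηL : 0 < η * L := mul_pos h.eta_pos h.L_pos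
  rw [h.gamma_eq, innerStepSize_div h.eta_pos h.L_pos.le]
  refine one_div_le_one_div_of_le (by positivity) ?_
  calc (1 + η * L) ^ 2 ≤ (1 + 1) ^ 2 := by gcongr; exact h.eta_mul_le
    _ = 4 := by norm_num

lemma StepSizes.delta_nonneg (h : StepSizes d L σ η γ δ) : 0 ≤ δ := by
  have hη := h.eta_pos
  have hσ := h.sigma_pos
  rw [h.delta_eq, smoothingRadius]
  positivity

lemma StepSizes.delta_mul_sqrt (h : StepSizes d L σ η γ δ) : δ * √(d : ℝ) = η * σ := by
  have hd : √(d : ℝ) ≠ 0 := (Real.sqrt_pos.mpr (by exact_mod_cast h.dim_pos)).ne'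
  rw [h.delta_eq, smoothingRadius, div_mul_cancel₀ _ hd]

/-- The decay rate `√(3/4)` of the inner loop: a bound for the contraction factor `√(1 - γ / η)` of
the noiseless inner step. -/
noncomputable def decayRate : ℝ := √(3 / 4)

lemma decayRate_nonneg : 0 ≤ decayRate := Real.sqrt_nonneg _

lemma decayRate_sq : decayRate ^ 2 = 3 / 4 := Real.sq_sqrt (by norm_num)

lemma le_decayRate : 43 / 50 ≤ decayRate := Real.le_sqrt_of_sq_le (by norm_num)

lemma StepSizes.sqrt_le_decayRate (h : StepSizes d L σ η γ δ) : √(1 - γ / η) ≤ decayRate :=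
  Real.sqrt_le_sqrt (by linarith [h.one_fourth_le_gamma_div])

/-- A bound for the `L²` distance between the inner iterate after `ℓ` steps and the resolvent: the
initial distance `η * G` decays geometrically, down to a noise floor of order `η * σ`. -/
noncomputable def innerError (η σ G : ℝ) (ℓ : ℕ) : ℝ := decayRate ^ ℓ * (η * G) + 4 * (η * σ)

/-- A bound for the distance between the mean of the inner iterate after `ℓ` steps and the
resolvent. Averaging improves the noise floor of `innerError` by a factor `η * L`. -/
noncomputable def meanError (η L σ G : ℝ) (ℓ : ℕ) : ℝ :=
  3 * (decayRate ^ ℓ * (η * G)) + 5 * (η ^ 2 * L * σ)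

lemma StepSizes.innerError_nonneg (h : StepSizes d L σ η γ δ) (hG : 0 ≤ G) (ℓ : ℕ) :
    0 ≤ innerError η σ G ℓ := by
  have hη := h.eta_pos
  have hσ := h.sigma_pos
  have hr := decayRate_nonneg
  rw [innerError]; positivity

lemma StepSizes.innerError_step (h : StepSizes d L σ η γ δ) (hG : 0 ≤ G) (ℓ : ℕ) :
    (√(1 - γ / η) * innerError η σ G ℓ + γ * L * δ * √(d : ℝ)) ^ 2 + (γ * σ) ^ 2 ≤
      innerError η σ G (ℓ + 1) ^ 2 := by
  have hη := h.eta_pos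
  have hσ := h.sigma_pos
  have hL := h.L_pos
  have hγ := h.gamma_pos
  have hδ := h.delta_nonneg
  have hr := decayRate_nonneg
  have hE := h.innerError_nonneg hG ℓ
  set p := √(1 - γ / η)
  have : 0 ≤ p := Real.sqrt_nonneg _
  have hp_sq : p ^ 2 = 1 - γ / η := Real.sq_sqrt (by linarith [h.gamma_div_le_one])
  have hγ_eq : γ = η * (1 - p ^ 2) := by rw [hp_sq]; field_simp; ring
  have hsmooth : γ * L * δ * √(d : ℝ) ≤ γ * σ :=
    calc γ * L * δ * √(d : ℝ) = γ * σ * (η * L) := by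
          rw [mul_assoc (γ * L), h.delta_mul_sqrt]; ring
      _ ≤ γ * σ * 1 := by gcongr; exact h.eta_mul_le
      _ = γ * σ := mul_one _
  have hsum : p * innerError η σ G ℓ + γ * L * δ * √(d : ℝ) + γ * σ ≤ innerError η σ G (ℓ + 1) := by
    have hdecay : p * (decayRate ^ ℓ * (η * G)) ≤ decayRate * (decayRate ^ ℓ * (η * G)) := by
      gcongr; exact h.sqrt_le_decayRate
    have hfloor : 0 ≤ η * σ * (p - 1) ^ 2 := by positivity
    have hγσ : γ * σ = η * σ * (1 - p ^ 2) := by rw [hγ_eq]; ring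
    simp only [innerError, pow_succ]
    nlinarith
  calc (p * innerError η σ G ℓ + γ * L * δ * √(d : ℝ)) ^ 2 + (γ * σ) ^ 2
      ≤ (p * innerError η σ G ℓ + γ * L * δ * √(d : ℝ) + γ * σ) ^ 2 :=
        pow_add_pow_le (by positivity) (by positivity) two_ne_zero
    _ ≤ innerError η σ G (ℓ + 1) ^ 2 := by gcongr

lemma StepSizes.meanError_step (h : StepSizes d L σ η γ δ) (hG : 0 ≤ G) (ℓ : ℕ) :
    (1 - γ / η) * meanError η L σ G ℓ + γ * (L * (innerError η σ G ℓ + η * σ)) ≤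
      meanError η L σ G (ℓ + 1) := by
  have hη := h.eta_pos
  have hr := decayRate_nonneg
  set q := 1 - γ / η with hq
  have hq_le : q ≤ 3 / 4 := by linarith [h.one_fourth_le_gamma_div]
  have hγ_eq : γ = η * (1 - q) := by rw [hq]; field_simp; ring
  have hG_step : decayRate ^ (ℓ + 1) * (η * G) = decayRate * (decayRate ^ ℓ * (η * G)) := by ring
  simp only [meanError, innerError, hG_step]
  set g := decayRate ^ ℓ * (η * G)
  have hg : 0 ≤ g := by positivity
  have hbias : η * L * ((1 - q) * g) ≤ 1 * ((1 - q) * g) :=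
    mul_le_mul_of_nonneg_right h.eta_mul_le (mul_nonneg (by linarith) hg)
  have hexpand : γ * (L * (g + 4 * (η * σ) + η * σ)) =
      η * L * ((1 - q) * g) + 5 * (1 - q) * (η ^ 2 * L * σ) := by rw [hγ_eq]; ring
  have hrate : 43 / 50 * g ≤ decayRate * g := by gcongr; exact le_decayRate
  have hcontr : q * g ≤ 3 / 4 * g := by gcongr
  rw [hexpand]
  linarith

end Parameters

section PerturbedStep

variable {E : Type*} [NormedAddCommGroup E] [InnerProductSpace ℝ E] {V : E → E} {L G η γ δ : ℝ}

/-- A monotone `L`-Lipschitz operator with values in the ball of radius `G`. -/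
structure RegularOperator (L G : ℝ) (V : E → E) : Prop extends MonotoneLipschitz L V where
  norm_le : ∀ x, ‖V x‖ ≤ G

lemma RegularOperator.bound_nonneg (hV : RegularOperator L G V) : 0 ≤ G :=
  (norm_nonneg _).trans (hV.norm_le 0)

lemma RegularOperator.memLp_comp {Ω : Type*} [MeasurableSpace Ω] {P : Measure Ω}
    [IsFiniteMeasure P] (hV : RegularOperator L G V) {X : Ω → E} (hX : AEStronglyMeasurable X P)
    (p : ENNReal) : MemLp (fun ω => V (X ω)) p P :=
  .of_bound (hV.lipschitzWith.continuous.comp_aestronglyMeasurable hX) G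
    (.of_forall fun ω => hV.norm_le (X ω))

/-- The inner step of the algorithm with an exact operator evaluation, at the point perturbed by
`δ • s`. -/
noncomputable def perturbedStep (V : E → E) (η γ δ : ℝ) (z x s : E) : E :=
  x - γ • (V (x + δ • s) + (1 / η) • (x - z))

variable [CompleteSpace E]

lemma perturbedStep_sub_resolvent (hV : MonotoneLipschitz L V) (hη : 0 < η) (z x s : E) :
    perturbedStep V η γ δ z x s - resolvent V η z =
      (1 - γ / η) • (x - resolvent V η z) - γ • (V (x + δ • s) - V (resolvent V η z)) := by
  have hpull : (1 / η) • (x - z) =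
      (1 / η) • (x - resolvent V η z) - V (resolvent V η z) := by
    rw [← sub_sub_sub_cancel_right x z (resolvent V η z), smul_sub _ _ (z - resolvent V η z),
      sub_resolvent hV hη, smul_smul, one_div_mul_cancel hη.ne', one_smul]
  rw [perturbedStep, hpull]
  module

lemma norm_perturbedStep_sub_le (hV : MonotoneLipschitz L V) (hη : 0 < η) (hδ : 0 ≤ δ)
    (hγ : γ = innerStepSize η L) (z x s : E) :
    ‖perturbedStep V η γ δ z x s - resolvent V η z‖ ≤
      √(1 - γ / η) * ‖x - resolvent V η z‖ + γ * L * δ * ‖s‖ := by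
  have hL := hV.nonneg
  have hγ_pos : 0 < γ := hγ ▸ innerStepSize_pos hη hL
  have hsplit : perturbedStep V η γ δ z x s - resolvent V η z =
      (proxStep V η γ z x - proxStep V η γ z (resolvent V η z)) -
        γ • (V (x + δ • s) - V x) := by
    rw [proxStep_resolvent hV hη hγ_pos.ne', perturbedStep, proxStep]; module
  have hperturb : ‖V (x + δ • s) - V x‖ ≤ L * (δ * ‖s‖) := by
    simpa [norm_smul, abs_of_nonneg hδ] using hV.norm_sub_le (x + δ • s) x
  calc ‖perturbedStep V η γ δ z x s - resolvent V η z‖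
      ≤ ‖proxStep V η γ z x - proxStep V η γ z (resolvent V η z)‖ +
          ‖γ • (V (x + δ • s) - V x)‖ := by rw [hsplit]; exact norm_sub_le _ _
    _ ≤ √(1 - γ / η) * ‖x - resolvent V η z‖ + γ * (L * (δ * ‖s‖)) := by
      rw [norm_smul, Real.norm_of_nonneg hγ_pos.le]
      gcongr
      exact hγ ▸ norm_proxStep_sub_le hV hη z x _
    _ = √(1 - γ / η) * ‖x - resolvent V η z‖ + γ * L * δ * ‖s‖ := by ring

end PerturbedStep

section InnerLoop

/-- The samples consumed by one run of the inner loop: each oracle sample is independent of all the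
other samples. -/
structure InnerSamples {d : ℕ} {Ξ Ω : Type*} [MeasurableSpace Ξ] [MeasurableSpace Ω]
    (P : Measure Ω) (ν : Measure Ξ) (s : ℕ → Ω → Vec d) (ξ : ℕ → Ω → Ξ) : Prop where
  measurable_gauss : ∀ ℓ, Measurable (s ℓ)
  measurable_sample : ∀ ℓ, Measurable (ξ ℓ)
  law_gauss : ∀ ℓ, P.map (s ℓ) = stdGaussian (Vec d)
  law_sample : ∀ ℓ, P.map (ξ ℓ) = ν
  leave_one_out : ∀ ℓ, ∃ m : MeasurableSpace Ω, (∀ k, Measurable[m] (s k)) ∧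
    (∀ k, k ≠ ℓ → Measurable[m] (ξ k)) ∧ Indep m (MeasurableSpace.comap (ξ ℓ) inferInstance) P

variable {d : ℕ} {Ξ Ω : Type*} {s : ℕ → Ω → Vec d} {ξ : ℕ → Ω → Ξ} {Vt : Vec d → Ξ → Vec d}
  {V : Vec d → Vec d} {L σ G η γ δ : ℝ}

/-- The inner iterates as random vectors. -/
noncomputable def innerPath (Vt : Vec d → Ξ → Vec d) (η γ δ : ℝ) (z : Vec d)
    (s : ℕ → Ω → Vec d) (ξ : ℕ → Ω → Ξ) (ℓ : ℕ) (ω : Ω) : Vec d :=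
  innerIter Vt η γ δ z (fun k => s k ω) (fun k => ξ k ω) ℓ

/-- The point at which the oracle is queried in the inner step `ℓ + 1`. -/
noncomputable def innerQuery (Vt : Vec d → Ξ → Vec d) (η γ δ : ℝ) (z : Vec d)
    (s : ℕ → Ω → Vec d) (ξ : ℕ → Ω → Ξ) (ℓ : ℕ) (ω : Ω) : Vec d :=
  innerPath Vt η γ δ z s ξ ℓ ω + δ • s (ℓ + 1) ω

/-- The error of the oracle response in the inner step `ℓ + 1`. -/
noncomputable def innerNoise (Vt : Vec d → Ξ → Vec d) (V : Vec d → Vec d) (η γ δ : ℝ) (z : Vec d)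
    (s : ℕ → Ω → Vec d) (ξ : ℕ → Ω → Ξ) (ℓ : ℕ) (ω : Ω) : Vec d :=
  Vt (innerQuery Vt η γ δ z s ξ ℓ ω) (ξ (ℓ + 1) ω) - V (innerQuery Vt η γ δ z s ξ ℓ ω)

lemma innerPath_succ (z : Vec d) (ℓ : ℕ) (ω : Ω) :
    innerPath Vt η γ δ z s ξ (ℓ + 1) ω =
      perturbedStep V η γ δ z (innerPath Vt η γ δ z s ξ ℓ ω) (s (ℓ + 1) ω) -
        γ • innerNoise Vt V η γ δ z s ξ ℓ ω := by
  simp only [innerPath, innerIter, perturbedStep, innerNoise, innerQuery]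
  module

variable [MeasurableSpace Ξ] [MeasurableSpace Ω] {P : Measure Ω} {ν : Measure Ξ}

lemma InnerSamples.memLp_gauss (hS : InnerSamples P ν s ξ) (ℓ : ℕ) : MemLp (s ℓ) 2 P :=
  memLp_of_map_eq_stdGaussian (hS.measurable_gauss ℓ) (hS.law_gauss ℓ)

lemma InnerSamples.lpNorm_gauss (hS : InnerSamples P ν s ξ) (ℓ : ℕ) :
    lpNorm (s ℓ) 2 P = √(d : ℝ) := by
  rw [lpNorm_two_of_map_eq_stdGaussian (hS.measurable_gauss ℓ) (hS.law_gauss ℓ),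
    finrank_euclideanSpace_fin]

lemma measurable_innerPath (ho : UnbiasedOracle ν Vt V σ) (hS : InnerSamples P ν s ξ) (z : Vec d)
    (ℓ : ℕ) : Measurable (innerPath Vt η γ δ z s ξ ℓ) :=
  measurable_innerIter ho.measurable measurable_const (fun k _ => hS.measurable_gauss k)
    (fun k _ => hS.measurable_sample k)

lemma measurable_innerQuery (ho : UnbiasedOracle ν Vt V σ) (hS : InnerSamples P ν s ξ) (z : Vec d)
    (ℓ : ℕ) : Measurable (innerQuery Vt η γ δ z s ξ ℓ) :=
  (measurable_innerPath ho hS z ℓ).add ((hS.measurable_gauss (ℓ + 1)).const_smul δ)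

lemma indepFun_innerPath_sample (ho : UnbiasedOracle ν Vt V σ) (hS : InnerSamples P ν s ξ)
    (z : Vec d) (ℓ : ℕ) :
    IndepFun (fun ω => (innerPath Vt η γ δ z s ξ ℓ ω, s (ℓ + 1) ω)) (ξ (ℓ + 1)) P := by
  obtain ⟨m, hs, hξ, hindep⟩ := hS.leave_one_out (ℓ + 1)
  have hpath : Measurable[m] (innerPath Vt η γ δ z s ξ ℓ) :=
    measurable_innerIter ho.measurable measurable_const (fun k _ => hs k)
      (fun k hk => hξ k (by omega))
  exact indepFun_of_indep_of_measurable hindep (hpath.prodMk (hs (ℓ + 1))) (comap_measurable _)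

lemma indepFun_innerQuery_sample (ho : UnbiasedOracle ν Vt V σ) (hS : InnerSamples P ν s ξ)
    (z : Vec d) (ℓ : ℕ) : IndepFun (innerQuery Vt η γ δ z s ξ ℓ) (ξ (ℓ + 1)) P :=
  (indepFun_innerPath_sample ho hS z ℓ).comp
    (by fun_prop : Measurable fun p : Vec d × Vec d => p.1 + δ • p.2) measurable_id

variable [IsProbabilityMeasure P]

lemma memLp_innerNoise (hV : Measurable V) (hσ : 0 ≤ σ) (ho : UnbiasedOracle ν Vt V σ)
    (hS : InnerSamples P ν s ξ) (z : Vec d) (ℓ : ℕ) :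
    MemLp (innerNoise Vt V η γ δ z s ξ ℓ) 2 P :=
  ho.memLp_noise hV hσ (measurable_innerQuery ho hS z ℓ) (hS.measurable_sample _)
    (hS.law_sample _) (indepFun_innerQuery_sample ho hS z ℓ)

lemma lpNorm_innerNoise_le (hV : Measurable V) (hσ : 0 ≤ σ) (ho : UnbiasedOracle ν Vt V σ)
    (hS : InnerSamples P ν s ξ) (z : Vec d) (ℓ : ℕ) :
    lpNorm (innerNoise Vt V η γ δ z s ξ ℓ) 2 P ≤ σ :=
  ho.lpNorm_noise_le hV hσ (measurable_innerQuery ho hS z ℓ) (hS.measurable_sample _)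
    (hS.law_sample _) (indepFun_innerQuery_sample ho hS z ℓ)

lemma integral_innerNoise (hV : Measurable V) (hσ : 0 ≤ σ) (ho : UnbiasedOracle ν Vt V σ)
    (hS : InnerSamples P ν s ξ) (z : Vec d) (ℓ : ℕ) :
    ∫ ω, innerNoise Vt V η γ δ z s ξ ℓ ω ∂P = 0 :=
  ho.integral_noise hV hσ (measurable_innerQuery ho hS z ℓ) (hS.measurable_sample _)
    (hS.law_sample _) (indepFun_innerQuery_sample ho hS z ℓ)

lemma integral_inner_innerNoise (hV : Measurable V) (hσ : 0 ≤ σ) (ho : UnbiasedOracle ν Vt V σ)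
    (hS : InnerSamples P ν s ξ) (z : Vec d) (ℓ : ℕ) {f : Vec d × Vec d → Vec d}
    (hf : Measurable f)
    (hf_memLp : MemLp (fun ω => f (innerPath Vt η γ δ z s ξ ℓ ω, s (ℓ + 1) ω)) 2 P) :
    ∫ ω, inner ℝ (f (innerPath Vt η γ δ z s ξ ℓ ω, s (ℓ + 1) ω))
      (innerNoise Vt V η γ δ z s ξ ℓ ω) ∂P = 0 := by
  have hquery : Measurable fun p : Vec d × Vec d => p.1 + δ • p.2 := by fun_prop
  exact ho.integral_inner_noise hV hσ
    (hf.comp ((measurable_innerPath ho hS z ℓ).prodMk (hS.measurable_gauss (ℓ + 1)))) hf_memLp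
    (measurable_innerQuery ho hS z ℓ) (hS.measurable_sample _) (hS.law_sample _)
    ((indepFun_innerPath_sample ho hS z ℓ).comp (hf.prodMk hquery) measurable_id)

lemma memLp_perturbedStep (hV : RegularOperator L G V) {x g : Ω → Vec d} (hx : MemLp x 2 P)
    (hg : MemLp g 2 P) (z : Vec d) :
    MemLp (fun ω => perturbedStep V η γ δ z (x ω) (g ω)) 2 P := by
  have hVx : MemLp (fun ω => V (x ω + δ • g ω)) 2 P :=
    hV.memLp_comp (hx.add (hg.const_smul δ)).aestronglyMeasurable 2
  exact hx.sub ((hVx.add ((hx.sub (memLp_const z)).const_smul (1 / η))).const_smul γ)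

lemma memLp_innerPath (hV : RegularOperator L G V) (hσ : 0 ≤ σ) (ho : UnbiasedOracle ν Vt V σ)
    (hS : InnerSamples P ν s ξ) (z : Vec d) (ℓ : ℕ) :
    MemLp (innerPath Vt η γ δ z s ξ ℓ) 2 P := by
  induction ℓ with
  | zero => exact memLp_const z
  | succ ℓ ih =>
    rw [funext (innerPath_succ (V := V) z ℓ)]
    exact (memLp_perturbedStep hV ih (hS.memLp_gauss (ℓ + 1)) z).sub
      ((memLp_innerNoise hV.measurable hσ ho hS z ℓ).const_smul γ)

lemma lpNorm_perturbedStep_sub_le (hV : MonotoneLipschitz L V) (h : StepSizes d L σ η γ δ)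
    {x g : Ω → Vec d} (hx : MemLp x 2 P) (hg : MemLp g 2 P) (z : Vec d) :
    lpNorm (fun ω => perturbedStep V η γ δ z (x ω) (g ω) - resolvent V η z) 2 P ≤
      √(1 - γ / η) * lpNorm (fun ω => x ω - resolvent V η z) 2 P + γ * L * δ * lpNorm g 2 P := by
  have hcoef : 0 ≤ γ * L * δ := mul_nonneg (mul_nonneg h.gamma_pos.le h.L_pos.le) h.delta_nonneg
  exact lpNorm_le_add_of_norm_le (hx.sub (memLp_const _)) hg one_le_two (Real.sqrt_nonneg _) hcoef
    fun ω => norm_perturbedStep_sub_le hV h.eta_pos h.delta_nonneg h.gamma_eq z _ _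

lemma lpNorm_innerPath_succ_sub_sq_le (hV : RegularOperator L G V) (h : StepSizes d L σ η γ δ)
    (ho : UnbiasedOracle ν Vt V σ) (hS : InnerSamples P ν s ξ) (z : Vec d) (ℓ : ℕ) :
    lpNorm (fun ω => innerPath Vt η γ δ z s ξ (ℓ + 1) ω - resolvent V η z) 2 P ^ 2 ≤
      (√(1 - γ / η) * lpNorm (fun ω => innerPath Vt η γ δ z s ξ ℓ ω - resolvent V η z) 2 P +
        γ * L * δ * √(d : ℝ)) ^ 2 + (γ * σ) ^ 2 := by
  have hσ := h.sigma_pos.le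
  have hVm := hV.measurable
  have hpath := memLp_innerPath (η := η) (γ := γ) (δ := δ) hV hσ ho hS z ℓ
  have hnoise := (memLp_innerNoise (η := η) (γ := γ) (δ := δ) hVm hσ ho hS z ℓ).const_smul (-γ)
  let f : Vec d × Vec d → Vec d := fun p => perturbedStep V η γ δ z p.1 p.2 - resolvent V η z
  have hf : Measurable f := by simp only [f, perturbedStep]; fun_prop
  let F : Ω → Vec d := fun ω => f (innerPath Vt η γ δ z s ξ ℓ ω, s (ℓ + 1) ω)
  have hF : MemLp F 2 P :=
    (memLp_perturbedStep hV hpath (hS.memLp_gauss (ℓ + 1)) z).sub (memLp_const _)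
  have hsplit : (fun ω => innerPath Vt η γ δ z s ξ (ℓ + 1) ω - resolvent V η z) =
      F + (-γ) • innerNoise Vt V η γ δ z s ξ ℓ := by
    ext1 ω
    rw [innerPath_succ (V := V), Pi.add_apply, Pi.smul_apply]
    module
  have horth : ∫ ω, inner ℝ (F ω) (((-γ) • innerNoise Vt V η γ δ z s ξ ℓ) ω) ∂P = 0 := by
    simp only [Pi.smul_apply, inner_smul_right]
    rw [integral_const_mul, integral_inner_innerNoise hVm hσ ho hS z ℓ hf hF, mul_zero]
  rw [hsplit, lpNorm_two_add_sq_of_integral_inner_eq_zero hF hnoise horth, lpNorm_const_smul,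
    coe_nnnorm, norm_neg, Real.norm_of_nonneg h.gamma_pos.le, ← hS.lpNorm_gauss (ℓ + 1)]
  gcongr
  · exact lpNorm_nonneg
  · exact lpNorm_perturbedStep_sub_le hV.toMonotoneLipschitz h hpath (hS.memLp_gauss (ℓ + 1)) z
  · exact mul_nonneg h.gamma_pos.le lpNorm_nonneg
  · exact h.gamma_pos.le
  · exact lpNorm_innerNoise_le hVm hσ ho hS z ℓ

lemma lpNorm_innerPath_sub_le (hV : RegularOperator L G V) (h : StepSizes d L σ η γ δ)
    (ho : UnbiasedOracle ν Vt V σ) (hS : InnerSamples P ν s ξ) (z : Vec d) (ℓ : ℕ) :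
    lpNorm (fun ω => innerPath Vt η γ δ z s ξ ℓ ω - resolvent V η z) 2 P ≤
      innerError η σ G ℓ := by
  induction ℓ with
  | zero =>
    have hdist := norm_sub_resolvent_le hV.toMonotoneLipschitz h.eta_pos hV.norm_le z
    have hfloor : 0 ≤ η * σ := mul_nonneg h.eta_pos.le h.sigma_pos.le
    simp only [innerPath, innerIter, innerError, lpNorm_const' two_ne_zero ENNReal.ofNat_ne_top,
      probReal_univ, Real.one_rpow, pow_zero]
    linarith
  | succ ℓ ih =>
    have hcoef : 0 ≤ γ * L * δ :=
      mul_nonneg (mul_nonneg h.gamma_pos.le h.L_pos.le) h.delta_nonneg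
    refine le_of_sq_le_sq ?_ (h.innerError_nonneg hV.bound_nonneg (ℓ + 1))
    calc _ ≤ _ := lpNorm_innerPath_succ_sub_sq_le hV h ho hS z ℓ
      _ ≤ (√(1 - γ / η) * innerError η σ G ℓ + γ * L * δ * √(d : ℝ)) ^ 2 + (γ * σ) ^ 2 := by
        have := lpNorm_nonneg (f := fun ω => innerPath Vt η γ δ z s ξ ℓ ω - resolvent V η z)
          (p := 2) (μ := P)
        gcongr
      _ ≤ innerError η σ G (ℓ + 1) ^ 2 := h.innerError_step hV.bound_nonneg ℓ

lemma norm_integral_innerQuery_sub_le (hV : RegularOperator L G V) (h : StepSizes d L σ η γ δ)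
    (ho : UnbiasedOracle ν Vt V σ) (hS : InnerSamples P ν s ξ) (z : Vec d) (ℓ : ℕ) :
    ‖∫ ω, (V (innerQuery Vt η γ δ z s ξ ℓ ω) - V (resolvent V η z)) ∂P‖ ≤
      L * (innerError η σ G ℓ + η * σ) := by
  set J := resolvent V η z
  have hpath := (memLp_innerPath (η := η) (γ := γ) (δ := δ) hV h.sigma_pos.le ho hS z ℓ).sub
    (memLp_const J)
  have hgauss := hS.memLp_gauss (ℓ + 1)
  have hpath_int := (hpath.integrable one_le_two).norm
  have hgauss_int := (hgauss.integrable one_le_two).norm.const_mul δ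
  have hlip : ∀ ω, ‖V (innerQuery Vt η γ δ z s ξ ℓ ω) - V J‖ ≤
      L * (‖innerPath Vt η γ δ z s ξ ℓ ω - J‖ + δ * ‖s (ℓ + 1) ω‖) := fun ω => by
    refine (hV.norm_sub_le _ _).trans (mul_le_mul_of_nonneg_left ?_ hV.nonneg)
    rw [innerQuery, add_sub_right_comm, ← Real.norm_of_nonneg h.delta_nonneg, ← norm_smul,
      Real.norm_of_nonneg h.delta_nonneg]
    exact norm_add_le _ _
  calc _ ≤ ∫ ω, L * (‖innerPath Vt η γ δ z s ξ ℓ ω - J‖ + δ * ‖s (ℓ + 1) ω‖) ∂P :=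
        norm_integral_le_of_norm_le ((hpath_int.add hgauss_int).const_mul L) (.of_forall hlip)
    _ = L * (∫ ω, ‖innerPath Vt η γ δ z s ξ ℓ ω - J‖ ∂P + δ * ∫ ω, ‖s (ℓ + 1) ω‖ ∂P) := by
        rw [integral_const_mul, ← integral_const_mul δ]
        exact congrArg (L * ·) (integral_add hpath_int hgauss_int)
    _ ≤ L * (innerError η σ G ℓ + δ * √(d : ℝ)) := by
        rw [← hS.lpNorm_gauss (ℓ + 1)]
        gcongr
        · exact hV.nonneg
        · exact (integral_norm_le_lpNorm_two hpath).trans (lpNorm_innerPath_sub_le hV h ho hS z ℓ)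
        · exact h.delta_nonneg
        · exact integral_norm_le_lpNorm_two hgauss
    _ = L * (innerError η σ G ℓ + η * σ) := by rw [h.delta_mul_sqrt]

lemma integral_innerPath_succ_sub (hV : RegularOperator L G V) (h : StepSizes d L σ η γ δ)
    (ho : UnbiasedOracle ν Vt V σ) (hS : InnerSamples P ν s ξ) (z : Vec d) (ℓ : ℕ) :
    ∫ ω, (innerPath Vt η γ δ z s ξ (ℓ + 1) ω - resolvent V η z) ∂P =
      (1 - γ / η) • ∫ ω, (innerPath Vt η γ δ z s ξ ℓ ω - resolvent V η z) ∂P -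
        γ • ∫ ω, (V (innerQuery Vt η γ δ z s ξ ℓ ω) - V (resolvent V η z)) ∂P := by
  have hσ := h.sigma_pos.le
  set J := resolvent V η z
  have hpath : Integrable (fun ω => innerPath Vt η γ δ z s ξ ℓ ω - J) P :=
    ((memLp_innerPath hV hσ ho hS z ℓ).sub (memLp_const J)).integrable one_le_two
  have hquery : Integrable (fun ω => V (innerQuery Vt η γ δ z s ξ ℓ ω) - V J) P :=
    ((hV.memLp_comp (measurable_innerQuery ho hS z ℓ).aestronglyMeasurable 2).sub
      (memLp_const (V J))).integrable one_le_two
  have hnoise : Integrable (innerNoise Vt V η γ δ z s ξ ℓ) P :=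
    (memLp_innerNoise hV.measurable hσ ho hS z ℓ).integrable one_le_two
  have hsplit : ∀ ω, innerPath Vt η γ δ z s ξ (ℓ + 1) ω - J =
      ((1 - γ / η) • (innerPath Vt η γ δ z s ξ ℓ ω - J) -
        γ • (V (innerQuery Vt η γ δ z s ξ ℓ ω) - V J)) -
        γ • innerNoise Vt V η γ δ z s ξ ℓ ω := fun ω => by
    rw [innerPath_succ (V := V), sub_right_comm,
      perturbedStep_sub_resolvent hV.toMonotoneLipschitz h.eta_pos, innerQuery]
  simp_rw [hsplit]
  rw [integral_sub, integral_sub, integral_smul, integral_smul, integral_smul,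
    integral_innerNoise hV.measurable hσ ho hS z ℓ, smul_zero, sub_zero]
  · exact hpath.smul (1 - γ / η)
  · exact hquery.smul γ
  · exact (hpath.smul (1 - γ / η)).sub (hquery.smul γ)
  · exact hnoise.smul γ

lemma norm_integral_innerPath_sub_le (hV : RegularOperator L G V) (h : StepSizes d L σ η γ δ)
    (ho : UnbiasedOracle ν Vt V σ) (hS : InnerSamples P ν s ξ) (z : Vec d) (ℓ : ℕ) :
    ‖∫ ω, (innerPath Vt η γ δ z s ξ ℓ ω - resolvent V η z) ∂P‖ ≤ meanError η L σ G ℓ := by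
  have hη := h.eta_pos
  have hσ := h.sigma_pos
  have hL := h.L_pos
  have hG := hV.bound_nonneg
  induction ℓ with
  | zero =>
    have hdist := norm_sub_resolvent_le hV.toMonotoneLipschitz hη hV.norm_le z
    have hfloor : 0 ≤ η ^ 2 * L * σ := by positivity
    have hstart : 0 ≤ η * G := by positivity
    simp only [innerPath, innerIter, integral_const, probReal_univ, one_smul, meanError, pow_zero]
    linarith
  | succ ℓ ih =>
    have hγ := h.gamma_pos.le
    have hcontr : 0 ≤ 1 - γ / η := by linarith [h.gamma_div_le_one]
    rw [integral_innerPath_succ_sub hV h ho hS z ℓ]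
    refine (norm_sub_le _ _).trans (le_trans ?_ (h.meanError_step hG ℓ))
    rw [norm_smul, norm_smul, Real.norm_of_nonneg hcontr, Real.norm_of_nonneg hγ]
    gcongr
    exact norm_integral_innerQuery_sub_le hV h ho hS z ℓ

end InnerLoop

/-- A run of the algorithm with `M` machines and communication period `K`: all inputs of the
algorithm together with the standing assumptions on them. -/
structure Run {Ξ Ω : Type*} {_ : MeasurableSpace Ξ} {_ : MeasurableSpace Ω} (P : Measure Ω)
    (ν : Measure Ξ) (d M : ℕ) where
  (K H : ℕ)
  (L σ G η γ δ : ℝ)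
  V : Vec d → Vec d
  Vt : Vec d → Ξ → Vec d
  s : ℕ → Fin M → ℕ → Ω → Vec d
  ξ : ℕ → Fin M → ℕ → Ω → Ξ
  machines_pos : 1 ≤ M
  period_pos : 1 ≤ K
  regular : RegularOperator L G V
  steps : StepSizes d L σ η γ δ
  oracle : UnbiasedOracle ν Vt V σ
  samples : IndependentSamples P ν s ξ

namespace Run

variable {Ξ Ω : Type*} {mΞ : MeasurableSpace Ξ} {mΩ : MeasurableSpace Ω} {P : Measure Ω}
  {ν : Measure Ξ} {d M : ℕ} (A : Run P ν d M)

section Iterates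

/-- The iterate `z_t^m` as a random vector. -/
noncomputable def iter (t : ℕ) (m : Fin M) (ω : Ω) : Vec d :=
  outerIter A.Vt A.η A.γ A.δ A.K A.H (fun t m ℓ => A.s t m ℓ ω) (fun t m ℓ => A.ξ t m ℓ ω) t m

/-- The point `x_{t+1}^m`, computed by the inner loop from `z_t^m`. The index is that of the
iterate from which the inner loop starts. -/
noncomputable def prox (t : ℕ) (m : Fin M) (ω : Ω) : Vec d :=
  innerIter A.Vt A.η A.γ A.δ (A.iter t m ω) (fun ℓ => A.s (t + 1) m ℓ ω)
    (fun ℓ => A.ξ (t + 1) m ℓ ω) A.H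

/-- The exact proximal point `(id + η V)⁻¹ z_t^m`, which `prox` approximates. -/
noncomputable def exactProx (t : ℕ) (m : Fin M) (ω : Ω) : Vec d := resolvent A.V A.η (A.iter t m ω)

/-- The oracle error in the outer step from `z_t^m`. -/
noncomputable def noise (t : ℕ) (m : Fin M) (ω : Ω) : Vec d :=
  A.Vt (A.prox t m ω) (A.ξ (t + 1) m (A.H + 1) ω) - A.V (A.prox t m ω)

/-- The local iterate `w_{t+1}^m`, before any averaging over the machines. -/
noncomputable def localIter (t : ℕ) (m : Fin M) (ω : Ω) : Vec d :=
  A.iter t m ω - A.η • (A.V (A.prox t m ω) + A.noise t m ω)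

/-- The residual `z - x - η V x` of the proximal equation at the result of the inner loop. -/
noncomputable def residual (t : ℕ) (m : Fin M) (ω : Ω) : Vec d :=
  A.iter t m ω - A.prox t m ω - A.η • A.V (A.prox t m ω)

/-- The bound for the root mean square distance between `prox` and `exactProx`. -/
noncomputable def proxError : ℝ := innerError A.η A.σ A.G A.H

/-- The bound for the conditional mean of `residual`, given the past. -/
noncomputable def residualBias : ℝ :=
  meanError A.η A.L A.σ A.G A.H + A.η * (A.L * A.proxError)

lemma four_mul_le_proxError : 4 * (A.η * A.σ) ≤ A.proxError := by
  have hη := A.steps.eta_pos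
  have hG := A.regular.bound_nonneg
  have hr := decayRate_nonneg
  have : 0 ≤ decayRate ^ A.H * (A.η * A.G) := by positivity
  unfold proxError innerError
  linarith

lemma proxError_pos : 0 < A.proxError :=
  (mul_pos four_pos (mul_pos A.steps.eta_pos A.steps.sigma_pos)).trans_le A.four_mul_le_proxError

lemma iter_zero (m : Fin M) (ω : Ω) : A.iter 0 m ω = 0 := rfl

lemma iter_succ (t : ℕ) (m : Fin M) (ω : Ω) :
    A.iter (t + 1) m ω =
      if (t + 1) % A.K = 0 then (1 / (M : ℝ)) • ∑ m', A.localIter t m' ω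
      else A.localIter t m ω := by
  simp only [localIter, noise, add_sub_cancel, iter, prox, outerIter]
  split_ifs <;> rfl

lemma exactProx_add (t : ℕ) (m : Fin M) (ω : Ω) :
    A.exactProx t m ω + A.η • A.V (A.exactProx t m ω) = A.iter t m ω :=
  resolvent_add A.regular.toMonotoneLipschitz A.steps.eta_pos _

end Iterates

section Measurability

lemma measurable_iter_of {m₀ : MeasurableSpace Ω} {t : ℕ}
    (hs : ∀ t' ≤ t, ∀ m ℓ, Measurable[m₀] (A.s t' m ℓ))
    (hξ : ∀ t' ≤ t, ∀ m ℓ, Measurable[m₀] (A.ξ t' m ℓ)) (m : Fin M) :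
    Measurable[m₀] (A.iter t m) :=
  measurable_outerIter A.oracle.measurable A.K A.H hs hξ m

lemma measurable_prox_of {m₀ : MeasurableSpace Ω} {t : ℕ} {m : Fin M}
    (hz : Measurable[m₀] (A.iter t m)) (hs : ∀ ℓ, Measurable[m₀] (A.s (t + 1) m ℓ))
    (hξ : ∀ ℓ ≤ A.H, Measurable[m₀] (A.ξ (t + 1) m ℓ)) : Measurable[m₀] (A.prox t m) :=
  measurable_innerIter A.oracle.measurable hz (fun k _ => hs k) hξ

lemma measurable_noise_of {m₀ : MeasurableSpace Ω} {t : ℕ} {m : Fin M}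
    (hx : Measurable[m₀] (A.prox t m)) (hξ : Measurable[m₀] (A.ξ (t + 1) m (A.H + 1))) :
    Measurable[m₀] (A.noise t m) :=
  (measurable_oracle_comp A.oracle.measurable hx hξ).sub (A.regular.measurable.comp hx)

lemma measurable_iter (t : ℕ) (m : Fin M) : Measurable (A.iter t m) :=
  A.measurable_iter_of (fun _ _ _ _ => A.samples.measurable_gauss _ _ _)
    (fun _ _ _ _ => A.samples.measurable_sample _ _ _) m

lemma measurable_prox (t : ℕ) (m : Fin M) : Measurable (A.prox t m) :=
  A.measurable_prox_of (A.measurable_iter t m) (fun _ => A.samples.measurable_gauss _ _ _)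
    (fun _ _ => A.samples.measurable_sample _ _ _)

lemma measurable_exactProx (t : ℕ) (m : Fin M) : Measurable (A.exactProx t m) :=
  (measurable_resolvent A.regular.toMonotoneLipschitz A.steps.eta_pos).comp (A.measurable_iter t m)

/-- The σ-algebra of all samples except the one consumed by machine `m` in the outer step
`t + 1`. -/
@[reducible] def others (t : ℕ) (m : Fin M) : MeasurableSpace Ω :=
  history A.s A.ξ {Sum.inr (t + 1, m, A.H + 1)}ᶜ

/-- The σ-algebra of the samples consumed in the iterations `1, …, t`. -/
@[reducible] def past (t : ℕ) : MeasurableSpace Ω :=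
  history A.s A.ξ {i | Sum.elim (fun j => j.1 ≤ t) (fun j => j.1 ≤ t) i}

lemma others_le (t : ℕ) (m : Fin M) : A.others t m ≤ mΩ := A.samples.history_le _

lemma past_le (t : ℕ) : A.past t ≤ mΩ := A.samples.history_le _

lemma past_le_others (t : ℕ) (m : Fin M) : A.past t ≤ A.others t m := by
  refine biSup_mono fun i hi h => ?_
  rw [Set.mem_singleton_iff.mp h] at hi
  exact absurd hi (by simp)

lemma measurable_iter_past (t : ℕ) (m : Fin M) : Measurable[A.past t] (A.iter t m) :=
  A.measurable_iter_of (fun _ ht _ _ => measurable_gauss_history ht)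
    (fun _ ht _ _ => measurable_sample_history ht) m

lemma measurable_exactProx_past (t : ℕ) (m : Fin M) : Measurable[A.past t] (A.exactProx t m) :=
  (measurable_resolvent A.regular.toMonotoneLipschitz A.steps.eta_pos).comp
    (A.measurable_iter_past t m)

lemma measurable_gauss_others (t : ℕ) (m : Fin M) (t' : ℕ) (m' : Fin M) (ℓ : ℕ) :
    Measurable[A.others t m] (A.s t' m' ℓ) := measurable_gauss_history (by simp)

lemma measurable_sample_others (t : ℕ) (m : Fin M) {t' : ℕ} {m' : Fin M} {ℓ : ℕ}
    (h : (t', m', ℓ) ≠ (t + 1, m, A.H + 1)) : Measurable[A.others t m] (A.ξ t' m' ℓ) :=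
  measurable_sample_history (by simpa using h)

lemma measurable_prox_others (t : ℕ) (m : Fin M) {t' : ℕ} (ht : t' ≤ t) (m' : Fin M) :
    Measurable[A.others t m] (A.prox t' m') :=
  A.measurable_prox_of
    (A.measurable_iter_of (fun _ _ _ _ => A.measurable_gauss_others _ _ _ _ _)
      (fun _ _ _ _ => A.measurable_sample_others _ _ (by simp; omega)) m')
    (fun _ => A.measurable_gauss_others _ _ _ _ _)
    (fun _ _ => A.measurable_sample_others _ _ (by simp; omega))

lemma measurable_noise_others {t : ℕ} {m : Fin M} {t' : ℕ} {m' : Fin M}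
    (h : t' < t ∨ (t' = t ∧ m' ≠ m)) : Measurable[A.others t m] (A.noise t' m') := by
  refine A.measurable_noise_of (A.measurable_prox_others t m (by omega) m')
    (A.measurable_sample_others _ _ ?_)
  rcases h with h | ⟨-, h⟩
  · simp [h.ne]
  · simp [h]

end Measurability

section Independence

lemma indepFun_sample_of_others {β : Type*} [MeasurableSpace β] {t : ℕ} {m : Fin M} {X : Ω → β}
    (hX : Measurable[A.others t m] X) : IndepFun X (A.ξ (t + 1) m (A.H + 1)) P :=
  indepFun_of_indep_of_measurable (A.samples.indep_history disjoint_compl_left) hX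
    (measurable_sample_history (Set.mem_singleton _))

lemma innerSamples (t : ℕ) (m : Fin M) : InnerSamples P ν (A.s t m) (A.ξ t m) where
  measurable_gauss _ := A.samples.measurable_gauss _ _ _
  measurable_sample _ := A.samples.measurable_sample _ _ _
  law_gauss _ := A.samples.law_gauss _ _ _
  law_sample _ := A.samples.law_sample _ _ _
  leave_one_out ℓ := by
    refine ⟨history A.s A.ξ {Sum.inr (t, m, ℓ)}ᶜ, fun k => measurable_gauss_history (by simp),
      fun k hk => measurable_sample_history (by simpa using hk),
      indep_of_indep_of_le_right (A.samples.indep_history disjoint_compl_left) ?_⟩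
    exact (measurable_sample_history (Set.mem_singleton (Sum.inr (t, m, ℓ)))).comap_le

/-- The sequences of samples from which the inner loop of machine `m` in iteration `t + 1` draws. -/
def block (t : ℕ) (m : Fin M) (ω : Ω) : (ℕ → Vec d) × (ℕ → Ξ) :=
  (fun ℓ => A.s (t + 1) m ℓ ω, fun ℓ => A.ξ (t + 1) m ℓ ω)

lemma measurable_block_of {m₀ : MeasurableSpace Ω} {t : ℕ} {m : Fin M}
    (hs : ∀ ℓ, Measurable[m₀] (A.s (t + 1) m ℓ)) (hξ : ∀ ℓ, Measurable[m₀] (A.ξ (t + 1) m ℓ)) :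
    Measurable[m₀] (A.block t m) :=
  Measurable.prodMk (measurable_pi_lambda _ hs) (measurable_pi_lambda _ hξ)

lemma measurable_block (t : ℕ) (m : Fin M) : Measurable (A.block t m) :=
  A.measurable_block_of (fun _ => A.samples.measurable_gauss _ _ _)
    fun _ => A.samples.measurable_sample _ _ _

lemma indepFun_block_of_past {β : Type*} [MeasurableSpace β] {t : ℕ} {m : Fin M} {X : Ω → β}
    (hX : Measurable[A.past t] X) : IndepFun X (A.block t m) P :=
  indepFun_of_indep_of_measurable (A.samples.indep_history disjoint_compl_right) hX
    (A.measurable_block_of (fun _ => measurable_gauss_history (by simp))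
      fun _ => measurable_sample_history (by simp))

/-- The inner loop as a function of its starting point and of the block of its samples. -/
noncomputable def proxMap (p : Vec d × ((ℕ → Vec d) × (ℕ → Ξ))) : Vec d :=
  innerIter A.Vt A.η A.γ A.δ p.1 p.2.1 p.2.2 A.H

lemma measurable_proxMap : Measurable A.proxMap :=
  measurable_innerIter A.oracle.measurable measurable_fst
    (fun k _ => (measurable_pi_apply k).comp (measurable_fst.comp measurable_snd))
    (fun k _ => (measurable_pi_apply k).comp (measurable_snd.comp measurable_snd))

end Independence

section SecondMoments

variable [IsProbabilityMeasure P]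

lemma memLp_noise (t : ℕ) (m : Fin M) : MemLp (A.noise t m) 2 P :=
  A.oracle.memLp_noise A.regular.measurable A.steps.sigma_pos.le (A.measurable_prox t m)
    (A.samples.measurable_sample _ _ _) (A.samples.law_sample _ _ _)
    (A.indepFun_sample_of_others (A.measurable_prox_others t m le_rfl m))

lemma lpNorm_noise_le (t : ℕ) (m : Fin M) : lpNorm (A.noise t m) 2 P ≤ A.σ :=
  A.oracle.lpNorm_noise_le A.regular.measurable A.steps.sigma_pos.le (A.measurable_prox t m)
    (A.samples.measurable_sample _ _ _) (A.samples.law_sample _ _ _)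
    (A.indepFun_sample_of_others (A.measurable_prox_others t m le_rfl m))

lemma integral_inner_noise {t : ℕ} {m : Fin M} {φ : Ω → Vec d} (hφ : Measurable[A.others t m] φ)
    (hφ_memLp : MemLp φ 2 P) : ∫ ω, inner ℝ (φ ω) (A.noise t m ω) ∂P = 0 :=
  A.oracle.integral_inner_noise A.regular.measurable A.steps.sigma_pos.le
    (hφ.mono (A.others_le t m) le_rfl) hφ_memLp (A.measurable_prox t m)
    (A.samples.measurable_sample _ _ _) (A.samples.law_sample _ _ _)
    (A.indepFun_sample_of_others (hφ.prodMk (A.measurable_prox_others t m le_rfl m)))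

lemma eLpNorm_prox_sub_exactProx_le (t : ℕ) (m : Fin M) :
    eLpNorm (fun ω => A.prox t m ω - A.exactProx t m ω) 2 P ≤ ENNReal.ofReal A.proxError := by
  refine eLpNorm_le_of_indepFun (A.measurable_iter t m) (A.measurable_block t m)
    (A.indepFun_block_of_past (A.measurable_iter_past t m))
    (h := fun p => A.proxMap p - resolvent A.V A.η p.1)
    (A.measurable_proxMap.sub ((measurable_resolvent A.regular.toMonotoneLipschitz
      A.steps.eta_pos).comp measurable_fst)) two_ne_zero ENNReal.ofNat_ne_top fun z => ?_
  have hinner := A.innerSamples (t + 1) m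
  have hpath := (memLp_innerPath (η := A.η) (γ := A.γ) (δ := A.δ) A.regular A.steps.sigma_pos.le
    A.oracle hinner z A.H).sub (memLp_const (resolvent A.V A.η z))
  exact (ofReal_lpNorm hpath).ge.trans (ENNReal.ofReal_le_ofReal
    (lpNorm_innerPath_sub_le A.regular A.steps A.oracle hinner z A.H))

lemma memLp_prox_sub_exactProx (t : ℕ) (m : Fin M) :
    MemLp (fun ω => A.prox t m ω - A.exactProx t m ω) 2 P :=
  ⟨((A.measurable_prox t m).sub (A.measurable_exactProx t m)).aestronglyMeasurable,
    (A.eLpNorm_prox_sub_exactProx_le t m).trans_lt ENNReal.ofReal_lt_top⟩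

lemma lpNorm_prox_sub_exactProx_le (t : ℕ) (m : Fin M) :
    lpNorm (fun ω => A.prox t m ω - A.exactProx t m ω) 2 P ≤ A.proxError :=
  lpNorm_le_of_eLpNorm_le A.proxError_pos.le (A.memLp_prox_sub_exactProx t m).aestronglyMeasurable
    (A.eLpNorm_prox_sub_exactProx_le t m)

lemma memLp_V_prox (t : ℕ) (m : Fin M) : MemLp (fun ω => A.V (A.prox t m ω)) 2 P :=
  A.regular.memLp_comp (A.measurable_prox t m).aestronglyMeasurable 2

lemma memLp_V_exactProx (t : ℕ) (m : Fin M) : MemLp (fun ω => A.V (A.exactProx t m ω)) 2 P :=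
  A.regular.memLp_comp (A.measurable_exactProx t m).aestronglyMeasurable 2

lemma memLp_V_prox_sub (t : ℕ) (m : Fin M) :
    MemLp (fun ω => A.V (A.prox t m ω) - A.V (A.exactProx t m ω)) 2 P :=
  (A.memLp_V_prox t m).sub (A.memLp_V_exactProx t m)

lemma memLp_iter (t : ℕ) (m : Fin M) : MemLp (A.iter t m) 2 P := by
  induction t generalizing m with
  | zero => exact memLp_const 0
  | succ t ih =>
    have hlocal : ∀ m, MemLp (A.localIter t m) 2 P := fun m =>
      (ih m).sub (((A.memLp_V_prox t m).add (A.memLp_noise t m)).const_smul A.η)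
    rw [funext (A.iter_succ t m)]
    split_ifs
    · exact (memLp_finsetSum _ fun m _ => hlocal m).const_smul (1 / (M : ℝ))
    · exact hlocal m

lemma memLp_exactProx (t : ℕ) (m : Fin M) : MemLp (A.exactProx t m) 2 P := by
  rw [funext fun ω => eq_sub_of_add_eq (A.exactProx_add t m ω)]
  exact (A.memLp_iter t m).sub ((A.memLp_V_exactProx t m).const_smul A.η)

lemma memLp_prox (t : ℕ) (m : Fin M) : MemLp (A.prox t m) 2 P := by
  simpa [Pi.add_def] using (A.memLp_prox_sub_exactProx t m).add (A.memLp_exactProx t m)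

lemma memLp_residual (t : ℕ) (m : Fin M) : MemLp (A.residual t m) 2 P :=
  ((A.memLp_iter t m).sub (A.memLp_prox t m)).sub ((A.memLp_V_prox t m).const_smul A.η)

end SecondMoments

section ConditionalBias

variable [IsProbabilityMeasure P]

lemma abs_integral_inner_prox_le {t : ℕ} {m : Fin M} {φ : Ω → Vec d}
    (hφ : Measurable[A.past t] φ) (hφ_memLp : MemLp φ 2 P) {f : Vec d × Vec d → Vec d}
    (hf : Measurable f) (hf_memLp : MemLp (fun ω => f (A.iter t m ω, A.prox t m ω)) 2 P) {b : ℝ}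
    (hinteg : ∀ z, Integrable (fun ω => f (z, A.proxMap (z, A.block t m ω))) P)
    (hb : ∀ z, ‖∫ ω, f (z, A.proxMap (z, A.block t m ω)) ∂P‖ ≤ b) :
    |∫ ω, inner ℝ (φ ω) (f (A.iter t m ω, A.prox t m ω)) ∂P| ≤ b * ∫ ω, ‖φ ω‖ ∂P := by
  have hstart : Measurable
      fun p : (Vec d × Vec d) × ((ℕ → Vec d) × (ℕ → Ξ)) => (p.1.2, p.2) := by fun_prop
  exact abs_integral_inner_le_of_indepFun
    ((hφ.mono (A.past_le t) le_rfl).prodMk (A.measurable_iter t m)) (A.measurable_block t m)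
    (A.indepFun_block_of_past (hφ.prodMk (A.measurable_iter_past t m))) measurable_fst
    (h := fun p => f (p.1.2, A.proxMap (p.1.2, p.2)))
    (hf.comp ((measurable_fst.comp hstart).prodMk (A.measurable_proxMap.comp hstart)))
    hφ_memLp hf_memLp (fun p => hinteg p.2) (fun p => hb p.2)

lemma memLp_proxMap_sub (t : ℕ) (m : Fin M) (z : Vec d) :
    MemLp (fun ω => A.proxMap (z, A.block t m ω) - resolvent A.V A.η z) 2 P :=
  (memLp_innerPath A.regular A.steps.sigma_pos.le A.oracle (A.innerSamples (t + 1) m) z A.H).sub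
    (memLp_const _)

lemma integrable_V_proxMap_sub (t : ℕ) (m : Fin M) (z : Vec d) :
    Integrable (fun ω => A.V (A.proxMap (z, A.block t m ω)) - A.V (resolvent A.V A.η z)) P := by
  have hmeas : Measurable fun ω => A.proxMap (z, A.block t m ω) :=
    A.measurable_proxMap.comp (measurable_prodMk_left.comp (A.measurable_block t m))
  exact ((A.regular.memLp_comp hmeas.aestronglyMeasurable 1).integrable le_rfl).sub
    (integrable_const _)

lemma norm_integral_V_proxMap_sub_le (t : ℕ) (m : Fin M) (z : Vec d) :
    ‖∫ ω, (A.V (A.proxMap (z, A.block t m ω)) - A.V (resolvent A.V A.η z)) ∂P‖ ≤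
      A.L * A.proxError := by
  have hmem := A.memLp_proxMap_sub t m z
  calc ‖∫ ω, (A.V (A.proxMap (z, A.block t m ω)) - A.V (resolvent A.V A.η z)) ∂P‖
      ≤ ∫ ω, A.L * ‖A.proxMap (z, A.block t m ω) - resolvent A.V A.η z‖ ∂P :=
        norm_integral_le_of_norm_le ((hmem.integrable one_le_two).norm.const_mul A.L)
          (.of_forall fun _ => A.regular.norm_sub_le _ _)
    _ = A.L * ∫ ω, ‖A.proxMap (z, A.block t m ω) - resolvent A.V A.η z‖ ∂P :=
        integral_const_mul _ _
    _ ≤ A.L * A.proxError :=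
        mul_le_mul_of_nonneg_left ((integral_norm_le_lpNorm_two hmem).trans
          (lpNorm_innerPath_sub_le A.regular A.steps A.oracle (A.innerSamples (t + 1) m) z A.H))
          A.steps.L_pos.le

lemma abs_integral_inner_V_prox_sub_le {t : ℕ} {m : Fin M} {φ : Ω → Vec d}
    (hφ : Measurable[A.past t] φ) (hφ_memLp : MemLp φ 2 P) :
    |∫ ω, inner ℝ (φ ω) (A.V (A.prox t m ω) - A.V (A.exactProx t m ω)) ∂P| ≤
      A.L * A.proxError * ∫ ω, ‖φ ω‖ ∂P :=
  A.abs_integral_inner_prox_le hφ hφ_memLp (f := fun p => A.V p.2 - A.V (resolvent A.V A.η p.1))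
    ((A.regular.measurable.comp measurable_snd).sub (A.regular.measurable.comp
      ((measurable_resolvent A.regular.toMonotoneLipschitz A.steps.eta_pos).comp measurable_fst)))
    (A.memLp_V_prox_sub t m) (A.integrable_V_proxMap_sub t m) (A.norm_integral_V_proxMap_sub_le t m)

lemma abs_integral_inner_residual_le {t : ℕ} {m : Fin M} {φ : Ω → Vec d}
    (hφ : Measurable[A.past t] φ) (hφ_memLp : MemLp φ 2 P) :
    |∫ ω, inner ℝ (φ ω) (A.residual t m ω) ∂P| ≤ A.residualBias * ∫ ω, ‖φ ω‖ ∂P := by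
  have hprox := fun z => (A.memLp_proxMap_sub t m z).integrable one_le_two
  have hV : ∀ z, Integrable (fun ω => A.η • (A.V (A.proxMap (z, A.block t m ω)) -
      A.V (resolvent A.V A.η z))) P := fun z => (A.integrable_V_proxMap_sub t m z).smul A.η
  refine A.abs_integral_inner_prox_le hφ hφ_memLp (f := fun p => p.1 - p.2 - A.η • A.V p.2)
    ((measurable_fst.sub measurable_snd).sub
      ((A.regular.measurable.comp measurable_snd).const_smul A.η))
    (A.memLp_residual t m) (fun z => ?_) (fun z => ?_)
  · simp only [sub_sub_smul_eq A.regular.toMonotoneLipschitz A.steps.eta_pos]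
    exact ((hprox z).add (hV z)).neg
  · have hη := A.steps.eta_pos.le
    simp only [sub_sub_smul_eq A.regular.toMonotoneLipschitz A.steps.eta_pos]
    rw [integral_neg, norm_neg, integral_add (hprox z) (hV z), integral_smul]
    refine (norm_add_le _ _).trans ?_
    rw [norm_smul, Real.norm_of_nonneg hη, residualBias]
    exact add_le_add
      (norm_integral_innerPath_sub_le A.regular A.steps A.oracle (A.innerSamples (t + 1) m) z A.H)
      (mul_le_mul_of_nonneg_left (A.norm_integral_V_proxMap_sub_le t m z) hη)

end ConditionalBias

end Run

section DriftRecursion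

/-- A bound for a nonnegative sequence `Δ` that is reset to `0` every `K` steps and satisfies
`Δ (t + 1) ≤ Δ t + 4 * b * √(Δ t) + v` in between. -/
noncomputable def resetBound (K : ℕ) (b v : ℝ) : ℝ := 16 * (K : ℝ) ^ 2 * b ^ 2 + 2 * K * v

variable {K : ℕ} {η b v : ℝ} {Δ a : ℕ → ℝ}

lemma resetBound_nonneg (hv : 0 ≤ v) : 0 ≤ resetBound K b v := by
  unfold resetBound; positivity

lemma mul_growth_le_resetBound (hv : 0 ≤ v) :
    K * (4 * b * √(resetBound K b v) + v) ≤ resetBound K b v := by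
  have hsq := Real.sq_sqrt (resetBound_nonneg (K := K) (b := b) hv)
  have hyoung := two_mul_le_add_sq (√(resetBound K b v)) (4 * K * b)
  have hU : resetBound K b v = 16 * (K : ℝ) ^ 2 * b ^ 2 + 2 * K * v := rfl
  linarith

lemma growth_le (hb : 0 ≤ b) {t : ℕ} (h_le : Δ t ≤ resetBound K b v) :
    4 * b * √(Δ t) + v ≤ 4 * b * √(resetBound K b v) + v := by
  gcongr

lemma add_one_mod_of_ne_zero {t : ℕ} (hK : 1 ≤ K) (ht : (t + 1) % K ≠ 0) :
    (t + 1) % K = t % K + 1 := by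
  rw [← Nat.mod_add_mod] at ht ⊢
  refine Nat.mod_eq_of_lt (lt_of_le_of_ne (Nat.mod_lt t hK) fun h => ht ?_)
  rw [h, Nat.mod_self]

lemma le_resetBound (hK : 1 ≤ K) (hb : 0 ≤ b) (hv : 0 ≤ v) (h_zero : Δ 0 = 0)
    (h_step : ∀ t, Δ (t + 1) ≤ Δ t + 4 * b * √(Δ t) + v)
    (h_reset : ∀ t, (t + 1) % K = 0 → Δ (t + 1) = 0) (t : ℕ) : Δ t ≤ resetBound K b v := by
  set c := 4 * b * √(resetBound K b v) + v
  have hmod : ∀ t : ℕ, ((t % K : ℕ) : ℝ) * c ≤ resetBound K b v := fun t => by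
    refine le_trans ?_ (mul_growth_le_resetBound hv)
    gcongr
    exact (Nat.mod_lt t hK).le
  refine le_trans ?_ (hmod t)
  induction t with
  | zero => simp [h_zero]
  | succ t ih =>
    by_cases ht : (t + 1) % K = 0
    · simp [h_reset t ht, ht]
    · have hgrowth := growth_le (v := v) hb (ih.trans (hmod t))
      rw [add_one_mod_of_ne_zero hK ht]
      push_cast
      linarith [h_step t]

lemma sum_le_of_le_resetBound (hK : 1 ≤ K) (hη : 0 < η) (hb : 0 ≤ b) (hv : 0 ≤ v) (h_zero : Δ 0 = 0)
    (h_nonneg : ∀ t, 0 ≤ Δ t) (h_le : ∀ t, Δ t ≤ resetBound K b v)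
    (h_step : ∀ t, Δ (t + 1) ≤ Δ t - η * a t + 4 * b * √(Δ t) + v) (n : ℕ) :
    ∑ t ∈ Finset.range n, a t ≤ n * (resetBound K b v / (K * η)) := by
  have hK₀ : (0 : ℝ) < K := by exact_mod_cast hK
  have hgrowth : 4 * b * √(resetBound K b v) + v ≤ resetBound K b v / K := by
    rw [le_div_iff₀' hK₀]; exact mul_growth_le_resetBound hv
  have hterm : ∀ t ∈ Finset.range n, η * a t ≤ (Δ t - Δ (t + 1)) + resetBound K b v / K :=
    fun t _ => by linarith [h_step t, growth_le (v := v) hb (h_le t)]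
  have hsum := Finset.sum_le_sum hterm
  rw [← Finset.mul_sum, Finset.sum_add_distrib, Finset.sum_range_sub', h_zero, Finset.sum_const,
    Finset.card_range, nsmul_eq_mul] at hsum
  rw [← div_div, ← mul_div_assoc, le_div_iff₀' hη]
  linarith [h_nonneg n]

end DriftRecursion

namespace Run

variable {Ξ Ω : Type*} {mΞ : MeasurableSpace Ξ} {mΩ : MeasurableSpace Ω} {P : Measure Ω}
  {ν : Measure Ξ} {d M : ℕ} (A : Run P ν d M)

section Drift

/-- The deviation of the local step from the exact proximal step. -/
noncomputable def localError (t : ℕ) (m : Fin M) (ω : Ω) : Vec d :=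
  (-A.η) • ((A.V (A.prox t m ω) - A.V (A.exactProx t m ω)) + A.noise t m ω)

/-- The bound for the drift, uniform in time because the drift vanishes every `K` steps. -/
noncomputable def driftBound : ℝ :=
  resetBound A.K (A.η * A.L * A.proxError) (7 * A.proxError ^ 2)

/-- The mean square distance of the iterates of two machines. -/
noncomputable def drift (t : ℕ) (m m' : Fin M) : ℝ :=
  ∫ ω, ‖A.iter t m ω - A.iter t m' ω‖ ^ 2 ∂P

/-- The mean Yosida pairing of the iterates of two machines: the decrease of the drift in an exact
proximal step, up to the factor `η`. -/
noncomputable def pairing (t : ℕ) (m m' : Fin M) : ℝ :=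
  ∫ ω, yosidaPairing A.V A.η (A.iter t m ω) (A.iter t m' ω) ∂P

lemma localIter_eq (t : ℕ) (m : Fin M) (ω : Ω) :
    A.localIter t m ω = A.exactProx t m ω + A.localError t m ω := by
  rw [localIter, localError, ← A.exactProx_add]; module

lemma drift_nonneg (t : ℕ) (m m' : Fin M) : 0 ≤ A.drift t m m' :=
  integral_nonneg fun _ => sq_nonneg _

lemma pairing_nonneg (t : ℕ) (m m' : Fin M) : 0 ≤ A.pairing t m m' :=
  integral_nonneg fun _ => yosidaPairing_nonneg A.regular.toMonotoneLipschitz A.steps.eta_pos _ _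

lemma drift_zero (m m' : Fin M) : A.drift 0 m m' = 0 := by simp [drift, iter_zero]

lemma drift_succ_of_mod_eq_zero {t : ℕ} (ht : (t + 1) % A.K = 0) (m m' : Fin M) :
    A.drift (t + 1) m m' = 0 := by
  simp [drift, iter_succ, ht]

lemma drift_succ_le (t : ℕ) (m m' : Fin M) :
    A.drift (t + 1) m m' ≤ ∫ ω, ‖A.localIter t m ω - A.localIter t m' ω‖ ^ 2 ∂P := by
  by_cases ht : (t + 1) % A.K = 0
  · rw [A.drift_succ_of_mod_eq_zero ht]
    exact integral_nonneg fun _ => sq_nonneg _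
  · simp [drift, iter_succ, ht]

lemma eta_mul_L_mul_proxError_nonneg : 0 ≤ A.η * A.L * A.proxError :=
  (mul_pos (mul_pos A.steps.eta_pos A.steps.L_pos) A.proxError_pos).le

variable [IsProbabilityMeasure P]

lemma memLp_iter_sub (t : ℕ) (m m' : Fin M) :
    MemLp (fun ω => A.iter t m ω - A.iter t m' ω) 2 P := (A.memLp_iter t m).sub (A.memLp_iter t m')

lemma memLp_localError (t : ℕ) (m : Fin M) : MemLp (A.localError t m) 2 P :=
  ((A.memLp_V_prox_sub t m).add (A.memLp_noise t m)).const_smul (-A.η)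

lemma lpNorm_localError_le (t : ℕ) (m : Fin M) :
    lpNorm (A.localError t m) 2 P ≤ 5 / 4 * A.proxError := by
  have hη := A.steps.eta_pos
  have hL := A.steps.L_pos
  have hnorm : ∀ ω, ‖A.localError t m ω‖ ≤
      A.η * A.L * ‖A.prox t m ω - A.exactProx t m ω‖ + A.η * ‖A.noise t m ω‖ := fun ω => by
    rw [localError, norm_smul, norm_neg, Real.norm_of_nonneg hη.le, mul_assoc, ← mul_add]
    gcongr
    exact (norm_add_le _ _).trans (by gcongr; exact A.regular.norm_sub_le _ _)
  calc lpNorm (A.localError t m) 2 P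
      ≤ A.η * A.L * lpNorm (fun ω => A.prox t m ω - A.exactProx t m ω) 2 P +
          A.η * lpNorm (A.noise t m) 2 P :=
        lpNorm_le_add_of_norm_le (A.memLp_prox_sub_exactProx t m) (A.memLp_noise t m) one_le_two
          (by positivity) hη.le hnorm
    _ ≤ 1 * A.proxError + A.η * A.σ := by
        gcongr
        · exact lpNorm_nonneg
        · exact A.steps.eta_mul_le
        · exact A.lpNorm_prox_sub_exactProx_le t m
        · exact A.lpNorm_noise_le t m
    _ ≤ 5 / 4 * A.proxError := by linarith [A.four_mul_le_proxError]

lemma abs_integral_inner_localError_le {t : ℕ} {m : Fin M} {φ : Ω → Vec d}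
    (hφ : Measurable[A.past t] φ) (hφ_memLp : MemLp φ 2 P) :
    |∫ ω, inner ℝ (φ ω) (A.localError t m ω) ∂P| ≤
      A.η * A.L * A.proxError * ∫ ω, ‖φ ω‖ ∂P := by
  have hη := A.steps.eta_pos.le
  have hbias := A.abs_integral_inner_V_prox_sub_le (m := m) hφ hφ_memLp
  have hnoise := A.integral_inner_noise (hφ.mono (A.past_le_others t m) le_rfl) hφ_memLp
  simp_rw [localError, inner_smul_right, inner_add_right]
  rw [integral_const_mul, integral_add (integrable_inner_of_memLp hφ_memLp (A.memLp_V_prox_sub t m))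
    (integrable_inner_of_memLp hφ_memLp (A.memLp_noise t m)), hnoise, add_zero, abs_mul, abs_neg,
    abs_of_nonneg hη]
  calc _ ≤ A.η * (A.L * A.proxError * ∫ ω, ‖φ ω‖ ∂P) := mul_le_mul_of_nonneg_left hbias hη
    _ = A.η * A.L * A.proxError * ∫ ω, ‖φ ω‖ ∂P := by ring

lemma integrable_yosidaPairing (t : ℕ) (m m' : Fin M) :
    Integrable (fun ω => yosidaPairing A.V A.η (A.iter t m ω) (A.iter t m' ω)) P :=
  integrable_inner_of_memLp ((A.memLp_V_exactProx t m).sub (A.memLp_V_exactProx t m'))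
    (A.memLp_iter_sub t m m')

lemma pairing_le (t : ℕ) (m m' : Fin M) : A.pairing t m m' ≤ A.L * A.drift t m m' := by
  rw [drift, ← integral_const_mul]
  exact integral_mono (A.integrable_yosidaPairing t m m')
    ((A.memLp_iter_sub t m m').norm.integrable_sq.const_mul _)
    fun _ => yosidaPairing_le A.regular.toMonotoneLipschitz A.steps.eta_pos _ _

lemma memLp_exactProx_sub (t : ℕ) (m m' : Fin M) :
    MemLp (fun ω => A.exactProx t m ω - A.exactProx t m' ω) 2 P :=
  (A.memLp_exactProx t m).sub (A.memLp_exactProx t m')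

lemma integral_norm_exactProx_sub_sq_le (t : ℕ) (m m' : Fin M) :
    ∫ ω, ‖A.exactProx t m ω - A.exactProx t m' ω‖ ^ 2 ∂P ≤
      A.drift t m m' - A.η * A.pairing t m m' := by
  have hdrift := (A.memLp_iter_sub t m m').norm.integrable_sq
  have hpairing := (A.integrable_yosidaPairing t m m').const_mul A.η
  rw [drift, pairing, ← integral_const_mul, ← integral_sub hdrift hpairing]
  exact integral_mono (A.memLp_exactProx_sub t m m').norm.integrable_sq (hdrift.sub hpairing)
    fun _ => norm_resolvent_sub_sq_le A.regular.toMonotoneLipschitz A.steps.eta_pos _ _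

lemma integral_norm_exactProx_sub_le (t : ℕ) (m m' : Fin M) :
    ∫ ω, ‖A.exactProx t m ω - A.exactProx t m' ω‖ ∂P ≤ √(A.drift t m m') := by
  have hmem := A.memLp_iter_sub t m m'
  rw [drift, ← lpNorm_two_eq_sqrt hmem]
  refine le_trans ?_ (integral_norm_le_lpNorm_two hmem)
  exact integral_mono ((A.memLp_exactProx_sub t m m').integrable one_le_two).norm
    (hmem.integrable one_le_two).norm
    fun _ => norm_resolvent_sub_le A.regular.toMonotoneLipschitz A.steps.eta_pos _ _

lemma integral_inner_exactProx_sub_localError_sub_le (t : ℕ) (m m' : Fin M) :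
    ∫ ω, inner ℝ (A.exactProx t m ω - A.exactProx t m' ω)
        (A.localError t m ω - A.localError t m' ω) ∂P ≤
      2 * (A.η * A.L * A.proxError * √(A.drift t m m')) := by
  set φ := fun ω => A.exactProx t m ω - A.exactProx t m' ω
  have hφ : Measurable[A.past t] φ :=
    (A.measurable_exactProx_past t m).sub (A.measurable_exactProx_past t m')
  have hφ_memLp : MemLp φ 2 P := A.memLp_exactProx_sub t m m'
  have hbias := fun m =>
    abs_le.mp (A.abs_integral_inner_localError_le (m := m) hφ hφ_memLp)
  have hinteg := fun m => integrable_inner_of_memLp hφ_memLp (A.memLp_localError t m)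
  have hscale : A.η * A.L * A.proxError * ∫ ω, ‖φ ω‖ ∂P ≤
      A.η * A.L * A.proxError * √(A.drift t m m') :=
    mul_le_mul_of_nonneg_left (A.integral_norm_exactProx_sub_le t m m')
      A.eta_mul_L_mul_proxError_nonneg
  simp_rw [inner_sub_right]
  rw [integral_sub (hinteg m) (hinteg m')]
  linarith [(hbias m).2, (hbias m').1]

lemma integral_norm_localError_sub_sq_le (t : ℕ) (m m' : Fin M) :
    ∫ ω, ‖A.localError t m ω - A.localError t m' ω‖ ^ 2 ∂P ≤ 7 * A.proxError ^ 2 := by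
  have herr := A.memLp_localError t m
  have herr' := A.memLp_localError t m'
  have hnorm : lpNorm (A.localError t m - A.localError t m') 2 P ≤ 5 / 2 * A.proxError := by
    linarith [lpNorm_sub_le herr (g := A.localError t m') one_le_two, A.lpNorm_localError_le t m,
      A.lpNorm_localError_le t m']
  calc ∫ ω, ‖A.localError t m ω - A.localError t m' ω‖ ^ 2 ∂P
      = lpNorm (A.localError t m - A.localError t m') 2 P ^ 2 :=
        (lpNorm_two_sq (herr.sub herr')).symm
    _ ≤ (5 / 2 * A.proxError) ^ 2 := by gcongr; exact lpNorm_nonneg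
    _ ≤ 7 * A.proxError ^ 2 := by linarith [sq_nonneg A.proxError]

lemma integral_norm_localIter_sub_sq_le (t : ℕ) (m m' : Fin M) :
    ∫ ω, ‖A.localIter t m ω - A.localIter t m' ω‖ ^ 2 ∂P ≤
      A.drift t m m' - A.η * A.pairing t m m' +
        4 * (A.η * A.L * A.proxError) * √(A.drift t m m') + 7 * A.proxError ^ 2 := by
  have hsplit : ∀ ω, A.localIter t m ω - A.localIter t m' ω =
      (A.exactProx t m ω - A.exactProx t m' ω) + (A.localError t m ω - A.localError t m' ω) :=
    fun ω => by simp only [localIter_eq]; abel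
  simp_rw [hsplit]
  rw [integral_norm_add_sq (f := fun ω => A.exactProx t m ω - A.exactProx t m' ω)
    (g := fun ω => A.localError t m ω - A.localError t m' ω) (A.memLp_exactProx_sub t m m')
    ((A.memLp_localError t m).sub (A.memLp_localError t m'))]
  linarith [A.integral_norm_exactProx_sub_sq_le t m m',
    A.integral_inner_exactProx_sub_localError_sub_le t m m',
    A.integral_norm_localError_sub_sq_le t m m']

lemma drift_succ_le_add (t : ℕ) (m m' : Fin M) :
    A.drift (t + 1) m m' ≤ A.drift t m m' - A.η * A.pairing t m m' +
      4 * (A.η * A.L * A.proxError) * √(A.drift t m m') + 7 * A.proxError ^ 2 :=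
  (A.drift_succ_le t m m').trans (A.integral_norm_localIter_sub_sq_le t m m')

lemma drift_le_driftBound (t : ℕ) (m m' : Fin M) : A.drift t m m' ≤ A.driftBound :=
  le_resetBound (Δ := fun t => A.drift t m m') A.period_pos A.eta_mul_L_mul_proxError_nonneg
    (by positivity) (A.drift_zero m m')
    (fun t => by
      linarith [A.drift_succ_le_add t m m',
        mul_nonneg A.steps.eta_pos.le (A.pairing_nonneg t m m')])
    (fun _ ht => A.drift_succ_of_mod_eq_zero ht m m') t

lemma sum_pairing_le (n : ℕ) (m m' : Fin M) :
    ∑ t ∈ Finset.range n, A.pairing t m m' ≤ n * (A.driftBound / (A.K * A.η)) :=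
  sum_le_of_le_resetBound (Δ := fun t => A.drift t m m') A.period_pos A.steps.eta_pos
    A.eta_mul_L_mul_proxError_nonneg (by positivity) (A.drift_zero m m')
    (fun t => A.drift_nonneg t m m') (fun t => A.drift_le_driftBound t m m')
    (fun t => A.drift_succ_le_add t m m') n

end Drift

end Run

section Gap

variable {d : ℕ} {L G D : ℝ} {V : Vec d → Vec d}

lemma bddAbove_gap (hV : RegularOperator L G V) (D : ℝ) (x : Vec d) :
    BddAbove ((fun z : Vec d => inner ℝ (V z) (x - z)) '' {z | ‖z‖ ≤ D}) := by
  have hG := hV.bound_nonneg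
  refine ⟨G * (‖x‖ + D), ?_⟩
  rintro _ ⟨z, hz, rfl⟩
  calc inner ℝ (V z) (x - z) ≤ ‖V z‖ * ‖x - z‖ := real_inner_le_norm _ _
    _ ≤ G * (‖x‖ + D) := by
      gcongr
      · exact hV.norm_le z
      · exact (norm_sub_le _ _).trans (by gcongr; exact hz)

lemma gap_le (hD : 0 ≤ D) {x : Vec d} {c : ℝ}
    (h : ∀ z, ‖z‖ ≤ D → inner ℝ (V z) (x - z) ≤ c) : gap V D x ≤ c := by
  refine csSup_le (Set.Nonempty.image _ ⟨0, by simpa using hD⟩) ?_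
  rintro _ ⟨z, hz, rfl⟩
  exact h z hz

lemma lipschitzWith_gap (hV : RegularOperator L G V) (hD : 0 ≤ D) :
    LipschitzWith G.toNNReal (gap V D) := by
  refine LipschitzWith.of_le_add_mul _ fun x y => gap_le hD fun z hz => ?_
  have hsplit : inner ℝ (V z) (x - z) = inner ℝ (V z) (y - z) + inner ℝ (V z) (x - y) := by
    rw [← inner_add_right, sub_add_sub_cancel']
  rw [Real.coe_toNNReal _ hV.bound_nonneg, dist_eq_norm, hsplit]
  gcongr
  · exact le_csSup (bddAbove_gap hV D y) ⟨z, hz, rfl⟩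
  · exact (real_inner_le_norm _ _).trans (by gcongr; exact hV.norm_le z)

lemma integrable_gap {Ω : Type*} [MeasurableSpace Ω] {P : Measure Ω} [IsFiniteMeasure P]
    (hV : RegularOperator L G V) (hD : 0 ≤ D) {x : Ω → Vec d} (hx : Integrable x P) :
    Integrable (fun ω => gap V D (x ω)) P := by
  have hlip := lipschitzWith_gap hV hD
  refine ((hx.norm.const_mul G).add (integrable_const ‖gap V D 0‖)).mono'
    (hlip.continuous.comp_aestronglyMeasurable hx.aestronglyMeasurable) (ae_of_all _ fun ω => ?_)
  have hdist := hlip.dist_le_mul (x ω) 0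
  rw [Real.coe_toNNReal _ hV.bound_nonneg, dist_eq_norm, dist_zero_right] at hdist
  exact (norm_le_norm_sub_add _ _).trans (add_le_add_left hdist _)

end Gap

section FinMean

variable {E : Type*} [NormedAddCommGroup E] [InnerProductSpace ℝ E] {M : ℕ}

/-- The average of a family indexed by the machines; it is `0` for the empty family. -/
noncomputable def finMean (a : Fin M → E) : E := (1 / (M : ℝ)) • ∑ m, a m

lemma finMean_const (hM : 1 ≤ M) (c : E) : finMean (fun _ : Fin M => c) = c := by
  have hM₀ : (M : ℝ) ≠ 0 := by positivity
  rw [finMean, Finset.sum_const, Finset.card_univ, Fintype.card_fin, ← Nat.cast_smul_eq_nsmul ℝ,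
    smul_smul, one_div_mul_cancel hM₀, one_smul]

lemma finMean_add (a b : Fin M → E) :
    finMean (fun m => a m + b m) = finMean a + finMean b := by
  simp only [finMean, Finset.sum_add_distrib, smul_add]

lemma finMean_sub (a b : Fin M → E) :
    finMean (fun m => a m - b m) = finMean a - finMean b := by
  simp only [finMean, Finset.sum_sub_distrib, smul_sub]

lemma finMean_smul (c : ℝ) (a : Fin M → E) : finMean (fun m => c • a m) = c • finMean a := by
  simp only [finMean, ← Finset.smul_sum, smul_comm c]

lemma finMean_sum {ι : Type*} (s : Finset ι) (a : ι → Fin M → E) :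
    finMean (fun m => ∑ i ∈ s, a i m) = ∑ i ∈ s, finMean (a i) := by
  simp only [finMean, ← Finset.smul_sum]
  rw [Finset.sum_comm]

lemma finMean_mono {a b : Fin M → ℝ} (h : ∀ m, a m ≤ b m) : finMean a ≤ finMean b :=
  smul_le_smul_of_nonneg_left (Finset.sum_le_sum fun m _ => h m) (by positivity)

lemma inner_finMean_left (a : Fin M → E) (u : E) :
    inner ℝ (finMean a) u = finMean fun m => inner ℝ (a m) u := by
  rw [finMean, real_inner_smul_left, sum_inner, finMean, smul_eq_mul]

lemma inner_finMean_right (u : E) (a : Fin M → E) :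
    inner ℝ u (finMean a) = finMean fun m => inner ℝ u (a m) := by
  rw [finMean, real_inner_smul_right, inner_sum, finMean, smul_eq_mul]

lemma norm_finMean_le (a : Fin M → E) : ‖finMean a‖ ≤ finMean fun m => ‖a m‖ := by
  rw [finMean, norm_smul, Real.norm_of_nonneg (by positivity)]
  exact mul_le_mul_of_nonneg_left (norm_sum_le _ _) (by positivity)

lemma norm_finMean_sq_le (a : Fin M → E) : ‖finMean a‖ ^ 2 ≤ finMean fun m => ‖a m‖ ^ 2 := by
  refine (pow_le_pow_left₀ (norm_nonneg _) (norm_finMean_le a) 2).trans ?_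
  simpa [finMean, div_eq_inv_mul] using
    sum_div_card_sq_le_sum_sq_div_card (s := (Finset.univ : Finset (Fin M))) (f := fun m => ‖a m‖)

lemma finMean_inner_sub_finMean (hM : 1 ≤ M) (a b : Fin M → E) :
    (finMean fun m => inner ℝ (a m) (b m - finMean b)) =
      1 / 2 * finMean fun m => finMean fun m' => inner ℝ (a m - a m') (b m - b m') := by
  simp only [inner_sub_left, inner_sub_right, finMean_sub, finMean_const hM, ← inner_finMean_left,
    ← inner_finMean_right]
  ring

lemma measurable_finMean {Ω : Type*} [MeasurableSpace E] [BorelSpace E] [SecondCountableTopology E]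
    {m₀ : MeasurableSpace Ω} {f : Fin M → Ω → E} (h : ∀ m, Measurable[m₀] (f m)) :
    Measurable[m₀] fun ω => finMean fun m => f m ω :=
  (Finset.measurable_fun_sum _ fun m _ => h m).const_smul (1 / (M : ℝ))

section Integral

variable {Ω : Type*} [MeasurableSpace Ω] {P : Measure Ω}

lemma memLp_finMean {f : Fin M → Ω → E} {p : ENNReal} (h : ∀ m, MemLp (f m) p P) :
    MemLp (fun ω => finMean fun m => f m ω) p P :=
  (memLp_finsetSum _ fun m _ => h m).const_smul (1 / (M : ℝ))

lemma integrable_finMean {f : Fin M → Ω → E} (h : ∀ m, Integrable (f m) P) :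
    Integrable (fun ω => finMean fun m => f m ω) P :=
  (integrable_finsetSum _ fun m _ => h m).smul (1 / (M : ℝ))

lemma integral_finMean {f : Fin M → Ω → E} (h : ∀ m, Integrable (f m) P) :
    ∫ ω, finMean (fun m => f m ω) ∂P = finMean fun m => ∫ ω, f m ω ∂P := by
  simp only [finMean]
  rw [integral_smul, integral_finsetSum _ fun m _ => h m]

end Integral

end FinMean

lemma norm_sub_smul_add_sub_sq {E : Type*} [NormedAddCommGroup E] [InnerProductSpace ℝ E]
    (η : ℝ) (z v n u : E) :
    ‖z - η • (v + n) - u‖ ^ 2 = ‖z - u‖ ^ 2 -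
      2 * η * (inner ℝ v (z - u) + inner ℝ z n - inner ℝ n u) + η ^ 2 * ‖v + n‖ ^ 2 := by
  rw [sub_right_comm, norm_sub_sq_real, real_inner_smul_right, norm_smul, mul_pow, Real.norm_eq_abs,
    sq_abs, inner_add_right, real_inner_comm v, inner_sub_left _ _ n, real_inner_comm n u]
  ring

/-- At the exact proximal point the residual `z - x - η • V x` vanishes, and
`⟪V x, z - x⟫ = η * ‖V x‖ ^ 2`. -/
lemma norm_sq_add_inner_residual_le {E : Type*} [NormedAddCommGroup E]
    [InnerProductSpace ℝ E] [CompleteSpace E] {L η : ℝ} {V : E → E} (hV : MonotoneLipschitz L V)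
    (hη : 0 < η) (hηL : η * L ≤ 1) (x z : E) :
    η * ‖V x‖ ^ 2 + inner ℝ (V (resolvent V η z)) (z - x - η • V x) ≤
      inner ℝ (V x) (z - x) + 2 * L * ‖x - resolvent V η z‖ ^ 2 := by
  set J := resolvent V η z
  have hnorm : ‖V x - V J‖ ≤ L * ‖x - J‖ := hV.norm_sub_le x J
  have hinner : inner ℝ (V x - V J) (x - J) ≤ L * ‖x - J‖ ^ 2 := by
    calc inner ℝ (V x - V J) (x - J) ≤ ‖V x - V J‖ * ‖x - J‖ := real_inner_le_norm _ _
      _ ≤ L * ‖x - J‖ * ‖x - J‖ := by gcongr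
      _ = L * ‖x - J‖ ^ 2 := by ring
  have hsq : η * ‖V x - V J‖ ^ 2 ≤ L * ‖x - J‖ ^ 2 := by
    have hL := hV.nonneg
    calc η * ‖V x - V J‖ ^ 2 ≤ η * (L * ‖x - J‖) ^ 2 := by gcongr
      _ = η * L * (L * ‖x - J‖ ^ 2) := by ring
      _ ≤ 1 * (L * ‖x - J‖ ^ 2) := by gcongr
      _ = L * ‖x - J‖ ^ 2 := one_mul _
  have hsplit : inner ℝ (V x) (z - x) = η * ‖V x‖ ^ 2 + inner ℝ (V J) (z - x - η • V x) +
      inner ℝ (V x - V J) (z - x - η • V x) := by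
    simp only [inner_sub_left, inner_sub_right, real_inner_smul_right, real_inner_self_eq_norm_sq]
    ring
  have hresidual : inner ℝ (V x - V J) (z - x - η • V x) =
      -(inner ℝ (V x - V J) (x - J) + η * ‖V x - V J‖ ^ 2) := by
    rw [sub_sub_smul_eq hV hη x z, inner_neg_right, inner_add_right, real_inner_smul_right,
      real_inner_self_eq_norm_sq]
  rw [hsplit, hresidual]
  linarith

namespace Run

variable {Ξ Ω : Type*} {mΞ : MeasurableSpace Ξ} {mΩ : MeasurableSpace Ω} {P : Measure Ω}
  {ν : Measure Ξ} {d M : ℕ} (A : Run P ν d M)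

section Averages

/-- The average of the iterates over the machines. -/
noncomputable def meanIter (t : ℕ) (ω : Ω) : Vec d := finMean fun m => A.iter t m ω

/-- The average over the machines of the operator values that drive the outer step. -/
noncomputable def meanOperator (t : ℕ) (ω : Ω) : Vec d := finMean fun m => A.V (A.prox t m ω)

/-- The average of the oracle errors over the machines. -/
noncomputable def meanNoise (t : ℕ) (ω : Ω) : Vec d := finMean fun m => A.noise t m ω

/-- The average of the first `T` points `x_t^m` over the iterations and the machines. -/
noncomputable def output (T : ℕ) (ω : Ω) : Vec d :=
  (1 / (T : ℝ)) • ∑ t ∈ Finset.range T, finMean fun m => A.prox t m ω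

/-- The part of the error of one outer step that does not depend on the comparison point. -/
noncomputable def stepError (t : ℕ) (ω : Ω) : ℝ :=
  A.η / 2 * ‖A.meanOperator t ω + A.meanNoise t ω‖ ^ 2 -
    inner ℝ (A.meanIter t ω) (A.meanNoise t ω) -
    (finMean fun m => inner ℝ (A.V (A.prox t m ω)) (A.iter t m ω - A.prox t m ω)) +
    finMean fun m => inner ℝ (A.V (A.prox t m ω)) (A.iter t m ω - A.meanIter t ω)

lemma meanIter_zero (ω : Ω) : A.meanIter 0 ω = 0 := by
  simp only [meanIter, iter_zero, finMean_const A.machines_pos]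

lemma meanIter_succ (t : ℕ) (ω : Ω) :
    A.meanIter (t + 1) ω = A.meanIter t ω - A.η • (A.meanOperator t ω + A.meanNoise t ω) := by
  have hlocal : A.meanIter (t + 1) ω = finMean fun m => A.localIter t m ω := by
    simp only [meanIter, iter_succ]
    split_ifs
    · exact finMean_const A.machines_pos _
    · rfl
  rw [hlocal]
  simp only [localIter, finMean_sub, finMean_smul, finMean_add]
  rfl

lemma norm_meanIter_succ_sub_sq (t : ℕ) (ω : Ω) (u : Vec d) :
    ‖A.meanIter (t + 1) ω - u‖ ^ 2 = ‖A.meanIter t ω - u‖ ^ 2 -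
      2 * A.η * (inner ℝ (A.meanOperator t ω) (A.meanIter t ω - u) +
        inner ℝ (A.meanIter t ω) (A.meanNoise t ω) - inner ℝ (A.meanNoise t ω) u) +
      A.η ^ 2 * ‖A.meanOperator t ω + A.meanNoise t ω‖ ^ 2 := by
  rw [A.meanIter_succ, norm_sub_smul_add_sub_sq]

lemma finMean_inner_prox_sub (t : ℕ) (ω : Ω) (u : Vec d) :
    (finMean fun m => inner ℝ (A.V (A.prox t m ω)) (A.prox t m ω - u)) =
      inner ℝ (A.meanOperator t ω) (A.meanIter t ω - u) -
      (finMean fun m => inner ℝ (A.V (A.prox t m ω)) (A.iter t m ω - A.prox t m ω)) +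
      finMean fun m => inner ℝ (A.V (A.prox t m ω)) (A.iter t m ω - A.meanIter t ω) := by
  rw [meanOperator, inner_finMean_left, ← finMean_sub, ← finMean_add]
  congr 1 with m
  simp only [inner_sub_right]
  ring

lemma finMean_inner_le (t : ℕ) (ω : Ω) (u : Vec d) :
    (finMean fun m => inner ℝ (A.V u) (A.prox t m ω - u)) ≤
      1 / (2 * A.η) * (‖A.meanIter t ω - u‖ ^ 2 - ‖A.meanIter (t + 1) ω - u‖ ^ 2) +
        A.stepError t ω + inner ℝ (A.meanNoise t ω) u := by
  have hη := A.steps.eta_pos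
  have hmonotone : (finMean fun m => inner ℝ (A.V u) (A.prox t m ω - u)) ≤
      finMean fun m => inner ℝ (A.V (A.prox t m ω)) (A.prox t m ω - u) := finMean_mono fun m => by
    have h := A.regular.monotone (A.prox t m ω) u
    rwa [inner_sub_left, sub_nonneg] at h
  refine hmonotone.trans_eq ?_
  rw [finMean_inner_prox_sub, norm_meanIter_succ_sub_sq, stepError]
  field_simp
  ring

lemma sum_finMean_inner_le {D : ℝ} (T : ℕ) (ω : Ω) {u : Vec d} (hu : ‖u‖ ≤ D) :
    ∑ t ∈ Finset.range T, (finMean fun m => inner ℝ (A.V u) (A.prox t m ω - u)) ≤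
      D ^ 2 / (2 * A.η) + ∑ t ∈ Finset.range T, A.stepError t ω +
        D * ‖∑ t ∈ Finset.range T, A.meanNoise t ω‖ := by
  have hη := A.steps.eta_pos
  refine (Finset.sum_le_sum fun t _ => A.finMean_inner_le t ω u).trans ?_
  rw [Finset.sum_add_distrib, Finset.sum_add_distrib, ← Finset.mul_sum,
    Finset.sum_range_sub' (fun t => ‖A.meanIter t ω - u‖ ^ 2), ← sum_inner, meanIter_zero,
    zero_sub, norm_neg]
  have htelescope : 1 / (2 * A.η) * (‖u‖ ^ 2 - ‖A.meanIter T ω - u‖ ^ 2) ≤ D ^ 2 / (2 * A.η) := by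
    rw [one_div_mul_eq_div]
    gcongr
    exact (sub_le_self _ (sq_nonneg _)).trans (by gcongr)
  have hnoise : inner ℝ (∑ t ∈ Finset.range T, A.meanNoise t ω) u ≤
      D * ‖∑ t ∈ Finset.range T, A.meanNoise t ω‖ := by
    rw [mul_comm]
    exact (real_inner_le_norm _ _).trans (by gcongr)
  linarith

lemma inner_output_sub {T : ℕ} (hT : 1 ≤ T) (ω : Ω) (v u : Vec d) :
    inner ℝ v (A.output T ω - u) =
      1 / T * ∑ t ∈ Finset.range T, finMean fun m => inner ℝ v (A.prox t m ω - u) := by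
  have hT₀ : (T : ℝ) ≠ 0 := by positivity
  simp only [← inner_finMean_right, finMean_sub, finMean_const A.machines_pos]
  rw [← inner_sum, Finset.sum_sub_distrib, ← real_inner_smul_right, output, smul_sub,
    Finset.sum_const, Finset.card_range, ← Nat.cast_smul_eq_nsmul ℝ, smul_smul,
    one_div_mul_cancel hT₀, one_smul]

lemma gap_output_le {D : ℝ} (hD : 0 ≤ D) {T : ℕ} (hT : 1 ≤ T) (ω : Ω) :
    gap A.V D (A.output T ω) ≤ 1 / T * (D ^ 2 / (2 * A.η) +
      ∑ t ∈ Finset.range T, A.stepError t ω + D * ‖∑ t ∈ Finset.range T, A.meanNoise t ω‖) := by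
  refine gap_le hD fun u hu => ?_
  rw [A.inner_output_sub hT]
  exact mul_le_mul_of_nonneg_left (A.sum_finMean_inner_le T ω hu) (by positivity)

end Averages

section Noise

variable [IsProbabilityMeasure P]

lemma integral_inner_noise_noise {t t' : ℕ} {m m' : Fin M} (h : (t, m) ≠ (t', m')) :
    ∫ ω, inner ℝ (A.noise t m ω) (A.noise t' m' ω) ∂P = 0 := by
  rcases lt_trichotomy t t' with hlt | rfl | hlt
  · exact A.integral_inner_noise (A.measurable_noise_others (Or.inl hlt)) (A.memLp_noise t m)
  · exact A.integral_inner_noise (A.measurable_noise_others (Or.inr ⟨rfl, by simpa using h⟩))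
      (A.memLp_noise t m)
  · simp_rw [real_inner_comm (A.noise t' m' _)]
    exact A.integral_inner_noise (A.measurable_noise_others (Or.inl hlt)) (A.memLp_noise t' m')

lemma integral_norm_noise_sq_le (t : ℕ) (m : Fin M) : ∫ ω, ‖A.noise t m ω‖ ^ 2 ∂P ≤ A.σ ^ 2 := by
  rw [← lpNorm_two_sq (A.memLp_noise t m)]
  exact pow_le_pow_left₀ lpNorm_nonneg (A.lpNorm_noise_le t m) 2

lemma integral_norm_sum_noise_sq_le (S : Finset (ℕ × Fin M)) :
    ∫ ω, ‖∑ i ∈ S, A.noise i.1 i.2 ω‖ ^ 2 ∂P ≤ S.card * A.σ ^ 2 := by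
  classical
  induction S using Finset.induction_on with
  | empty => simp
  | insert i S hi ih =>
    have hS : MemLp (fun ω => ∑ j ∈ S, A.noise j.1 j.2 ω) 2 P :=
      memLp_finsetSum _ fun j _ => A.memLp_noise j.1 j.2
    have horth : ∀ j ∈ S, ∫ ω, inner ℝ (A.noise i.1 i.2 ω) (A.noise j.1 j.2 ω) ∂P = 0 :=
      fun j hj => A.integral_inner_noise_noise (ne_of_mem_of_not_mem hj hi).symm
    simp_rw [Finset.sum_insert hi]
    rw [integral_norm_add_sq (A.memLp_noise i.1 i.2) hS, Finset.card_insert_of_notMem hi]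
    simp_rw [inner_sum]
    rw [integral_finsetSum _ fun j _ =>
      integrable_inner_of_memLp (A.memLp_noise i.1 i.2) (A.memLp_noise j.1 j.2),
      Finset.sum_eq_zero horth]
    push_cast
    linarith [A.integral_norm_noise_sq_le i.1 i.2]

lemma memLp_meanNoise (t : ℕ) : MemLp (A.meanNoise t) 2 P := memLp_finMean (A.memLp_noise t)

lemma memLp_sum_meanNoise (s : Finset ℕ) : MemLp (fun ω => ∑ t ∈ s, A.meanNoise t ω) 2 P :=
  memLp_finsetSum _ fun t _ => A.memLp_meanNoise t

lemma integral_norm_sum_meanNoise_sq_le (s : Finset ℕ) :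
    ∫ ω, ‖∑ t ∈ s, A.meanNoise t ω‖ ^ 2 ∂P ≤ s.card * A.σ ^ 2 / M := by
  have hM := A.machines_pos
  have hsum : ∀ ω, ‖∑ t ∈ s, A.meanNoise t ω‖ ^ 2 =
      (1 / (M : ℝ)) ^ 2 * ‖∑ i ∈ s ×ˢ Finset.univ, A.noise i.1 i.2 ω‖ ^ 2 := fun ω => by
    simp only [meanNoise, finMean]
    rw [← Finset.smul_sum, ← Finset.sum_product', norm_smul, mul_pow,
      Real.norm_of_nonneg (by positivity)]
  have hnoise := A.integral_norm_sum_noise_sq_le (s ×ˢ Finset.univ)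
  rw [Finset.card_product, Finset.card_univ, Fintype.card_fin, Nat.cast_mul] at hnoise
  simp_rw [hsum]
  rw [integral_const_mul]
  calc _ ≤ (1 / (M : ℝ)) ^ 2 * (s.card * M * A.σ ^ 2) := by gcongr
    _ = s.card * A.σ ^ 2 / M := by field_simp

lemma integral_norm_sum_meanNoise_le (T : ℕ) :
    ∫ ω, ‖∑ t ∈ Finset.range T, A.meanNoise t ω‖ ∂P ≤ A.σ * √(T / M) := by
  have hσ := A.steps.sigma_pos
  have hmem := A.memLp_sum_meanNoise (Finset.range T)
  refine (integral_norm_le_lpNorm_two hmem).trans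
    (le_of_sq_le_sq ?_ (by positivity))
  rw [lpNorm_two_sq hmem, mul_pow, Real.sq_sqrt (by positivity)]
  refine (A.integral_norm_sum_meanNoise_sq_le _).trans_eq ?_
  rw [Finset.card_range]
  ring

lemma integral_inner_meanNoise {t : ℕ} {φ : Ω → Vec d} (hφ : ∀ m, Measurable[A.others t m] φ)
    (hφ_memLp : MemLp φ 2 P) : ∫ ω, inner ℝ (φ ω) (A.meanNoise t ω) ∂P = 0 := by
  simp_rw [meanNoise, inner_finMean_right]
  rw [integral_finMean fun m => integrable_inner_of_memLp hφ_memLp (A.memLp_noise t m)]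
  simp_rw [fun m => A.integral_inner_noise (hφ m) hφ_memLp]
  exact finMean_const A.machines_pos 0

lemma memLp_meanIter (t : ℕ) : MemLp (A.meanIter t) 2 P := memLp_finMean (A.memLp_iter t)

lemma integral_inner_meanIter_meanNoise (t : ℕ) :
    ∫ ω, inner ℝ (A.meanIter t ω) (A.meanNoise t ω) ∂P = 0 :=
  A.integral_inner_meanNoise (fun m => measurable_finMean fun m' =>
    (A.measurable_iter_past t m').mono (A.past_le_others t m) le_rfl) (A.memLp_meanIter t)

lemma memLp_meanOperator (t : ℕ) : MemLp (A.meanOperator t) 2 P :=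
  memLp_finMean (A.memLp_V_prox t)

lemma integral_norm_meanOperator_sq_le (t : ℕ) :
    ∫ ω, ‖A.meanOperator t ω‖ ^ 2 ∂P ≤
      finMean fun m => ∫ ω, ‖A.V (A.prox t m ω)‖ ^ 2 ∂P := by
  have hinteg := fun m => (A.memLp_V_prox t m).norm.integrable_sq
  rw [← integral_finMean hinteg]
  exact integral_mono (A.memLp_meanOperator t).norm.integrable_sq (integrable_finMean hinteg)
    fun ω => norm_finMean_sq_le _

lemma integral_norm_meanOperator_add_meanNoise_sq_le (t : ℕ) :
    ∫ ω, ‖A.meanOperator t ω + A.meanNoise t ω‖ ^ 2 ∂P ≤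
      (finMean fun m => ∫ ω, ‖A.V (A.prox t m ω)‖ ^ 2 ∂P) + A.σ ^ 2 / M := by
  have horth := A.integral_inner_meanNoise (fun m => measurable_finMean fun m' =>
    A.regular.measurable.comp (A.measurable_prox_others t m le_rfl m')) (A.memLp_meanOperator t)
  have hnoise : ∫ ω, ‖A.meanNoise t ω‖ ^ 2 ∂P ≤ A.σ ^ 2 / M := by
    simpa using A.integral_norm_sum_meanNoise_sq_le {t}
  rw [integral_norm_add_sq (A.memLp_meanOperator t) (A.memLp_meanNoise t)]
  change ∫ ω, inner ℝ (A.meanOperator t ω) _ ∂P = 0 at horth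
  rw [horth]
  linarith [A.integral_norm_meanOperator_sq_le t]

end Noise

end Run

lemma one_div_mul_sqrt_div {T : ℝ} (hT : 0 ≤ T) {M : ℝ} (hM : 0 ≤ M) :
    1 / T * √(T / M) = 1 / √(M * T) := by
  rw [Real.sqrt_div hT, Real.sqrt_mul hM, one_div_mul_eq_div, div_right_comm,
    Real.sqrt_div_self, inv_eq_one_div, div_div, mul_comm]

namespace Run

variable {Ξ Ω : Type*} {mΞ : MeasurableSpace Ξ} {mΩ : MeasurableSpace Ω} {P : Measure Ω}
  {ν : Measure Ξ} {d M : ℕ} (A : Run P ν d M)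

lemma residualBias_nonneg : 0 ≤ A.residualBias := by
  have hη := A.steps.eta_pos
  have hσ := A.steps.sigma_pos
  have hL := A.steps.L_pos
  have hG := A.regular.bound_nonneg
  have herr := A.proxError_pos
  have hdecay := decayRate_nonneg
  unfold residualBias meanError
  positivity

/-- The mean square error of the inner loop, and its effect through the bias of the residual. -/
noncomputable def residualBound : ℝ :=
  A.residualBias ^ 2 / A.η + 5 / 2 * A.L * A.proxError ^ 2

lemma sum_finMean_pairing_le {T : ℕ} {X : ℝ}
    (hX : ∀ m m', ∑ t ∈ Finset.range T, A.pairing t m m' ≤ X) :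
    ∑ t ∈ Finset.range T, (finMean fun m => finMean fun m' => A.pairing t m m') ≤ X := by
  rw [← finMean_sum]
  simp_rw [← finMean_sum]
  have hmean : ∀ m, (finMean fun m' => ∑ t ∈ Finset.range T, A.pairing t m m') ≤ X := fun m =>
    (finMean_mono (hX m)).trans_eq (finMean_const A.machines_pos X)
  exact (finMean_mono hmean).trans_eq (finMean_const A.machines_pos X)

variable [IsProbabilityMeasure P]

section Residual

lemma integral_norm_prox_sub_exactProx_sq_le (t : ℕ) (m : Fin M) :
    ∫ ω, ‖A.prox t m ω - A.exactProx t m ω‖ ^ 2 ∂P ≤ A.proxError ^ 2 := by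
  rw [← lpNorm_two_sq (A.memLp_prox_sub_exactProx t m)]
  exact pow_le_pow_left₀ lpNorm_nonneg (A.lpNorm_prox_sub_exactProx_le t m) 2

lemma integral_norm_V_exactProx_sq_le (t : ℕ) (m : Fin M) :
    ∫ ω, ‖A.V (A.exactProx t m ω)‖ ^ 2 ∂P ≤
      2 * ∫ ω, ‖A.V (A.prox t m ω)‖ ^ 2 ∂P + 2 * (A.L ^ 2 * A.proxError ^ 2) := by
  have hV := (A.memLp_V_prox t m).norm.integrable_sq
  have herr := (A.memLp_prox_sub_exactProx t m).norm.integrable_sq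
  have hnorm : ∀ ω, ‖A.V (A.exactProx t m ω)‖ ^ 2 ≤
      2 * ‖A.V (A.prox t m ω)‖ ^ 2 +
        2 * A.L ^ 2 * ‖A.prox t m ω - A.exactProx t m ω‖ ^ 2 := fun ω => by
    calc ‖A.V (A.exactProx t m ω)‖ ^ 2
        ≤ (‖A.V (A.prox t m ω)‖ + A.L * ‖A.prox t m ω - A.exactProx t m ω‖) ^ 2 := by
          gcongr
          exact (norm_le_norm_add_norm_sub _ _).trans
            (add_le_add_right (A.regular.norm_sub_le _ _) _)
      _ ≤ 2 * (‖A.V (A.prox t m ω)‖ ^ 2 + (A.L * ‖A.prox t m ω - A.exactProx t m ω‖) ^ 2) :=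
          add_sq_le
      _ = _ := by ring
  calc ∫ ω, ‖A.V (A.exactProx t m ω)‖ ^ 2 ∂P
      ≤ ∫ ω, (2 * ‖A.V (A.prox t m ω)‖ ^ 2 +
          2 * A.L ^ 2 * ‖A.prox t m ω - A.exactProx t m ω‖ ^ 2) ∂P :=
        integral_mono (A.memLp_V_exactProx t m).norm.integrable_sq
          ((hV.const_mul _).add (herr.const_mul _)) hnorm
    _ = 2 * ∫ ω, ‖A.V (A.prox t m ω)‖ ^ 2 ∂P +
          2 * A.L ^ 2 * ∫ ω, ‖A.prox t m ω - A.exactProx t m ω‖ ^ 2 ∂P := by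
        rw [integral_add (hV.const_mul _) (herr.const_mul _), integral_const_mul,
          integral_const_mul]
    _ ≤ 2 * ∫ ω, ‖A.V (A.prox t m ω)‖ ^ 2 ∂P + 2 * A.L ^ 2 * A.proxError ^ 2 := by
        gcongr
        exact A.integral_norm_prox_sub_exactProx_sq_le t m
    _ = _ := by ring

lemma integrable_inner_V_prox_iter_sub (t : ℕ) (m : Fin M) :
    Integrable (fun ω => inner ℝ (A.V (A.prox t m ω)) (A.iter t m ω - A.prox t m ω)) P :=
  integrable_inner_of_memLp (A.memLp_V_prox t m) ((A.memLp_iter t m).sub (A.memLp_prox t m))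

lemma integral_norm_sq_add_inner_residual_le (t : ℕ) (m : Fin M) :
    A.η * ∫ ω, ‖A.V (A.prox t m ω)‖ ^ 2 ∂P +
        ∫ ω, inner ℝ (A.V (A.exactProx t m ω)) (A.residual t m ω) ∂P ≤
      ∫ ω, inner ℝ (A.V (A.prox t m ω)) (A.iter t m ω - A.prox t m ω) ∂P +
        2 * A.L * A.proxError ^ 2 := by
  have hV := (A.memLp_V_prox t m).norm.integrable_sq.const_mul A.η
  have hresidual := integrable_inner_of_memLp (A.memLp_V_exactProx t m) (A.memLp_residual t m)
  have hinner := A.integrable_inner_V_prox_iter_sub t m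
  have herr := (A.memLp_prox_sub_exactProx t m).norm.integrable_sq.const_mul (2 * A.L)
  have hmono := integral_mono (hV.add hresidual) (hinner.add herr) fun ω =>
    norm_sq_add_inner_residual_le A.regular.toMonotoneLipschitz A.steps.eta_pos A.steps.eta_mul_le
      (A.prox t m ω) (A.iter t m ω)
  rw [integral_add' hV hresidual, integral_add' hinner herr, integral_const_mul,
    integral_const_mul] at hmono
  refine hmono.trans ?_
  have hL := A.steps.L_pos
  gcongr
  exact A.integral_norm_prox_sub_exactProx_sq_le t m

/-- Young's inequality trades the bias of the residual for a quarter of the mean square of the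
operator. -/
lemma neg_integral_inner_residual_le (t : ℕ) (m : Fin M) :
    -∫ ω, inner ℝ (A.V (A.exactProx t m ω)) (A.residual t m ω) ∂P ≤
      A.residualBias ^ 2 / A.η + A.η / 4 * ∫ ω, ‖A.V (A.exactProx t m ω)‖ ^ 2 ∂P := by
  have hη := A.steps.eta_pos
  have hmem := A.memLp_V_exactProx t m
  have hbias := A.abs_integral_inner_residual_le (m := m)
    (A.regular.measurable.comp (A.measurable_exactProx_past t m)) hmem
  have hnorm := mul_le_mul_of_nonneg_left (integral_norm_le_lpNorm_two hmem) A.residualBias_nonneg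
  refine ((neg_le_abs _).trans hbias).trans (hnorm.trans ?_)
  rw [← lpNorm_two_sq hmem, div_add' _ _ _ hη.ne', le_div_iff₀ hη]
  linarith [two_mul_le_add_sq A.residualBias
    (A.η / 2 * lpNorm (fun ω => A.V (A.exactProx t m ω)) 2 P)]

lemma half_eta_mul_integral_norm_sq_sub_le (t : ℕ) (m : Fin M) :
    A.η / 2 * ∫ ω, ‖A.V (A.prox t m ω)‖ ^ 2 ∂P -
      ∫ ω, inner ℝ (A.V (A.prox t m ω)) (A.iter t m ω - A.prox t m ω) ∂P ≤ A.residualBound := by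
  have hη := A.steps.eta_pos
  have hL := A.steps.L_pos
  have hV := mul_le_mul_of_nonneg_left (A.integral_norm_V_exactProx_sq_le t m)
    (by positivity : 0 ≤ A.η / 4)
  have hscale : A.η * A.L * (A.L * A.proxError ^ 2) ≤ 1 * (A.L * A.proxError ^ 2) := by
    gcongr; exact A.steps.eta_mul_le
  rw [residualBound]
  linarith [A.integral_norm_sq_add_inner_residual_le t m, A.neg_integral_inner_residual_le t m]

end Residual

section MachineDrift

lemma memLp_iter_sub_meanIter (t : ℕ) (m : Fin M) :
    MemLp (fun ω => A.iter t m ω - A.meanIter t ω) 2 P :=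
  (A.memLp_iter t m).sub (A.memLp_meanIter t)

lemma integral_norm_iter_sub_meanIter_le (t : ℕ) (m : Fin M) :
    ∫ ω, ‖A.iter t m ω - A.meanIter t ω‖ ∂P ≤ √A.driftBound := by
  have hinteg := fun m' => ((A.memLp_iter_sub t m m').integrable one_le_two).norm
  have hpair : ∀ m', ∫ ω, ‖A.iter t m ω - A.iter t m' ω‖ ∂P ≤ √A.driftBound := fun m' => by
    refine (integral_norm_le_lpNorm_two (A.memLp_iter_sub t m m')).trans ?_
    rw [lpNorm_two_eq_sqrt (A.memLp_iter_sub t m m')]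
    exact Real.sqrt_le_sqrt (A.drift_le_driftBound t m m')
  have hnorm : ∀ ω, ‖A.iter t m ω - A.meanIter t ω‖ ≤
      finMean fun m' => ‖A.iter t m ω - A.iter t m' ω‖ := fun ω => by
    refine le_trans (le_of_eq ?_) (norm_finMean_le _)
    rw [finMean_sub, finMean_const A.machines_pos]
    rfl
  calc ∫ ω, ‖A.iter t m ω - A.meanIter t ω‖ ∂P
      ≤ ∫ ω, finMean (fun m' => ‖A.iter t m ω - A.iter t m' ω‖) ∂P :=
        integral_mono ((A.memLp_iter_sub_meanIter t m).integrable one_le_two).norm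
          (integrable_finMean hinteg) hnorm
    _ = finMean fun m' => ∫ ω, ‖A.iter t m ω - A.iter t m' ω‖ ∂P := integral_finMean hinteg
    _ ≤ finMean fun _ : Fin M => √A.driftBound := finMean_mono hpair
    _ = √A.driftBound := finMean_const A.machines_pos _

lemma integral_inner_V_prox_sub_exactProx_le (t : ℕ) (m : Fin M) :
    ∫ ω, inner ℝ (A.V (A.prox t m ω) - A.V (A.exactProx t m ω))
      (A.iter t m ω - A.meanIter t ω) ∂P ≤ A.L * A.proxError * √A.driftBound := by
  have hL := A.steps.L_pos
  have herr := A.proxError_pos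
  have hbias := A.abs_integral_inner_V_prox_sub_le (m := m)
    ((A.measurable_iter_past t m).sub (measurable_finMean (A.measurable_iter_past t)))
    (A.memLp_iter_sub_meanIter t m)
  simp_rw [real_inner_comm (A.iter t m _ - A.meanIter t _)]
  refine ((le_abs_self _).trans hbias).trans ?_
  gcongr
  exact A.integral_norm_iter_sub_meanIter_le t m

lemma integrable_inner_V_exactProx_iter_sub (t : ℕ) (m : Fin M) :
    Integrable (fun ω => inner ℝ (A.V (A.exactProx t m ω)) (A.iter t m ω - A.meanIter t ω)) P :=
  integrable_inner_of_memLp (A.memLp_V_exactProx t m) (A.memLp_iter_sub_meanIter t m)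

lemma finMean_integral_inner_V_exactProx (t : ℕ) :
    (finMean fun m => ∫ ω, inner ℝ (A.V (A.exactProx t m ω))
      (A.iter t m ω - A.meanIter t ω) ∂P) =
      1 / 2 * finMean fun m => finMean fun m' => A.pairing t m m' := by
  have hinteg := fun m m' => A.integrable_yosidaPairing t m m'
  rw [← integral_finMean (A.integrable_inner_V_exactProx_iter_sub t)]
  simp_rw [meanIter, finMean_inner_sub_finMean A.machines_pos]
  rw [integral_const_mul]
  congr 1
  exact (integral_finMean fun m => integrable_finMean (hinteg m)).trans
    (congrArg finMean (funext fun m => integral_finMean (hinteg m)))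

lemma integrable_inner_V_prox_iter_sub_meanIter (t : ℕ) (m : Fin M) :
    Integrable (fun ω => inner ℝ (A.V (A.prox t m ω)) (A.iter t m ω - A.meanIter t ω)) P :=
  integrable_inner_of_memLp (A.memLp_V_prox t m) (A.memLp_iter_sub_meanIter t m)

lemma finMean_integral_inner_V_prox_le (t : ℕ) :
    (finMean fun m => ∫ ω, inner ℝ (A.V (A.prox t m ω)) (A.iter t m ω - A.meanIter t ω) ∂P) ≤
      1 / 2 * (finMean fun m => finMean fun m' => A.pairing t m m') +
        A.L * A.proxError * √A.driftBound := by
  have hsplit : ∀ m, ∫ ω, inner ℝ (A.V (A.prox t m ω)) (A.iter t m ω - A.meanIter t ω) ∂P ≤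
      ∫ ω, inner ℝ (A.V (A.exactProx t m ω)) (A.iter t m ω - A.meanIter t ω) ∂P +
        A.L * A.proxError * √A.driftBound := fun m => by
    have h := A.integral_inner_V_prox_sub_exactProx_le t m
    simp_rw [inner_sub_left (A.V _)] at h
    rw [integral_sub (A.integrable_inner_V_prox_iter_sub_meanIter t m)
      (A.integrable_inner_V_exactProx_iter_sub t m)] at h
    linarith
  refine (finMean_mono hsplit).trans_eq ?_
  rw [finMean_add, finMean_integral_inner_V_exactProx, finMean_const A.machines_pos]

end MachineDrift

section Gap

lemma integrable_norm_meanOperator_add_meanNoise_sq (t : ℕ) :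
    Integrable (fun ω => ‖A.meanOperator t ω + A.meanNoise t ω‖ ^ 2) P :=
  ((A.memLp_meanOperator t).add (A.memLp_meanNoise t)).norm.integrable_sq

lemma integrable_inner_meanIter_meanNoise (t : ℕ) :
    Integrable (fun ω => inner ℝ (A.meanIter t ω) (A.meanNoise t ω)) P :=
  integrable_inner_of_memLp (A.memLp_meanIter t) (A.memLp_meanNoise t)

lemma integrable_stepError (t : ℕ) : Integrable (A.stepError t) P :=
  ((((A.integrable_norm_meanOperator_add_meanNoise_sq t).const_mul _).sub
    (A.integrable_inner_meanIter_meanNoise t)).sub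
    (integrable_finMean (A.integrable_inner_V_prox_iter_sub t))).add
    (integrable_finMean (A.integrable_inner_V_prox_iter_sub_meanIter t))

lemma integral_stepError (t : ℕ) :
    ∫ ω, A.stepError t ω ∂P =
      A.η / 2 * ∫ ω, ‖A.meanOperator t ω + A.meanNoise t ω‖ ^ 2 ∂P -
      (finMean fun m => ∫ ω, inner ℝ (A.V (A.prox t m ω)) (A.iter t m ω - A.prox t m ω) ∂P) +
      finMean fun m => ∫ ω, inner ℝ (A.V (A.prox t m ω)) (A.iter t m ω - A.meanIter t ω) ∂P := by
  have hsq := (A.integrable_norm_meanOperator_add_meanNoise_sq t).const_mul (A.η / 2)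
  have hnoise := A.integrable_inner_meanIter_meanNoise t
  have hiter := integrable_finMean (A.integrable_inner_V_prox_iter_sub t)
  have hmean := integrable_finMean (A.integrable_inner_V_prox_iter_sub_meanIter t)
  rw [← integral_finMean (A.integrable_inner_V_prox_iter_sub t),
    ← integral_finMean (A.integrable_inner_V_prox_iter_sub_meanIter t), ← integral_const_mul,
    ← sub_zero (∫ ω, A.η / 2 * _ ∂P), ← A.integral_inner_meanIter_meanNoise t,
    ← integral_sub' hsq hnoise, ← integral_sub' (hsq.sub hnoise) hiter,
    ← integral_add' ((hsq.sub hnoise).sub hiter) hmean]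
  rfl

lemma integral_stepError_le (t : ℕ) :
    ∫ ω, A.stepError t ω ∂P ≤ A.η * A.σ ^ 2 / (2 * M) + A.residualBound +
      1 / 2 * (finMean fun m => finMean fun m' => A.pairing t m m') +
      A.L * A.proxError * √A.driftBound := by
  have hη := A.steps.eta_pos
  have hresidual := finMean_mono (A.half_eta_mul_integral_norm_sq_sub_le t)
  rw [finMean_const A.machines_pos, finMean_sub] at hresidual
  simp_rw [← smul_eq_mul (A.η / 2)] at hresidual
  rw [finMean_smul, smul_eq_mul] at hresidual
  have hsq := mul_le_mul_of_nonneg_left (A.integral_norm_meanOperator_add_meanNoise_sq_le t)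
    (by positivity : 0 ≤ A.η / 2)
  have hvariance : A.η / 2 * (A.σ ^ 2 / M) = A.η * A.σ ^ 2 / (2 * M) := by ring
  rw [integral_stepError]
  linarith [A.finMean_integral_inner_V_prox_le t]

lemma integrable_gap_output {D : ℝ} (hD : 0 ≤ D) (T : ℕ) :
    Integrable (fun ω => gap A.V D (A.output T ω)) P := by
  have hprox : ∀ t, MemLp (fun ω => finMean fun m => A.prox t m ω) 2 P := fun t =>
    memLp_finMean (A.memLp_prox t)
  have hmem : MemLp (A.output T) 2 P :=
    (memLp_finsetSum _ fun t _ => hprox t).const_smul (1 / (T : ℝ))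
  exact integrable_gap A.regular hD (hmem.integrable one_le_two)

lemma integral_gap_output_le_sum {D : ℝ} (hD : 0 ≤ D) {T : ℕ} (hT : 1 ≤ T) :
    ∫ ω, gap A.V D (A.output T ω) ∂P ≤ 1 / T * (D ^ 2 / (2 * A.η) +
      ∑ t ∈ Finset.range T, ∫ ω, A.stepError t ω ∂P + D * (A.σ * √(T / M))) := by
  have hconst : Integrable (fun _ : Ω => D ^ 2 / (2 * A.η)) P := integrable_const _
  have hstep := integrable_finsetSum (Finset.range T) fun t _ => A.integrable_stepError t
  have hsum : Integrable
      (fun ω => D ^ 2 / (2 * A.η) + ∑ t ∈ Finset.range T, A.stepError t ω) P := hconst.add hstep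
  have hnoise :=
    ((A.memLp_sum_meanNoise (Finset.range T)).integrable one_le_two).norm.const_mul D
  calc ∫ ω, gap A.V D (A.output T ω) ∂P
      ≤ ∫ ω, 1 / T * (D ^ 2 / (2 * A.η) + ∑ t ∈ Finset.range T, A.stepError t ω +
          D * ‖∑ t ∈ Finset.range T, A.meanNoise t ω‖) ∂P :=
        integral_mono (A.integrable_gap_output hD T)
          ((hsum.add hnoise).const_mul _) fun ω => A.gap_output_le hD hT ω
    _ = 1 / T * (D ^ 2 / (2 * A.η) + ∑ t ∈ Finset.range T, ∫ ω, A.stepError t ω ∂P +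
          D * ∫ ω, ‖∑ t ∈ Finset.range T, A.meanNoise t ω‖ ∂P) := by
        rw [integral_const_mul, integral_add hsum hnoise, integral_add hconst hstep,
          integral_const_mul, integral_finsetSum _ fun t _ => A.integrable_stepError t,
          integral_const, probReal_univ, one_smul]
    _ ≤ _ := by
        gcongr
        exact A.integral_norm_sum_meanNoise_le T

theorem integral_gap_output_le {D : ℝ} (hD : 0 ≤ D) {T : ℕ} (hT : 1 ≤ T) {X : ℝ}
    (hX : ∀ m m', ∑ t ∈ Finset.range T, A.pairing t m m' ≤ T * X) :
    ∫ ω, gap A.V D (A.output T ω) ∂P ≤ D ^ 2 / (2 * A.η * T) + D * A.σ / √(M * T) +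
      A.η * A.σ ^ 2 / (2 * M) + A.residualBound + (X / 2 + A.L * A.proxError * √A.driftBound) := by
  have hη := A.steps.eta_pos
  have hT₀ : (0 : ℝ) < T := by positivity
  have hsum : ∑ t ∈ Finset.range T, ∫ ω, A.stepError t ω ∂P ≤
      T * (A.η * A.σ ^ 2 / (2 * M) + A.residualBound + (X / 2 +
        A.L * A.proxError * √A.driftBound)) := by
    refine (Finset.sum_le_sum fun t _ => A.integral_stepError_le t).trans ?_
    simp only [Finset.sum_add_distrib, Finset.sum_const, Finset.card_range, nsmul_eq_mul,
      ← Finset.mul_sum]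
    linarith [A.sum_finMean_pairing_le hX]
  have hdiv := mul_le_mul_of_nonneg_left hsum (by positivity : 0 ≤ 1 / (T : ℝ))
  rw [← mul_assoc, one_div_mul_cancel hT₀.ne', one_mul] at hdiv
  have hnoise : 1 / T * (D * (A.σ * √(T / M))) = D * A.σ / √(M * T) := by
    rw [← mul_one_div (D * A.σ), ← one_div_mul_sqrt_div hT₀.le M.cast_nonneg]; ring
  have hstart : 1 / T * (D ^ 2 / (2 * A.η)) = D ^ 2 / (2 * A.η * T) := by field_simp
  refine (A.integral_gap_output_le_sum hD hT).trans ?_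
  rw [mul_add, mul_add, hnoise, hstart]
  linarith

end Gap

end Run

lemma exists_pos_pow_eq_and_rpow_eq {x : ℝ} (hx : 0 < x) {n : ℕ} (hn : n ≠ 0) :
    ∃ y : ℝ, 0 < y ∧ x = y ^ n ∧ ∀ (k : ℕ) (q : ℝ), q * n = k → x ^ q = y ^ k := by
  have hn₀ : (n : ℝ) ≠ 0 := by exact_mod_cast hn
  refine ⟨x ^ (1 / (n : ℝ)), by positivity, ?_, fun k q hq => ?_⟩
  · rw [← Real.rpow_mul_natCast hx.le, one_div_mul_cancel hn₀, Real.rpow_one]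
  · rw [← Real.rpow_mul_natCast hx.le, ← hq, mul_left_comm, one_div_mul_cancel hn₀, mul_one]

lemma div_min_mul_le {a x y c : ℝ} (ha : 0 ≤ a) (hx : 0 < x) (hy : 0 < y) (hc : 0 ≤ c) :
    a / (min x y * c) ≤ a / (x * c) + a / (y * c) := by
  rcases min_choice x y with h | h <;> rw [h]
  · exact le_add_of_nonneg_right (by positivity)
  · exact le_add_of_nonneg_left (by positivity)

section Candidates

/-- The first candidate in `stepSize`. -/
noncomputable def smoothingStep (d K R L σ D : ℝ) : ℝ :=
  D ^ (1 / 2 : ℝ) / (K ^ (1 / 4 : ℝ) * R ^ (1 / 4 : ℝ) * L ^ (1 / 2 : ℝ) * σ ^ (1 / 2 : ℝ) *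
    d ^ (1 / 8 : ℝ))

/-- The second candidate in `stepSize`. -/
noncomputable def biasedDriftStep (d K R L σ D : ℝ) : ℝ :=
  D ^ (2 / 5 : ℝ) / (σ ^ (2 / 5 : ℝ) * L ^ (2 / 5 : ℝ) * d ^ (1 / 10 : ℝ) * K ^ (3 / 5 : ℝ) *
    R ^ (1 / 5 : ℝ))

/-- The third candidate in `stepSize`, which controls the drift between the machines. -/
noncomputable def driftStep (K R L σ D : ℝ) : ℝ :=
  D ^ (2 / 3 : ℝ) / (K ^ (2 / 3 : ℝ) * R ^ (1 / 3 : ℝ) * σ ^ (2 / 3 : ℝ) * L ^ (2 / 3 : ℝ))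

/-- The fourth candidate in `stepSize`, which controls the variance of the averaged oracle. -/
noncomputable def varianceStep (M K R σ D : ℝ) : ℝ :=
  D * √M / (σ * √(K * R))

variable {d M K R L σ D : ℝ}

lemma sq_div_smoothingStep (hd : 0 < d) (hK : 0 < K) (hR : 0 < R) (hL : 0 < L) (hσ : 0 < σ)
    (hD : 0 < D) :
    D ^ 2 / (smoothingStep d K R L σ D * (K * R)) =
      D ^ (3 / 2 : ℝ) * L ^ (1 / 2 : ℝ) * σ ^ (1 / 2 : ℝ) * d ^ (1 / 8 : ℝ) /
        (K ^ (3 / 4 : ℝ) * R ^ (3 / 4 : ℝ)) := by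
  obtain ⟨D, hD, rfl, hDpow⟩ := exists_pos_pow_eq_and_rpow_eq hD two_ne_zero
  obtain ⟨K, hK, rfl, hKpow⟩ := exists_pos_pow_eq_and_rpow_eq hK four_ne_zero
  obtain ⟨R, hR, rfl, hRpow⟩ := exists_pos_pow_eq_and_rpow_eq hR four_ne_zero
  rw [smoothingStep, hDpow 1 (1 / 2) (by norm_num), hDpow 3 (3 / 2) (by norm_num),
    hKpow 1 (1 / 4) (by norm_num), hKpow 3 (3 / 4) (by norm_num), hRpow 1 (1 / 4) (by norm_num),
    hRpow 3 (3 / 4) (by norm_num)]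
  field_simp

lemma sq_div_biasedDriftStep (hd : 0 < d) (hK : 0 < K) (hR : 0 < R) (hL : 0 < L) (hσ : 0 < σ)
    (hD : 0 < D) :
    D ^ 2 / (biasedDriftStep d K R L σ D * (K * R)) =
      D ^ (8 / 5 : ℝ) * σ ^ (2 / 5 : ℝ) * L ^ (2 / 5 : ℝ) * d ^ (1 / 10 : ℝ) /
        (R ^ (4 / 5 : ℝ) * K ^ (2 / 5 : ℝ)) := by
  obtain ⟨D, hD, rfl, hDpow⟩ := exists_pos_pow_eq_and_rpow_eq hD (by norm_num : 5 ≠ 0)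
  obtain ⟨K, hK, rfl, hKpow⟩ := exists_pos_pow_eq_and_rpow_eq hK (by norm_num : 5 ≠ 0)
  obtain ⟨R, hR, rfl, hRpow⟩ := exists_pos_pow_eq_and_rpow_eq hR (by norm_num : 5 ≠ 0)
  rw [biasedDriftStep, hDpow 2 (2 / 5) (by norm_num), hDpow 8 (8 / 5) (by norm_num),
    hKpow 3 (3 / 5) (by norm_num), hKpow 2 (2 / 5) (by norm_num), hRpow 1 (1 / 5) (by norm_num),
    hRpow 4 (4 / 5) (by norm_num)]
  field_simp

lemma sq_div_driftStep (hK : 0 < K) (hR : 0 < R) (hL : 0 < L) (hσ : 0 < σ) (hD : 0 < D) :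
    D ^ 2 / (driftStep K R L σ D * (K * R)) =
      D ^ (4 / 3 : ℝ) * σ ^ (2 / 3 : ℝ) * L ^ (2 / 3 : ℝ) /
        (K ^ (1 / 3 : ℝ) * R ^ (2 / 3 : ℝ)) := by
  obtain ⟨D, hD, rfl, hDpow⟩ := exists_pos_pow_eq_and_rpow_eq hD three_ne_zero
  obtain ⟨K, hK, rfl, hKpow⟩ := exists_pos_pow_eq_and_rpow_eq hK three_ne_zero
  obtain ⟨R, hR, rfl, hRpow⟩ := exists_pos_pow_eq_and_rpow_eq hR three_ne_zero
  rw [driftStep, hDpow 2 (2 / 3) (by norm_num), hDpow 4 (4 / 3) (by norm_num),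
    hKpow 1 (1 / 3) (by norm_num), hKpow 2 (2 / 3) (by norm_num), hRpow 1 (1 / 3) (by norm_num),
    hRpow 2 (2 / 3) (by norm_num)]
  field_simp

lemma sq_div_varianceStep (hM : 0 < M) (hK : 0 < K) (hR : 0 < R) (hσ : 0 < σ) (hD : 0 < D) :
    D ^ 2 / (varianceStep M K R σ D * (K * R)) = D * σ / √(M * K * R) := by
  have hsq : √(K * R) * √(K * R) = K * R := Real.mul_self_sqrt (by positivity)
  rw [varianceStep, mul_assoc M, Real.sqrt_mul hM.le]
  nth_rewrite 2 [← hsq]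
  field_simp

lemma sq_mul_le_of_le_driftStep (hK : 0 < K) (hR : 0 < R) (hL : 0 < L) (hσ : 0 < σ) (hD : 0 < D)
    {η : ℝ} (hη : 0 < η) (h : η ≤ driftStep K R L σ D) :
    η ^ 2 * K * L ^ 2 * σ ^ 2 ≤ D ^ 2 / (η * (K * R)) := by
  obtain ⟨D, -, rfl, hDpow⟩ := exists_pos_pow_eq_and_rpow_eq hD three_ne_zero
  obtain ⟨K, hK, rfl, hKpow⟩ := exists_pos_pow_eq_and_rpow_eq hK three_ne_zero
  obtain ⟨R, hR, rfl, hRpow⟩ := exists_pos_pow_eq_and_rpow_eq hR three_ne_zero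
  obtain ⟨L, hL, rfl, hLpow⟩ := exists_pos_pow_eq_and_rpow_eq hL three_ne_zero
  obtain ⟨σ, hσ, rfl, hσpow⟩ := exists_pos_pow_eq_and_rpow_eq hσ three_ne_zero
  rw [driftStep, hDpow 2 (2 / 3) (by norm_num), hKpow 2 (2 / 3) (by norm_num),
    hRpow 1 (1 / 3) (by norm_num), hLpow 2 (2 / 3) (by norm_num), hσpow 2 (2 / 3) (by norm_num),
    le_div_iff₀ (by positivity)] at h
  rw [le_div_iff₀ (by positivity)]
  calc _ = (η * (K ^ 2 * R ^ 1 * σ ^ 2 * L ^ 2)) ^ 3 := by ring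
    _ ≤ (D ^ 2) ^ 3 := by gcongr
    _ = _ := by ring

lemma mul_sq_div_le_of_le_varianceStep (hM : 0 < M) (hK : 0 < K) (hR : 0 < R) (hσ : 0 < σ)
    {η : ℝ} (h : η ≤ varianceStep M K R σ D) :
    η * σ ^ 2 / M ≤ D * σ / √(M * K * R) := by
  have hsq : √M * √M = M := Real.mul_self_sqrt hM.le
  rw [mul_assoc M, Real.sqrt_mul hM.le]
  calc η * σ ^ 2 / M ≤ varianceStep M K R σ D * σ ^ 2 / M := by gcongr
    _ = D * √M / (σ * √(K * R)) * σ ^ 2 / (√M * √M) := by rw [hsq, varianceStep]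
    _ = _ := by field_simp

end Candidates

/-- The polynomial part of the convergence rate: every candidate `c` in `stepSize` contributes
`D ^ 2 / (c * (K * R))`. -/
noncomputable def rate (d M K R : ℕ) (L σ D : ℝ) : ℝ :=
  (D ^ 2 * L / ((K : ℝ) * (R : ℝ))
      + D * σ / √((M : ℝ) * (K : ℝ) * (R : ℝ))
      + D ^ (4 / 3 : ℝ) * σ ^ (2 / 3 : ℝ) * L ^ (2 / 3 : ℝ) /
          ((K : ℝ) ^ (1 / 3 : ℝ) * (R : ℝ) ^ (2 / 3 : ℝ)))
    + (D ^ (3 / 2 : ℝ) * L ^ (1 / 2 : ℝ) * σ ^ (1 / 2 : ℝ) * (d : ℝ) ^ (1 / 8 : ℝ) /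
          ((K : ℝ) ^ (3 / 4 : ℝ) * (R : ℝ) ^ (3 / 4 : ℝ))
      + D ^ (8 / 5 : ℝ) * σ ^ (2 / 5 : ℝ) * L ^ (2 / 5 : ℝ) * (d : ℝ) ^ (1 / 10 : ℝ) /
          ((R : ℝ) ^ (4 / 5 : ℝ) * (K : ℝ) ^ (2 / 5 : ℝ)))

section StepSize

variable {d M K R : ℕ} {L σ D : ℝ}

lemma stepSize_pos (hd : 1 ≤ d) (hM : 1 ≤ M) (hK : 1 ≤ K) (hR : 1 ≤ R) (hL : 0 < L) (hσ : 0 < σ)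
    (hD : 0 < D) : 0 < stepSize d M K R L σ D := by
  unfold stepSize
  refine lt_min (by positivity) (lt_min (by positivity) (lt_min (by positivity)
    (lt_min (by positivity) (by positivity))))

lemma stepSize_le_driftStep : stepSize d M K R L σ D ≤ driftStep K R L σ D :=
  (min_le_right _ _).trans ((min_le_right _ _).trans (min_le_left _ _))

lemma stepSize_le_varianceStep : stepSize d M K R L σ D ≤ varianceStep M K R σ D :=
  (min_le_right _ _).trans ((min_le_right _ _).trans ((min_le_right _ _).trans (min_le_left _ _)))

lemma stepSize_mul_le_one (hL : 0 < L) : stepSize d M K R L σ D * L ≤ 1 := by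
  rw [← le_div_iff₀ hL]
  exact (min_le_right _ _).trans ((min_le_right _ _).trans ((min_le_right _ _).trans
    (min_le_right _ _)))

lemma sq_div_stepSize_le_rate (hd : 1 ≤ d) (hM : 1 ≤ M) (hK : 1 ≤ K) (hR : 1 ≤ R) (hL : 0 < L)
    (hσ : 0 < σ) (hD : 0 < D) :
    D ^ 2 / (stepSize d M K R L σ D * ((K : ℝ) * R)) ≤ rate d M K R L σ D := by
  have hd₀ : (0 : ℝ) < d := by positivity
  have hM₀ : (0 : ℝ) < M := by positivity
  have hK₀ : (0 : ℝ) < K := by positivity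
  have hR₀ : (0 : ℝ) < R := by positivity
  have hsmoothing : 0 < smoothingStep d K R L σ D := by unfold smoothingStep; positivity
  have hbiased : 0 < biasedDriftStep d K R L σ D := by unfold biasedDriftStep; positivity
  have hdrift : 0 < driftStep K R L σ D := by unfold driftStep; positivity
  have hvariance : 0 < varianceStep M K R σ D := by unfold varianceStep; positivity
  have hlipschitz : 0 < 1 / L := by positivity
  have hsplit {x y : ℝ} (hx : 0 < x) (hy : 0 < y) := div_min_mul_le (sq_nonneg D) hx hy
    (mul_pos hK₀ hR₀).le
  have hmin₄ := lt_min hvariance hlipschitz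
  have hmin₃ := lt_min hdrift hmin₄
  have hmin₂ := lt_min hbiased hmin₃
  have hterm : D ^ 2 / (1 / L * ((K : ℝ) * R)) = D ^ 2 * L / ((K : ℝ) * R) := by field_simp
  change D ^ 2 / (min (smoothingStep d K R L σ D) (min (biasedDriftStep d K R L σ D)
    (min (driftStep K R L σ D) (min (varianceStep M K R σ D) (1 / L)))) * ((K : ℝ) * R)) ≤ _
  rw [rate, ← sq_div_smoothingStep hd₀ hK₀ hR₀ hL hσ hD,
    ← sq_div_biasedDriftStep hd₀ hK₀ hR₀ hL hσ hD, ← sq_div_driftStep hK₀ hR₀ hL hσ hD,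
    ← sq_div_varianceStep hM₀ hK₀ hR₀ hσ hD, ← hterm]
  linarith [hsplit hsmoothing hmin₂, hsplit hbiased hmin₃, hsplit hdrift hmin₄,
    hsplit hvariance hlipschitz]

lemma variance_term_le_rate (hL : 0 ≤ L) (hσ : 0 ≤ σ) (hD : 0 ≤ D) :
    D * σ / √((M : ℝ) * K * R) ≤ rate d M K R L σ D := by
  unfold rate
  exact (le_add_of_nonneg_left (by positivity)).trans
    ((le_add_of_nonneg_right (by positivity)).trans (le_add_of_nonneg_right (by positivity)))

end StepSize

lemma decayRate_pow_sq (H : ℕ) : (decayRate ^ H) ^ 2 = (3 / 4 : ℝ) ^ H := by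
  rw [← pow_mul, mul_comm, pow_mul, decayRate_sq]

namespace Run

variable {Ξ Ω : Type*} {mΞ : MeasurableSpace Ξ} {mΩ : MeasurableSpace Ω} {P : Measure Ω}
  {ν : Measure Ξ} {d M : ℕ} (A : Run P ν d M)

/-- What the inner loop leaves of the squared initial distance, up to the factor `η ^ 2`. -/
noncomputable def innerLoopDecay : ℝ := (3 / 4) ^ A.H * A.G ^ 2

lemma innerLoopDecay_nonneg : 0 ≤ A.innerLoopDecay := by
  unfold innerLoopDecay; positivity

lemma proxError_sq_le :
    A.proxError ^ 2 ≤ 2 * A.η ^ 2 * A.innerLoopDecay + 32 * A.η ^ 2 * A.σ ^ 2 := by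
  calc A.proxError ^ 2
      ≤ 2 * ((decayRate ^ A.H * (A.η * A.G)) ^ 2 + (4 * (A.η * A.σ)) ^ 2) := add_sq_le
    _ = 2 * A.η ^ 2 * ((decayRate ^ A.H) ^ 2 * A.G ^ 2) + 32 * A.η ^ 2 * A.σ ^ 2 := by ring
    _ = _ := by rw [decayRate_pow_sq, innerLoopDecay]

lemma residualBias_le :
    A.residualBias ≤ 4 * (decayRate ^ A.H * (A.η * A.G)) + 9 * (A.η ^ 2 * A.L * A.σ) := by
  have hη := A.steps.eta_pos
  have hG := A.regular.bound_nonneg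
  have hdecay := decayRate_nonneg
  have hle : A.η * A.L * (decayRate ^ A.H * (A.η * A.G)) ≤
      1 * (decayRate ^ A.H * (A.η * A.G)) := by
    gcongr
    exact A.steps.eta_mul_le
  unfold residualBias meanError proxError innerError
  linarith

lemma residualBias_sq_div_le :
    A.residualBias ^ 2 / A.η ≤
      32 * (A.η * A.innerLoopDecay) + 162 * (A.η ^ 3 * A.L ^ 2 * A.σ ^ 2) := by
  rw [div_le_iff₀ A.steps.eta_pos]
  calc A.residualBias ^ 2
      ≤ (4 * (decayRate ^ A.H * (A.η * A.G)) + 9 * (A.η ^ 2 * A.L * A.σ)) ^ 2 :=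
        pow_le_pow_left₀ A.residualBias_nonneg A.residualBias_le 2
    _ ≤ 2 * ((4 * (decayRate ^ A.H * (A.η * A.G))) ^ 2 + (9 * (A.η ^ 2 * A.L * A.σ)) ^ 2) :=
        add_sq_le
    _ = (32 * (A.η * ((decayRate ^ A.H) ^ 2 * A.G ^ 2)) +
          162 * (A.η ^ 3 * A.L ^ 2 * A.σ ^ 2)) * A.η := by ring
    _ = _ := by rw [decayRate_pow_sq, innerLoopDecay]

lemma driftBound_eq : A.driftBound =
    2 * A.K * A.proxError ^ 2 * (8 * (A.K * A.η ^ 2 * A.L ^ 2) + 7) := by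
  unfold driftBound resetBound; ring

lemma driftBound_nonneg : 0 ≤ A.driftBound := resetBound_nonneg (by positivity)

lemma L_mul_proxError_mul_sqrt_driftBound_le :
    A.L * A.proxError * √A.driftBound ≤ A.L * A.driftBound / 3 := by
  have hL := A.steps.L_pos
  have hK : (1 : ℝ) ≤ A.K := by exact_mod_cast A.period_pos
  have hproxError : 3 * A.proxError ≤ √A.driftBound := by
    refine Real.le_sqrt_of_sq_le ?_
    rw [driftBound_eq]
    calc (3 * A.proxError) ^ 2 ≤ 2 * 1 * A.proxError ^ 2 * (8 * 0 + 7) := by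
          linarith [sq_nonneg A.proxError]
      _ ≤ _ := by gcongr; positivity
  calc A.L * A.proxError * √A.driftBound = A.L * (3 * A.proxError * √A.driftBound) / 3 := by ring
    _ ≤ A.L * (√A.driftBound * √A.driftBound) / 3 := by gcongr
    _ = A.L * A.driftBound / 3 := by rw [Real.mul_self_sqrt A.driftBound_nonneg]

lemma L_mul_proxError_mul_sqrt_driftBound_le_div :
    A.L * A.proxError * √A.driftBound ≤ A.driftBound / (A.K * A.η) / 4 := by
  have hη := A.steps.eta_pos
  have hK : (0 : ℝ) < A.K := by exact_mod_cast A.period_pos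
  have hproxError : 4 * (A.K * (A.η * A.L * A.proxError)) ≤ √A.driftBound := by
    refine Real.le_sqrt_of_sq_le ?_
    unfold driftBound resetBound
    have : 0 ≤ 2 * A.K * (7 * A.proxError ^ 2) := by positivity
    linarith
  rw [div_div, le_div_iff₀ (by positivity)]
  calc A.L * A.proxError * √A.driftBound * (A.K * A.η * 4)
      = 4 * (A.K * (A.η * A.L * A.proxError)) * √A.driftBound := by ring
    _ ≤ √A.driftBound * √A.driftBound := by gcongr
    _ = A.driftBound := Real.mul_self_sqrt A.driftBound_nonneg

lemma output_eq (T : ℕ) (ω : Ω) :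
    Slippax.output A.Vt A.η A.γ A.δ A.K A.H T (fun t m ℓ => A.s t m ℓ ω)
      (fun t m ℓ => A.ξ t m ℓ ω) = A.output T ω := by
  unfold Slippax.output output finMean
  rw [Finset.sum_comm, ← Finset.smul_sum, smul_smul, one_div_mul_one_div, mul_comm (T : ℝ),
    Finset.range_eq_Ico]
  exact congrArg _ (Finset.sum_Ico_add' _ 0 T 1).symm

lemma residualBound_add_le :
    A.residualBound + 25 * (A.K * A.L * A.proxError ^ 2) ≤
      87 * (A.K * A.η * A.innerLoopDecay) + 1042 * (A.K * A.L * A.η ^ 2 * A.σ ^ 2) := by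
  have hη := A.steps.eta_pos
  have hL := A.steps.L_pos
  have hηL := A.steps.eta_mul_le
  have hK : (1 : ℝ) ≤ A.K := by exact_mod_cast A.period_pos
  have hdecay := A.innerLoopDecay_nonneg
  have herr : 1 * (A.L * A.proxError ^ 2) ≤ A.K * (A.L * A.proxError ^ 2) := by gcongr
  have herr_le : A.K * A.L * A.proxError ^ 2 ≤
      A.K * A.L * (2 * A.η ^ 2 * A.innerLoopDecay + 32 * A.η ^ 2 * A.σ ^ 2) := by
    gcongr; exact A.proxError_sq_le
  have hdecay_le : A.η * A.L * (A.K * A.η * A.innerLoopDecay) ≤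
      1 * (A.K * A.η * A.innerLoopDecay) := by gcongr
  have hdecay_le_mul : 1 * (A.η * A.innerLoopDecay) ≤ A.K * (A.η * A.innerLoopDecay) := by gcongr
  have hnoise : A.η * A.L * (1 * (A.L * A.η ^ 2 * A.σ ^ 2)) ≤
      1 * (A.K * (A.L * A.η ^ 2 * A.σ ^ 2)) := by gcongr
  unfold residualBound
  linarith [A.residualBias_sq_div_le]

lemma mul_eta_mul_innerLoopDecay_le {L₀ : ℝ} (hL₀ : 0 < L₀) (hL : L₀ ≤ A.L) :
    A.K * A.η * A.innerLoopDecay ≤ 1 / L₀ ^ 3 * (A.K ^ 2 * A.L ^ 2 * A.innerLoopDecay) := by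
  have hη := A.steps.eta_pos
  have hLpos := A.steps.L_pos
  have hdecay := A.innerLoopDecay_nonneg
  have hK : (1 : ℝ) ≤ A.K := by exact_mod_cast A.period_pos
  rw [one_div_mul_eq_div, le_div_iff₀ (by positivity)]
  calc A.K * A.η * A.innerLoopDecay * L₀ ^ 3 ≤ A.K * A.η * A.innerLoopDecay * A.L ^ 3 := by gcongr
    _ = A.K * (A.η * A.L) * A.L ^ 2 * A.innerLoopDecay := by ring
    _ ≤ A.K * A.K * A.L ^ 2 * A.innerLoopDecay := by
        gcongr; exact A.steps.eta_mul_le.trans hK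
    _ = _ := by ring

lemma mul_innerLoopDecay_le : A.K ^ 2 * A.L ^ 2 * A.innerLoopDecay ≤ (3 / 4) ^ A.H *
    (A.G ^ 2 + A.K ^ 2 * A.L ^ 2 * A.G ^ 2 +
      A.H ^ 2 * A.L ^ 2 * (d : ℝ) ^ (1 / 2 : ℝ) * A.G ^ 4 / A.σ ^ 2) := by
  have hG : 0 ≤ A.G ^ 2 := sq_nonneg A.G
  have hlast : 0 ≤ A.H ^ 2 * A.L ^ 2 * (d : ℝ) ^ (1 / 2 : ℝ) * A.G ^ 4 / A.σ ^ 2 := by positivity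
  calc A.K ^ 2 * A.L ^ 2 * A.innerLoopDecay = (3 / 4) ^ A.H * (A.K ^ 2 * A.L ^ 2 * A.G ^ 2) := by
        unfold innerLoopDecay; ring
    _ ≤ _ := by gcongr; linarith

variable [IsProbabilityMeasure P]

/-- The bound `L * driftBound` is used when `K * (η * L) ^ 2 ≤ 1`; otherwise the telescoped bound
`driftBound / (K * η)` is the better one. -/
lemma exists_pairing_bound : ∃ X : ℝ,
    (∀ (T : ℕ) (m m' : Fin M), ∑ t ∈ Finset.range T, A.pairing t m m' ≤ T * X) ∧
      X / 2 + A.L * A.proxError * √A.driftBound ≤ 25 * (A.K * A.L * A.proxError ^ 2) := by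
  have hη := A.steps.eta_pos
  have hL := A.steps.L_pos
  have hK : (0 : ℝ) < A.K := by exact_mod_cast A.period_pos
  rcases le_total (A.K * A.η ^ 2 * A.L ^ 2) 1 with hsmall | hlarge
  · refine ⟨A.L * A.driftBound, fun T m m' => ?_, ?_⟩
    · refine (Finset.sum_le_card_nsmul _ _ (A.L * A.driftBound) fun t _ => ?_).trans_eq (by simp)
      exact (A.pairing_le t m m').trans
        (mul_le_mul_of_nonneg_left (A.drift_le_driftBound t m m') hL.le)
    · have hbound : A.L * A.driftBound ≤ 30 * (A.K * A.L * A.proxError ^ 2) := by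
        rw [driftBound_eq]
        calc _ ≤ A.L * (2 * A.K * A.proxError ^ 2 * (8 * 1 + 7)) := by gcongr
          _ = _ := by ring
      linarith [A.L_mul_proxError_mul_sqrt_driftBound_le]
  · refine ⟨A.driftBound / (A.K * A.η), A.sum_pairing_le, ?_⟩
    have hbound : A.driftBound / (A.K * A.η) ≤ 30 * (A.K * A.L * A.proxError ^ 2) := by
      rw [driftBound_eq, div_le_iff₀ (by positivity)]
      calc _ ≤ 2 * A.K * A.proxError ^ 2 *
            (8 * (A.K * A.η ^ 2 * A.L ^ 2) + 7 * (A.K * A.η ^ 2 * A.L ^ 2)) := by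
            gcongr; linarith
        _ = 30 * (A.K * A.L * A.proxError ^ 2) * (A.K * A.η) * (A.η * A.L) := by ring
        _ ≤ 30 * (A.K * A.L * A.proxError ^ 2) * (A.K * A.η) * 1 := by
            gcongr; exact A.steps.eta_mul_le
        _ = _ := mul_one _
    have : 0 ≤ A.K * A.L * A.proxError ^ 2 := by positivity
    linarith [A.L_mul_proxError_mul_sqrt_driftBound_le_div]

/-- Because `L ≥ L₀`, the drift term also dominates the error of the inner loop, at the cost of a
factor `1 / L₀`. -/
theorem integral_gap_output_le_of_terms_le {D : ℝ} (hD : 0 ≤ D) {T : ℕ} (hT : 1 ≤ T) {L₀ B : ℝ}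
    (hL₀ : 0 < L₀) (hL : L₀ ≤ A.L) (hstart : D ^ 2 / (A.η * T) ≤ B)
    (hnoise : D * A.σ / √(M * T) ≤ B) (hvariance : A.η * A.σ ^ 2 / M ≤ B)
    (hdrift : A.η ^ 2 * A.K * A.L ^ 2 * A.σ ^ 2 ≤ B) :
    ∫ ω, gap A.V D (A.output T ω) ∂P ≤ (2 + 1042 / L₀ + 87 / L₀ ^ 3) *
      (B + A.K ^ 2 * A.L ^ 2 * A.innerLoopDecay) := by
  have hη := A.steps.eta_pos
  have hLpos := A.steps.L_pos
  have hdecay := A.innerLoopDecay_nonneg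
  obtain ⟨X, hX, hX_le⟩ := A.exists_pairing_bound
  have hgap := A.integral_gap_output_le hD hT (hX T)
  have hB : 0 ≤ B := (by positivity : 0 ≤ D ^ 2 / (A.η * T)).trans hstart
  have hdrift_le : A.K * A.L * A.η ^ 2 * A.σ ^ 2 ≤ 1 / L₀ * B := by
    rw [one_div_mul_eq_div, le_div_iff₀ hL₀]
    calc _ ≤ A.K * A.L * A.η ^ 2 * A.σ ^ 2 * A.L := by gcongr
      _ = A.η ^ 2 * A.K * A.L ^ 2 * A.σ ^ 2 := by ring
      _ ≤ B := hdrift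
  rw [show D ^ 2 / (2 * A.η * T) = D ^ 2 / (A.η * T) / 2 by rw [div_div]; ring_nf,
    show A.η * A.σ ^ 2 / (2 * M) = A.η * A.σ ^ 2 / M / 2 by rw [div_div, mul_comm (M : ℝ)]] at hgap
  calc ∫ ω, gap A.V D (A.output T ω) ∂P
      ≤ 2 * B + 1042 * (1 / L₀ * B) +
          87 * (1 / L₀ ^ 3 * (A.K ^ 2 * A.L ^ 2 * A.innerLoopDecay)) := by
        linarith [A.residualBound_add_le, A.mul_eta_mul_innerLoopDecay_le hL₀ hL]
    _ = (2 + 1042 / L₀) * B + 87 / L₀ ^ 3 * (A.K ^ 2 * A.L ^ 2 * A.innerLoopDecay) := by ring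
    _ ≤ (2 + 1042 / L₀ + 87 / L₀ ^ 3) * B + (2 + 1042 / L₀ + 87 / L₀ ^ 3) *
          (A.K ^ 2 * A.L ^ 2 * A.innerLoopDecay) :=
        add_le_add
          (mul_le_mul_of_nonneg_right (le_add_of_nonneg_right (by positivity)) hB)
          (mul_le_mul_of_nonneg_right (le_add_of_nonneg_left (by positivity)) (by positivity))
    _ = _ := (mul_add _ _ _).symm

theorem integral_gap_output_le_rate {R : ℕ} (hR : 1 ≤ R) {D L₀ : ℝ} (hD : 0 < D) (hL₀ : 0 < L₀)
    (hL : L₀ ≤ A.L) (hη : A.η = stepSize d M A.K R A.L A.σ D) :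
    ∫ ω, gap A.V D (A.output (A.K * R) ω) ∂P ≤ (2 + 1042 / L₀ + 87 / L₀ ^ 3) *
      (rate d M A.K R A.L A.σ D + A.K ^ 2 * A.L ^ 2 * A.innerLoopDecay) := by
  have hLpos := A.steps.L_pos
  have hσ := A.steps.sigma_pos
  have hM : (0 : ℝ) < M := by exact_mod_cast A.machines_pos
  have hK : (0 : ℝ) < A.K := by exact_mod_cast A.period_pos
  have hR₀ : (0 : ℝ) < R := by positivity
  have hstart : D ^ 2 / (A.η * (A.K * R)) ≤ rate d M A.K R A.L A.σ D := hη ▸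
    sq_div_stepSize_le_rate A.steps.dim_pos A.machines_pos A.period_pos hR hLpos hσ hD
  have hnoise : D * A.σ / √(M * A.K * R) ≤ rate d M A.K R A.L A.σ D :=
    variance_term_le_rate hLpos.le hσ.le hD.le
  refine A.integral_gap_output_le_of_terms_le hD.le (Nat.mul_pos A.period_pos hR) hL₀ hL ?_ ?_ ?_ ?_
  · rwa [Nat.cast_mul]
  · rwa [Nat.cast_mul, ← mul_assoc]
  · exact (mul_sq_div_le_of_le_varianceStep hM hK hR₀ hσ
      (hη.trans_le stepSize_le_varianceStep)).trans hnoise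
  · exact (sq_mul_le_of_le_driftStep hK hR₀ hLpos hσ hD A.steps.eta_pos
      (hη.trans_le stepSize_le_driftStep)).trans hstart

end Run

end Slippax

theorem mainTheorem7 (L₀ : ℝ) (hL₀ : 0 < L₀) :
    ∃ C : ℝ, 0 < C ∧
      ∀ (d M K R H : ℕ) (_ : 1 ≤ d) (_ : 1 ≤ M) (_ : 1 ≤ K) (_ : 1 ≤ R) (_ : 1 ≤ H)
        (L σ D G : ℝ) (_ : L₀ ≤ L) (_ : 0 < σ) (_ : 0 < D)
        (V : Slippax.Vec d → Slippax.Vec d)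
        (_ : Slippax.SmoothOperator L V) (_ : Slippax.MonotoneOperator V) (_ : ∀ x, ‖V x‖ ≤ G)
        (Ξ : Type*) [MeasurableSpace Ξ] (ν : MeasureTheory.Measure Ξ)
        [MeasureTheory.IsProbabilityMeasure ν]
        (Vt : Slippax.Vec d → Ξ → Slippax.Vec d) (_ : Slippax.UnbiasedOracle ν Vt V σ)
        (Ω : Type*) [MeasurableSpace Ω] (P : MeasureTheory.Measure Ω)
        [MeasureTheory.IsProbabilityMeasure P]
        (s : ℕ → Fin M → ℕ → Ω → Slippax.Vec d) (ξ : ℕ → Fin M → ℕ → Ω → Ξ)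
        (_ : Slippax.IndependentSamples P ν s ξ)
        (η γ δ : ℝ) (_ : η = Slippax.stepSize d M K R L σ D)
        (_ : γ = Slippax.innerStepSize η L) (_ : δ = Slippax.smoothingRadius d η σ)
        (xo : Ω → Slippax.Vec d)
        (_ : ∀ ω, xo ω = Slippax.output Vt η γ δ K H (K * R)
          (fun t m ℓ => s t m ℓ ω) (fun t m ℓ => ξ t m ℓ ω)),
        MeasureTheory.Integrable (fun ω => Slippax.gap V D (xo ω)) P ∧
        ∫ ω, Slippax.gap V D (xo ω) ∂P ≤
          C * ((D ^ 2 * L / ((K : ℝ) * (R : ℝ))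
                + D * σ / √((M : ℝ) * (K : ℝ) * (R : ℝ))
                + D ^ (4 / 3 : ℝ) * σ ^ (2 / 3 : ℝ) * L ^ (2 / 3 : ℝ) /
                    ((K : ℝ) ^ (1 / 3 : ℝ) * (R : ℝ) ^ (2 / 3 : ℝ)))
              + (D ^ (3 / 2 : ℝ) * L ^ (1 / 2 : ℝ) * σ ^ (1 / 2 : ℝ) * (d : ℝ) ^ (1 / 8 : ℝ) /
                    ((K : ℝ) ^ (3 / 4 : ℝ) * (R : ℝ) ^ (3 / 4 : ℝ))
                + D ^ (8 / 5 : ℝ) * σ ^ (2 / 5 : ℝ) * L ^ (2 / 5 : ℝ) * (d : ℝ) ^ (1 / 10 : ℝ) /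
                    ((R : ℝ) ^ (4 / 5 : ℝ) * (K : ℝ) ^ (2 / 5 : ℝ)))
              + (3 / 4 : ℝ) ^ H *
                  (G ^ 2 + (K : ℝ) ^ 2 * L ^ 2 * G ^ 2
                    + (H : ℝ) ^ 2 * L ^ 2 * (d : ℝ) ^ (1 / 2 : ℝ) * G ^ 4 / σ ^ 2)) := by
  refine ⟨2 + 1042 / L₀ + 87 / L₀ ^ 3, by positivity, ?_⟩
  intro d M K R H hd hM hK hR _ L σ D G hL hσ hD V hSmooth hMono hBound Ξ _ ν _ Vt hOracle
    Ω _ P _ s ξ hSamples η γ δ hη hγ hδ xo hxo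
  have hLpos : 0 < L := hL₀.trans_le hL
  have hηpos : 0 < η := hη ▸ Slippax.stepSize_pos hd hM hK hR hLpos hσ hD
  have hηL : η * L ≤ 1 := hη ▸ Slippax.stepSize_mul_le_one hLpos
  let A : Slippax.Run P ν d M :=
    { K, H, L, σ, G, η, γ, δ, V, Vt, s, ξ
      machines_pos := hM
      period_pos := hK
      regular := ⟨⟨hLpos.le, hMono, hSmooth⟩, hBound⟩
      steps := ⟨hd, hLpos, hσ, hηpos, hηL, hγ, hδ⟩
      oracle := hOracle
      samples := hSamples }
  obtain rfl : xo = A.output (K * R) := funext fun ω => (hxo ω).trans (A.output_eq (K * R) ω)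
  refine ⟨A.integrable_gap_output hD.le (K * R),
    (A.integral_gap_output_le_rate hR hD hL₀ hL hη).trans ?_⟩
  exact mul_le_mul_of_nonneg_left (add_le_add_right A.mul_innerLoopDecay_le _) (by positivity)
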